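/- Setting. Let $G\subset\mathbb R^3$ be a bounded open set with $C^\infty$ boundary (that is, $\overline G$ is a $C^\infty$ submanifold of $\mathbb R^3$ with boundary) whose closure is strictly convex, and let $\nu$ be its outward unit normal. Let $S=S'$ be the unit sphere of $\mathbb R^3$ with surface measure $d\omega$, and let $I=[E_0,E_m]$ with $0\le E_0<E_m<\infty$ and $I^\circ=(E_0,E_m)$. Put $$\Gamma_-=\{(y,\omega,E)\in\partial G\times S\times I:\ \omega\cdot\nu(y)<0\},\qquad \Gamma_0=\{(y,\omega,E)\in\partial G\times S\times I:\ \omega\cdot\nu(y)=0\}.$$ Spaces. Let $m\in\mathbb N_0$. * $H^{(m,0,0)}(G\times S\times I)$ is the space of real $\psi\in L^2(G\times S\times I)$ whose weak derivatives $\partial_x^\alpha\psi$, $|\alpha|\le m$, lie in $L^2(G\times S\times I)$, with norm $\big(\sum_{|\alpha|\le m}\|\partial_x^\alpha\psi\|_{L^2}^2\big)^{1/2}$. * For a Banach space $X$ and $k\in\mathbb N\cup\{\infty\}$, $C_0^{(k,0,0)}(\overline G\times S\times I,X,\Gamma_-)$ is the set of restrictions to $G\times S\times I^\circ$ of compactly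 supported functions $f:\mathbb R^3\times S\times\mathbb R\to X$ all of whose derivatives $\partial_x^\alpha f$, $|\alpha|\le k$, exist and are continuous in $(x,\omega,E)$, such that the support of the restriction, taken in $\overline G\times S\times I$, is disjoint from $\Gamma_-\cup\Gamma_0$. * $H_0^{(m,0,0)}(G\times S\times I,\Gamma_-)$ is the completion (equivalently, the closure in $H^{(m,0,0)}(G\times S\times I)$) of $\bigcap_{k\ge1}C_0^{(k,0,0)}(\overline G\times S\times I,\mathbb R,\Gamma_-)$ in the $H^{(m,0,0)}$-norm. * For a function $\sigma=\sigma(x,\omega',\omega,E)$ on $G\times S'\times S\times I$ with weak derivatives $\partial_x^\alpha\sigma$, $|\alpha|\le m$, put $$N_1(\sigma)=\max_{|\alpha|\le m}\ \operatorname*{ess\,sup}_{(x,\omega,E)\in G\times S\times I}\int_{S'}|\partial_x^\alpha\sigma(x,\omega',\omega,E)|\,d\omega',$$ $$N_2(\sigma)=\max_{|\alpha|\le m}\ \operatorname*{ess\,sup}_{(x,\omega',E)\in G\times S'\times I}\int_{S}|\partial_x^\alpha\sigma(x,\omega',\omega,E)|\,d\omega ;$$ these are the norms of $W^{\infty,(m,0,0)}(G\times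 S\times I,L^1(S'))$ and of $W^{\infty,(m,0,0)}(G\times S'\times I,L^1(S))$. * $\mathcal W_0^{\infty,(m,0,0)}(G\times S\times I,L^1(S'),\Gamma_-)$ is the completion of $C_0^{(\infty,0,0)}(\overline G\times S\times I,L^1(S'),\Gamma_-)\cap W^{\infty,(m,0,0)}(G\times S'\times I,L^1(S))$ with respect to the norm $N_1+N_2$; its elements are regarded as functions on $G\times S'\times S\times I$. Theorem. For every $m\in\mathbb N_0$ there is a constant $C_m>0$, depending only on $m$, such that the following holds for all $G$ and $I$ as above. Let $\sigma^2:G\times S'\times S\times I\to[0,\infty)$ be a Borel measurable function with $\sigma^2\in\mathcal W_0^{\infty,(m,0,0)}(G\times S\times I,L^1(S'),\Gamma_-)$. Then, for every $\psi\in H^{(m,0,0)}(G\times S\times I)$, the integral $$(K_r^2\psi)(x,\omega,E)=\int_{S'}\sigma^2(x,\omega',\omega,E)\,\psi(x,\omega',E)\,d\omega'$$ converges absolutely for a.e. $(x,\omega,E)\in G\times S\times I$ and does not depend, up to null sets, on the representative of $\psi$; $K_r^2$ is a bounded linear operator from $H^{(m,0,0)}(G\times S\times I)$ to $H_0^{(m,0,0)}(G\times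 S\times I,\Gamma_-)$; the norms $N_1(\sigma^2)$ and $N_2(\sigma^2)$ are finite; and $$\|K_r^2\|^2\le C_m\,N_1(\sigma^2)\,N_2(\sigma^2).$$ -/

import Mathlib

open Set Filter Topology MeasureTheory

noncomputable section

namespace Transport

/-- The Euclidean space `ℝ³`. -/
abbrev E3 : Type := EuclideanSpace ℝ (Fin 3)

/-- The unit sphere `S ⊂ ℝ³`. -/
abbrev S2 : Type := Metric.sphere (0 : E3) 1

/-- The usual surface measure `dω` on `S` (total mass `4π`). -/
def sphereMeasure : Measure S2 := (volume : Measure E3).toSphere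

/-- The ambient space of the variables `(x, ω, E)`. -/
abbrev Phase : Type := E3 × (S2 × ℝ)

/-- The ambient space of the variables `(x, ω', ω, E)`. -/
abbrev KernelDom : Type := E3 × (S2 × (S2 × ℝ))

/-! ### The spatial domain and its boundary -/

/-- `ρ` is a smooth local defining function of `G` at the boundary point `y`. -/
def IsLocalDefining (G : Set E3) (y : E3) (ρ : E3 → ℝ) : Prop :=
  ContDiff ℝ (⊤ : ℕ∞) ρ ∧ ρ y = 0 ∧ gradient ρ y ≠ 0 ∧ ∀ᶠ x in 𝓝 y, (x ∈ G ↔ ρ x < 0)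

/-- The boundary of `G` is of class `C^∞`: near each boundary point `G` is the sublevel set
`{ρ < 0}` of a smooth function with non-vanishing gradient, i.e. the closure of `G` is a smooth
three-dimensional submanifold with boundary. -/
def HasSmoothBoundary (G : Set E3) : Prop :=
  ∀ y ∈ frontier G, ∃ ρ : E3 → ℝ, IsLocalDefining G y ρ

/-- `n` is the outward unit normal `ν(y)` of `G` at `y`. -/
def IsOutwardNormal (G : Set E3) (y n : E3) : Prop :=
  ∃ ρ : E3 → ℝ, IsLocalDefining G y ρ ∧ n = ‖gradient ρ y‖⁻¹ • gradient ρ y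

/-- The inflow boundary `Γ₋`. -/
def GammaMinus (G : Set E3) (E₀ Em : ℝ) : Set Phase :=
  {p | p.1 ∈ frontier G ∧ p.2.2 ∈ Icc E₀ Em ∧
    ∃ n, IsOutwardNormal G p.1 n ∧ inner ℝ (p.2.1 : E3) n < 0}

/-- The characteristic boundary `Γ₀`. -/
def GammaZero (G : Set E3) (E₀ Em : ℝ) : Set Phase :=
  {p | p.1 ∈ frontier G ∧ p.2.2 ∈ Icc E₀ Em ∧
    ∃ n, IsOutwardNormal G p.1 n ∧ inner ℝ (p.2.1 : E3) n = 0}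

/-- The measure `dx dω dE` on `G × S × I`. -/
def phaseMeasure (G : Set E3) (E₀ Em : ℝ) : Measure Phase :=
  (volume.restrict G).prod (sphereMeasure.prod (volume.restrict (Icc E₀ Em)))

/-- The measure `dx dω' dω dE` on `G × S' × S × I`. -/
def kernelMeasure (G : Set E3) (E₀ Em : ℝ) : Measure KernelDom :=
  (volume.restrict G).prod
    (sphereMeasure.prod (sphereMeasure.prod (volume.restrict (Icc E₀ Em))))

/-! ### Spatial derivatives, classical and weak -/

/-- The partial derivative `∂g/∂x_i`. -/
def pd (i : Fin 3) (g : E3 → ℝ) : E3 → ℝ :=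
  fun x => fderiv ℝ g x (EuclideanSpace.single i 1)

/-- The spatial partial derivative `∂_x^α φ` of a function of `x` and further variables `y`. -/
def xPartial {Y : Type*} (α : Fin 3 → ℕ) (φ : E3 × Y → ℝ) : E3 × Y → ℝ :=
  fun p => ((pd 0)^[α 0] ((pd 1)^[α 1] ((pd 2)^[α 2] (fun x => φ (x, p.2))))) p.1

/-- The class `C^{(k,0,…)}(ℝ³ × Y)`: all spatial derivatives of order at most `k` exist and are
jointly continuous. The values lie in a normed space `X`. -/
def ClassCX {Y X : Type*} [TopologicalSpace Y] [NormedAddCommGroup X] [NormedSpace ℝ X]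
    (k : ℕ∞) (f : E3 × Y → X) : Prop :=
  (∀ y, ContDiff ℝ k (fun x => f (x, y))) ∧
    ∀ n : ℕ, (n : ℕ∞) ≤ k →
      Continuous fun p : E3 × Y => iteratedFDeriv ℝ n (fun x => f (x, p.2)) p.1

/-- Test functions on `G × V`: smooth in `x` with jointly continuous spatial derivatives, and
compactly supported in `G × V`. -/
def IsTest {Y : Type*} [TopologicalSpace Y] (G : Set E3) (V : Set Y) (φ : E3 × Y → ℝ) : Prop :=
  ClassCX ⊤ φ ∧ HasCompactSupport φ ∧ tsupport φ ⊆ G ×ˢ V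

/-- `v = ∂_x^α u` in the weak sense on `G × V`, where `μ` is the measure carried by `G × V`. The
integrals against test functions are required to converge (local integrability). -/
def HasWeakXDeriv {Y : Type*} [TopologicalSpace Y] [MeasurableSpace Y]
    (G : Set E3) (V : Set Y) (μ : Measure (E3 × Y)) (α : Fin 3 → ℕ) (u v : E3 × Y → ℝ) : Prop :=
  ∀ φ : E3 × Y → ℝ, IsTest G V φ →
    Integrable (fun p => u p * xPartial α φ p) μ ∧ Integrable (fun p => v p * φ p) μ ∧
      ∫ p, u p * xPartial α φ p ∂μ = (-1) ^ (∑ i, α i) * ∫ p, v p * φ p ∂μ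

/-- Multi-indices `α ∈ ℕ₀³` with `|α| ≤ m`. -/
abbrev MultiIdx (m : ℕ) : Type := {α : Fin 3 → Fin (m + 1) // ∑ i, (α i : ℕ) ≤ m}

/-- The multi-index as a function to `ℕ`. -/
def MultiIdx.toFun {m : ℕ} (α : MultiIdx m) : Fin 3 → ℕ := fun i => (α.1 i : ℕ)

/-- The multi-index `0`. -/
def MultiIdx.zero (m : ℕ) : MultiIdx m := ⟨fun _ => 0, by simp⟩

/-! ### The Sobolev spaces `H^{(m,0,0)}(G × S × I)` and `H₀^{(m,0,0)}(G × S × I, Γ₋)` -/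

/-- The space `L²(G × S × I)`. -/
abbrev L2Phase (G : Set E3) (E₀ Em : ℝ) : Type := Lp ℝ 2 (phaseMeasure G E₀ Em)

theorem HasWeakXDeriv.congr {Y : Type*} [TopologicalSpace Y] [MeasurableSpace Y]
    {G : Set E3} {V : Set Y} {μ : Measure (E3 × Y)} {α : Fin 3 → ℕ} {u v u' v' : E3 × Y → ℝ}
    (h : HasWeakXDeriv G V μ α u v) (hu : u =ᵐ[μ] u') (hv : v =ᵐ[μ] v') :
    HasWeakXDeriv G V μ α u' v' := by
  intro φ hφ
  obtain ⟨h1, h2, h3⟩ := h φ hφ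
  have e1 : (fun p => u p * xPartial α φ p) =ᵐ[μ] fun p => u' p * xPartial α φ p := by
    filter_upwards [hu] with p hp
    rw [hp]
  have e2 : (fun p => v p * φ p) =ᵐ[μ] fun p => v' p * φ p := by
    filter_upwards [hv] with p hp
    rw [hp]
  exact ⟨h1.congr e1, h2.congr e2, by rw [← integral_congr_ae e1, ← integral_congr_ae e2, h3]⟩

theorem HasWeakXDeriv.add {Y : Type*} [TopologicalSpace Y] [MeasurableSpace Y]
    {G : Set E3} {V : Set Y} {μ : Measure (E3 × Y)} {α : Fin 3 → ℕ} {u v u' v' : E3 × Y → ℝ}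
    (h : HasWeakXDeriv G V μ α u v) (h' : HasWeakXDeriv G V μ α u' v') :
    HasWeakXDeriv G V μ α (u + u') (v + v') := by
  intro φ hφ
  obtain ⟨h1, h2, h3⟩ := h φ hφ
  obtain ⟨h1', h2', h3'⟩ := h' φ hφ
  simp only [Pi.add_apply, add_mul]
  refine ⟨h1.add h1', h2.add h2', ?_⟩
  rw [integral_add h1 h1', integral_add h2 h2', h3, h3', mul_add]

theorem HasWeakXDeriv.smul {Y : Type*} [TopologicalSpace Y] [MeasurableSpace Y]
    {G : Set E3} {V : Set Y} {μ : Measure (E3 × Y)} {α : Fin 3 → ℕ} {u v : E3 × Y → ℝ}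
    (c : ℝ) (h : HasWeakXDeriv G V μ α u v) :
    HasWeakXDeriv G V μ α (c • u) (c • v) := by
  intro φ hφ
  obtain ⟨h1, h2, h3⟩ := h φ hφ
  simp only [Pi.smul_apply, smul_eq_mul, mul_assoc]
  refine ⟨h1.const_mul c, h2.const_mul c, ?_⟩
  rw [integral_const_mul, integral_const_mul, h3]
  ring

/-- The space `H^{(m,0,0)}(G × S × I)`. A function `ψ` is represented by the family
`(∂_x^α ψ)_{|α| ≤ m}` of its weak derivatives in `L²` (which `ψ` determines); the inherited norm is
`(∑_{|α| ≤ m} ‖∂_x^α ψ‖²)^{1/2}`. -/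
def sobolevH (m : ℕ) (G : Set E3) (E₀ Em : ℝ) :
    Submodule ℝ (PiLp 2 (fun _ : MultiIdx m => L2Phase G E₀ Em)) where
  carrier := {u | ∀ α : MultiIdx m,
    HasWeakXDeriv G (univ ×ˢ Ioo E₀ Em) (phaseMeasure G E₀ Em) α.toFun
      (u (MultiIdx.zero m)) (u α)}
  add_mem' := by
    intro u v hu hv α
    exact ((hu α).add (hv α)).congr (Lp.coeFn_add _ _).symm (Lp.coeFn_add _ _).symm
  zero_mem' := by
    intro α φ hφ
    have e : ((0 : L2Phase G E₀ Em) : Phase → ℝ) =ᵐ[phaseMeasure G E₀ Em] 0 := Lp.coeFn_zero _ _ _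
    refine HasWeakXDeriv.congr (u := 0) (v := 0) ?_ e.symm e.symm φ hφ
    intro φ _
    simp
  smul_mem' := by
    intro c u hu α
    exact ((hu α).smul c).congr (Lp.coeFn_smul _ _).symm (Lp.coeFn_smul _ _).symm

/-- The `L²` function `ψ` itself underlying an element of `H^{(m,0,0)}(G × S × I)`. -/
def toL2 {m : ℕ} {G : Set E3} {E₀ Em : ℝ} (ψ : sobolevH m G E₀ Em) : L2Phase G E₀ Em :=
  (ψ : PiLp 2 (fun _ : MultiIdx m => L2Phase G E₀ Em)) (MultiIdx.zero m)

/-- The class `C^{(k,0,0)}(closure G × S × I)` of restrictions to `G × S × I°` of compactly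
supported functions of class `C^{(k,0,0)}` on `ℝ³ × S × ℝ`, with values in `X`. -/
def ClassCBar {X : Type*} [NormedAddCommGroup X] [NormedSpace ℝ X]
    (k : ℕ∞) (G : Set E3) (E₀ Em : ℝ) (f : Phase → X) : Prop :=
  ∃ F : Phase → X, ClassCX k F ∧ HasCompactSupport F ∧
    EqOn f F (G ×ˢ (univ ×ˢ Ioo E₀ Em))

/-- The class `C₀^{(k,0,0)}(closure G × S × I, Γ₋)`: in addition, the support (taken in
`closure G × S × I`) does not meet `Γ₋ ∪ Γ₀`. -/
def ClassC0 {X : Type*} [NormedAddCommGroup X] [NormedSpace ℝ X]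
    (k : ℕ∞) (G : Set E3) (E₀ Em : ℝ) (f : Phase → X) : Prop :=
  ClassCBar k G E₀ Em f ∧
    Disjoint (closure (Function.support f ∩ (G ×ˢ (univ ×ˢ Ioo E₀ Em))))
      (GammaMinus G E₀ Em ∪ GammaZero G E₀ Em)

theorem ClassCX.add {Y X : Type*} [TopologicalSpace Y] [NormedAddCommGroup X] [NormedSpace ℝ X]
    {k : ℕ∞} {f g : E3 × Y → X} (hf : ClassCX k f) (hg : ClassCX k g) : ClassCX k (f + g) := by
  refine ⟨fun y => (hf.1 y).add (hg.1 y), fun n hn => ?_⟩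
  refine ((hf.2 n hn).add (hg.2 n hn)).congr fun p => ?_
  have hk : ((n : ℕ) : WithTop ℕ∞) ≤ (k : WithTop ℕ∞) := by exact_mod_cast hn
  exact (iteratedFDeriv_add_apply ((hf.1 p.2).contDiffAt.of_le hk)
    ((hg.1 p.2).contDiffAt.of_le hk)).symm

theorem ClassCX.smul {Y X : Type*} [TopologicalSpace Y] [NormedAddCommGroup X] [NormedSpace ℝ X]
    {k : ℕ∞} {f : E3 × Y → X} (c : ℝ) (hf : ClassCX k f) : ClassCX k (c • f) := by
  refine ⟨fun y => (hf.1 y).const_smul c, fun n hn => ?_⟩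
  refine ((hf.2 n hn).const_smul c).congr fun p => ?_
  have hk : ((n : ℕ) : WithTop ℕ∞) ≤ (k : WithTop ℕ∞) := by exact_mod_cast hn
  exact (iteratedFDeriv_const_smul_apply ((hf.1 p.2).contDiffAt.of_le hk)).symm

theorem ClassC0.add {X : Type*} [NormedAddCommGroup X] [NormedSpace ℝ X]
    {k : ℕ∞} {G : Set E3} {E₀ Em : ℝ} {f g : Phase → X}
    (hf : ClassC0 k G E₀ Em f) (hg : ClassC0 k G E₀ Em g) : ClassC0 k G E₀ Em (f + g) := by
  obtain ⟨⟨F, hF, hF', hfF⟩, df⟩ := hf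
  obtain ⟨⟨H, hH, hH', hgH⟩, dg⟩ := hg
  refine ⟨⟨F + H, hF.add hH, hF'.add hH',
    fun p hp => congrArg₂ (· + ·) (hfF hp) (hgH hp)⟩, ?_⟩
  refine Disjoint.mono_left ?_ (df.union_left dg)
  rw [← closure_union, ← union_inter_distrib_right]
  exact closure_mono (inter_subset_inter_left _ (Function.support_add f g))

theorem ClassC0.smul {X : Type*} [NormedAddCommGroup X] [NormedSpace ℝ X]
    {k : ℕ∞} {G : Set E3} {E₀ Em : ℝ} {f : Phase → X} (c : ℝ)
    (hf : ClassC0 k G E₀ Em f) : ClassC0 k G E₀ Em (c • f) := by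
  obtain ⟨⟨F, hF, hF', hfF⟩, df⟩ := hf
  refine ⟨⟨c • F, hF.smul c, hF'.smul_left (f := fun _ => c),
    fun p hp => congrArg (c • ·) (hfF hp)⟩, ?_⟩
  refine Disjoint.mono_left ?_ df
  exact closure_mono (inter_subset_inter_left _ (Function.support_const_smul_subset c f))

theorem ClassC0.zero {X : Type*} [NormedAddCommGroup X] [NormedSpace ℝ X]
    {k : ℕ∞} {G : Set E3} {E₀ Em : ℝ} : ClassC0 k G E₀ Em (0 : Phase → X) := by
  refine ⟨⟨0, ⟨fun _ => contDiff_const, fun n _ => ?_⟩, HasCompactSupport.zero,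
    fun _ _ => rfl⟩, by simp⟩
  simp only [Pi.zero_apply]
  refine (continuous_const (y := 0)).congr fun p => ?_
  exact (congrFun (iteratedFDeriv_fun_zero (𝕜 := ℝ) (E := E3) (F := X) (n := n)) p.1).symm

/-- The elements of `⋂_{k ≥ 1} C₀^{(k,0,0)}(closure G × S × I, Γ₋)`, as elements of
`H^{(m,0,0)}(G × S × I)`. -/
def smoothVanishing (m : ℕ) (G : Set E3) (E₀ Em : ℝ) : Submodule ℝ (sobolevH m G E₀ Em) where
  carrier := {ψ | ∃ f : Phase → ℝ, (∀ k : ℕ, 1 ≤ k → ClassC0 k G E₀ Em f) ∧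
    toL2 ψ =ᵐ[phaseMeasure G E₀ Em] f}
  add_mem' := by
    rintro ψ χ ⟨f, hf, hψ⟩ ⟨g, hg, hχ⟩
    exact ⟨f + g, fun k hk => (hf k hk).add (hg k hk), (Lp.coeFn_add _ _).trans (hψ.add hχ)⟩
  zero_mem' := ⟨0, fun _ _ => ClassC0.zero, Lp.coeFn_zero _ _ _⟩
  smul_mem' := by
    rintro c ψ ⟨f, hf, hψ⟩
    exact ⟨c • f, fun k hk => (hf k hk).smul c, (Lp.coeFn_smul _ _).trans (hψ.const_smul c)⟩

/-- The space `H₀^{(m,0,0)}(G × S × I, Γ₋)`: the completion of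
`⋂_{k ≥ 1} C₀^{(k,0,0)}(closure G × S × I, Γ₋)` in the norm of `H^{(m,0,0)}(G × S × I)`, i.e. its
closure in that Hilbert space. -/
def sobolevH0 (m : ℕ) (G : Set E3) (E₀ Em : ℝ) : Submodule ℝ (sobolevH m G E₀ Em) :=
  (smoothVanishing m G E₀ Em).topologicalClosure

/-! ### The kernel spaces -/

/-- The norm of `L^∞(G × S × I, L¹(S'))`. -/
def mixedNorm (G : Set E3) (E₀ Em : ℝ) (v : KernelDom → ℝ) : ENNReal :=
  essSup (fun p : Phase => ∫⁻ ω', ‖v (p.1, ω', p.2.1, p.2.2)‖ₑ ∂sphereMeasure)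
    (phaseMeasure G E₀ Em)

/-- The norm of `L^∞(G × S' × I, L¹(S))`. -/
def mixedNorm' (G : Set E3) (E₀ Em : ℝ) (v : KernelDom → ℝ) : ENNReal :=
  essSup (fun p : Phase => ∫⁻ ω, ‖v (p.1, p.2.1, ω, p.2.2)‖ₑ ∂sphereMeasure)
    (phaseMeasure G E₀ Em)

/-- The families of weak derivatives `(∂_x^α σ)_{|α| ≤ m}` on `G × S' × S × I`. Such a family is
unique up to null sets if it exists. -/
def weakDerivs (m : ℕ) (G : Set E3) (E₀ Em : ℝ) (σ : KernelDom → ℝ) :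
    Set (MultiIdx m → KernelDom → ℝ) :=
  {D | ∀ α : MultiIdx m, AEStronglyMeasurable (D α) (kernelMeasure G E₀ Em) ∧
    HasWeakXDeriv G (univ ×ˢ (univ ×ˢ Ioo E₀ Em)) (kernelMeasure G E₀ Em) α.toFun σ (D α)}

/-- The norm `max_{|α| ≤ m} ‖∂_x^α σ‖` of `W^{∞,(m,0,0)}(G × S × I, L¹(S'))`; it is `⊤` if `σ` is
not in that space. -/
def kernelNorm (m : ℕ) (G : Set E3) (E₀ Em : ℝ) (σ : KernelDom → ℝ) : ENNReal :=
  ⨅ D ∈ weakDerivs m G E₀ Em σ, ⨆ α, mixedNorm G E₀ Em (D α)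

/-- The norm `max_{|α| ≤ m} ‖∂_x^α σ‖` of `W^{∞,(m,0,0)}(G × S' × I, L¹(S))`; it is `⊤` if `σ` is
not in that space. -/
def kernelNorm' (m : ℕ) (G : Set E3) (E₀ Em : ℝ) (σ : KernelDom → ℝ) : ENNReal :=
  ⨅ D ∈ weakDerivs m G E₀ Em σ, ⨆ α, mixedNorm' G E₀ Em (D α)

/-- `τ` belongs to `C₀^{(∞,0,0)}(closure G × S × I, L¹(S'), Γ₋)`, as the function
`(x, ω, E) ↦ τ(x, ·, ω, E)` with values in `L¹(S')`. -/
def IsSmoothKernel (G : Set E3) (E₀ Em : ℝ) (τ : KernelDom → ℝ) : Prop :=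
  ∃ F : Phase → Lp ℝ 1 sphereMeasure, ClassC0 ⊤ G E₀ Em F ∧
    ∀ᵐ p ∂phaseMeasure G E₀ Em, ∀ᵐ ω' ∂sphereMeasure, τ (p.1, ω', p.2.1, p.2.2) = F p ω'

/-- `σ` belongs to `𝒲₀^{∞,(m,0,0)}(G × S × I, L¹(S'), Γ₋)`, the completion of
`C₀^{(∞,0,0)}(closure G × S × I, L¹(S'), Γ₋) ∩ W^{∞,(m,0,0)}(G × S' × I, L¹(S))` with respect to
the sum of the two norms. -/
def MemW0 (m : ℕ) (G : Set E3) (E₀ Em : ℝ) (σ : KernelDom → ℝ) : Prop :=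
  ∀ ε : ENNReal, 0 < ε → ∃ τ : KernelDom → ℝ,
    AEStronglyMeasurable τ (kernelMeasure G E₀ Em) ∧ IsSmoothKernel G E₀ Em τ ∧
      kernelNorm' m G E₀ Em τ < ⊤ ∧
      kernelNorm m G E₀ Em (σ - τ) + kernelNorm' m G E₀ Em (σ - τ) < ε

/-- The integrand `ω' ↦ σ(x, ω', ω, E) ψ(x, ω', E)` at the point `p = (x, ω, E)`. -/
def collisionIntegrand (σ : KernelDom → ℝ) (ψ : Phase → ℝ) (p : Phase) (ω' : S2) : ℝ :=
  σ (p.1, ω', p.2.1, p.2.2) * ψ (p.1, ω', p.2.2)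

/-- The collision operator
`(K_r ψ)(x, ω, E) = ∫_{S'} σ(x, ω', ω, E) ψ(x, ω', E) dω'`. -/
def collision (σ : KernelDom → ℝ) (ψ : Phase → ℝ) (p : Phase) : ℝ :=
  ∫ ω', collisionIntegrand σ ψ p ω' ∂sphereMeasure

end Transport

end

/-!
A function of `H^(m,0,0)` is handled together with its jet, the family of its weak `x`-derivatives.
By the Leibniz rule `K_r` acts on jets as a sum of integral operators whose kernels are the
derivatives `∂ₓ^β σ`; the Schur test bounds each of them on `L²` by `√(N₁ N₂)`, which gives the norm
estimate. It remains to see that the image of a jet lies in `H₀`. If `σ` is smooth and vanishes near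
`Γ₋ ∪ Γ₀` and `ψ` is smooth, then `K_r ψ` is again smooth and vanishes near `Γ₋ ∪ Γ₀`. Smooth
functions are dense because a convex `G` can be contracted into itself, which leaves room for a
mollification, and by the norm estimate `σ` can be approximated in the norm `N₁ + N₂`. Since `H₀` is
closed, it contains the image in general.
-/

noncomputable section

namespace Transport

open scoped ENNReal NNReal

universe u v

/-! ### Calculus in the spatial variable -/

section ClassCX

variable {X : Type u} [NormedAddCommGroup X] [NormedSpace ℝ X] {Y : Type v}

/-- The partial derivative `∂f/∂x_i` of a function of `x` and `y` with values in a normed space. -/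
def xpd (i : Fin 3) (f : E3 × Y → X) : E3 × Y → X :=
  fun p => fderiv ℝ (fun x => f (x, p.2)) p.1 (EuclideanSpace.single i 1)

theorem clm_eq_sum_proj_smulRight (L : E3 →L[ℝ] X) :
    L = ∑ i, (EuclideanSpace.proj i : E3 →L[ℝ] ℝ).smulRight (L (EuclideanSpace.single i 1)) := by
  refine ContinuousLinearMap.coe_injective ((EuclideanSpace.basisFun (Fin 3) ℝ).toBasis.ext
    fun j => ?_)
  simp [PiLp.single_apply, ite_smul, Finset.sum_ite_eq']

theorem xpd_bilin {X₁ X₂ : Type*} [NormedAddCommGroup X₁] [NormedSpace ℝ X₁]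
    [NormedAddCommGroup X₂] [NormedSpace ℝ X₂] (B : X₁ →L[ℝ] X₂ →L[ℝ] X)
    {f : E3 × Y → X₁} {g : E3 × Y → X₂} (hf : ∀ y, Differentiable ℝ fun x => f (x, y))
    (hg : ∀ y, Differentiable ℝ fun x => g (x, y)) (i : Fin 3) :
    xpd i (fun p => B (f p) (g p)) =
      (fun p => B (f p) (xpd i g p)) + fun p => B (xpd i f p) (g p) := by
  funext p
  exact congrArg (fun L : E3 →L[ℝ] X => L (EuclideanSpace.single i 1))
    (B.fderiv_of_bilinear (hf p.2 p.1) (hg p.2 p.1))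

theorem xpd_comp_smul_add (c : ℝ) (a : E3) (f : E3 × Y → X) (i : Fin 3) :
    xpd i (fun p : E3 × Y => f (c • p.1 + a, p.2)) = c • fun p => xpd i f (c • p.1 + a, p.2) := by
  funext p
  have := fderiv_comp_smul (𝕜 := ℝ) (f := fun x => f (x + a, p.2)) (x := p.1) c
  simp [xpd, this, fderiv_comp_add_right (f := fun x => f (x, p.2))]

variable [TopologicalSpace Y]

theorem ClassCX.continuous {k : ℕ∞} {f : E3 × Y → X} (hf : ClassCX k f) : Continuous f := by
  refine ((continuousMultilinearCurryFin0 ℝ E3 X).continuous.comp (hf.2 0 (by simp))).congr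
    fun p => ?_
  simp [continuousMultilinearCurryFin0]

theorem ClassCX.of_le {k l : ℕ∞} {f : E3 × Y → X} (hf : ClassCX k f) (h : l ≤ k) : ClassCX l f :=
  ⟨fun y => (hf.1 y).of_le (by exact_mod_cast h), fun n hn => hf.2 n (hn.trans h)⟩

theorem classCX_top_iff {f : E3 × Y → X} : ClassCX ⊤ f ↔ ∀ n : ℕ, ClassCX n f :=
  ⟨fun h _ => h.of_le le_top, fun h => ⟨fun y => contDiff_infty.2 fun n => (h n).1 y,
    fun n _ => (h n).2 n le_rfl⟩⟩

theorem classCX_zero_iff {f : E3 × Y → X} : ClassCX ((0 : ℕ) : ℕ∞) f ↔ Continuous f := by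
  refine ⟨ClassCX.continuous, fun h => ⟨fun y => ?_, fun n hn => ?_⟩⟩
  · have : Continuous fun x => f (x, y) := by fun_prop
    simpa using (contDiff_zero (𝕜 := ℝ)).2 this
  · obtain rfl : n = 0 := by simpa using hn
    exact ((continuousMultilinearCurryFin0 ℝ E3 X).symm.continuous.comp h).congr
      fun p => by rw [iteratedFDeriv_zero_eq_comp]; rfl

theorem classCX_succ_iff_fderiv {n : ℕ} {f : E3 × Y → X} : ClassCX ((n + 1 : ℕ) : ℕ∞) f ↔
    Continuous f ∧ (∀ y, Differentiable ℝ fun x => f (x, y)) ∧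
      ClassCX n fun p : E3 × Y => fderiv ℝ (fun x => f (x, p.2)) p.1 := by
  constructor
  · intro h
    refine ⟨h.continuous, fun y => (h.1 y).differentiable (by simp),
      fun y => (h.1 y).fderiv_right (by norm_cast), fun j hj => ?_⟩
    have hj' : ((j + 1 : ℕ) : ℕ∞) ≤ ((n + 1 : ℕ) : ℕ∞) := by
      exact_mod_cast Nat.succ_le_succ (by exact_mod_cast hj)
    refine ((continuousMultilinearCurryRightEquiv' ℝ j E3 X).continuous.comp
      (h.2 (j + 1) hj')).congr fun p => ?_
    simp only [Function.comp_apply, iteratedFDeriv_succ_eq_comp_right,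
      LinearIsometryEquiv.apply_symm_apply]
  · rintro ⟨hc, hd, h⟩
    refine ⟨fun y => ?_, fun j hj => ?_⟩
    · exact_mod_cast (contDiff_succ_iff_fderiv (𝕜 := ℝ) (n := (n : WithTop ℕ∞))
        (f := fun x => f (x, y))).2 ⟨hd y, by simp, h.1 y⟩
    · rcases j with _ | j
      · exact (classCX_zero_iff.2 hc).2 0 le_rfl
      · have hj' : (j : ℕ∞) ≤ n := by
          have : j + 1 ≤ n + 1 := by exact_mod_cast hj
          exact_mod_cast Nat.le_of_succ_le_succ this
        refine ((continuousMultilinearCurryRightEquiv' ℝ j E3 X).symm.continuous.comp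
          (h.2 j hj')).congr fun p => ?_
        rw [iteratedFDeriv_succ_eq_comp_right]
        rfl

theorem ClassCX.clm_comp {X' : Type*} [NormedAddCommGroup X'] [NormedSpace ℝ X']
    (L : X →L[ℝ] X') {k : ℕ∞} {f : E3 × Y → X} (hf : ClassCX k f) :
    ClassCX k fun p => L (f p) := by
  refine ⟨fun y => L.contDiff.comp (hf.1 y), fun n hn => ?_⟩
  refine ((ContinuousLinearMap.compContinuousMultilinearMapL ℝ (fun _ : Fin n => E3) X X'
    L).continuous.comp (hf.2 n hn)).congr fun p => ?_
  exact (L.iteratedFDeriv_comp_left (hf.1 p.2).contDiffAt (by exact_mod_cast hn)).symm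

theorem ClassCX.sum {ι : Type*} [Fintype ι] {k : ℕ∞} {f : ι → E3 × Y → X}
    (hf : ∀ i, ClassCX k (f i)) : ClassCX k (∑ i, f i) :=
  Finset.sum_induction f (ClassCX k) (fun _ _ => ClassCX.add)
    ⟨fun _ => contDiff_const, fun n _ => by
      simp only [Pi.zero_apply, iteratedFDeriv_fun_zero]
      exact continuous_const⟩ fun i _ => hf i

theorem classCX_succ_iff {n : ℕ} {f : E3 × Y → X} : ClassCX ((n + 1 : ℕ) : ℕ∞) f ↔
    Continuous f ∧ (∀ y, Differentiable ℝ fun x => f (x, y)) ∧ ∀ i, ClassCX n (xpd i f) := by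
  rw [classCX_succ_iff_fderiv]
  refine and_congr_right fun _ => and_congr_right fun _ => ⟨fun h i =>
    h.clm_comp (ContinuousLinearMap.apply ℝ X (EuclideanSpace.single i 1)), fun h => ?_⟩
  convert ClassCX.sum fun i => (h i).clm_comp (ContinuousLinearMap.smulRightL ℝ E3 X
    (EuclideanSpace.proj i : E3 →L[ℝ] ℝ)) using 1
  funext p
  rw [Finset.sum_apply]
  exact clm_eq_sum_proj_smulRight _

theorem ClassCX.differentiable {f : E3 × Y → X} (hf : ClassCX ⊤ f) (y : Y) :
    Differentiable ℝ fun x => f (x, y) :=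
  (hf.1 y).differentiable (by simp)

protected theorem ClassCX.xpd {f : E3 × Y → X} (hf : ClassCX ⊤ f) (i : Fin 3) :
    ClassCX ⊤ (xpd i f) :=
  classCX_top_iff.2 fun n => (classCX_succ_iff.1 (classCX_top_iff.1 hf (n + 1))).2.2 i

theorem classCX_top_of_forall_xpd (P : (E3 × Y → X) → Prop)
    (hP : ∀ f, P f → Continuous f ∧ (∀ y, Differentiable ℝ fun x => f (x, y)) ∧
      ∀ i, P (xpd i f)) {f : E3 × Y → X} (hf : P f) : ClassCX ⊤ f := by
  refine classCX_top_iff.2 fun n => ?_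
  induction n generalizing f with
  | zero => exact classCX_zero_iff.2 (hP f hf).1
  | succ n ih =>
    obtain ⟨hc, hd, hx⟩ := hP f hf
    exact classCX_succ_iff.2 ⟨hc, hd, fun i => ih (hx i)⟩

theorem classCX_of_contDiff {f : E3 → X} (hf : ContDiff ℝ (⊤ : ℕ∞) f) :
    ClassCX ⊤ fun p : E3 × Y => f p.1 :=
  ⟨fun _ => hf, fun _ _ => (hf.continuous_iteratedFDeriv (by exact_mod_cast le_top)).comp
    continuous_fst⟩

theorem classCX_of_continuous {g : Y → X} (hg : Continuous g) :
    ClassCX ⊤ fun p : E3 × Y => g p.2 := by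
  refine classCX_top_of_forall_xpd (fun f => ∃ g : Y → X, Continuous g ∧ f = fun p => g p.2) ?_
    ⟨g, hg, rfl⟩
  rintro _ ⟨g, hg, rfl⟩
  refine ⟨hg.comp continuous_snd, fun y => differentiable_const (g y),
    fun i => ⟨0, continuous_const, ?_⟩⟩
  funext p
  simp [xpd]

theorem ClassCX.bilin {X₁ X₂ : Type*} [NormedAddCommGroup X₁] [NormedSpace ℝ X₁]
    [NormedAddCommGroup X₂] [NormedSpace ℝ X₂] (B : X₁ →L[ℝ] X₂ →L[ℝ] X)
    {f : E3 × Y → X₁} {g : E3 × Y → X₂} (hf : ClassCX ⊤ f) (hg : ClassCX ⊤ g) :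
    ClassCX ⊤ fun p => B (f p) (g p) := by
  refine classCX_top_iff.2 fun n => ?_
  induction n generalizing f g with
  | zero => exact classCX_zero_iff.2 ((B.continuous.comp hf.continuous).clm_apply hg.continuous)
  | succ n ih =>
    refine classCX_succ_iff.2 ⟨(B.continuous.comp hf.continuous).clm_apply hg.continuous,
      fun y x => (B.hasFDerivAt_of_bilinear (hf.differentiable y x).hasFDerivAt
        (hg.differentiable y x).hasFDerivAt).differentiableAt, fun i => ?_⟩
    rw [xpd_bilin B hf.differentiable hg.differentiable i]
    exact (ih hf (hg.xpd i)).add (ih (hf.xpd i) hg)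

theorem ClassCX.mul {f g : E3 × Y → ℝ} (hf : ClassCX ⊤ f) (hg : ClassCX ⊤ g) :
    ClassCX ⊤ fun p => f p * g p :=
  ClassCX.bilin (ContinuousLinearMap.mul ℝ ℝ) hf hg

theorem xpd_mul {f g : E3 × Y → ℝ} (hf : ClassCX ⊤ f) (hg : ClassCX ⊤ g) (i : Fin 3) :
    xpd i (fun p => f p * g p) = (fun p => f p * xpd i g p) + fun p => xpd i f p * g p :=
  xpd_bilin (ContinuousLinearMap.mul ℝ ℝ) hf.differentiable hg.differentiable i

theorem ClassCX.comp_right {Y' : Type*} [TopologicalSpace Y'] {k : ℕ∞} {f : E3 × Y → X}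
    (hf : ClassCX k f) {q : Y' → Y} (hq : Continuous q) :
    ClassCX k fun p : E3 × Y' => f (p.1, q p.2) :=
  ⟨fun y => hf.1 (q y), fun n hn =>
    (hf.2 n hn).comp (continuous_fst.prodMk (hq.comp continuous_snd))⟩

theorem ClassCX.comp_smul_add (c : ℝ) (a : E3) {f : E3 × Y → X} (hf : ClassCX ⊤ f) :
    ClassCX ⊤ fun p : E3 × Y => f (c • p.1 + a, p.2) := by
  refine classCX_top_of_forall_xpd
    (fun h => ∃ f : E3 × Y → X, ClassCX ⊤ f ∧ h = fun p => f (c • p.1 + a, p.2)) ?_ ⟨f, hf, rfl⟩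
  rintro _ ⟨f, hf, rfl⟩
  refine ⟨hf.continuous.comp (by fun_prop), fun y =>
    (hf.differentiable y).comp ((differentiable_id.const_smul c).add_const a),
    fun i => ⟨c • xpd i f, (hf.xpd i).smul c, xpd_comp_smul_add c a f i⟩⟩

theorem xpd_clm_comp {X' : Type*} [NormedAddCommGroup X'] [NormedSpace ℝ X'] (L : X →L[ℝ] X')
    {f : E3 × Y → X} (hf : ClassCX ⊤ f) (i : Fin 3) :
    xpd i (fun p => L (f p)) = fun p => L (xpd i f p) := by
  funext p
  have h := L.hasFDerivAt.comp p.1 (hf.differentiable p.2 p.1).hasFDerivAt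
  exact congrArg (fun T : E3 →L[ℝ] X' => T (EuclideanSpace.single i 1)) h.fderiv

theorem xpd_apply_continuousMap {S : Type*} [TopologicalSpace S] [CompactSpace S]
    {f : E3 × Y → C(S, ℝ)} (hf : ClassCX ⊤ f) (i : Fin 3) :
    xpd i (fun p : E3 × (S × Y) => f (p.1, p.2.2) p.2.1) =
      fun p => xpd i f (p.1, p.2.2) p.2.1 :=
  funext fun p => congrFun (xpd_clm_comp (ContinuousMap.evalCLM (M := ℝ) ℝ p.2.1) hf i)
    (p.1, p.2.2)

theorem ClassCX.apply_continuousMap {S : Type*} [TopologicalSpace S] [CompactSpace S]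
    {f : E3 × Y → C(S, ℝ)} (hf : ClassCX ⊤ f) :
    ClassCX ⊤ fun p : E3 × (S × Y) => f (p.1, p.2.2) p.2.1 := by
  refine classCX_top_of_forall_xpd (fun h => ∃ f : E3 × Y → C(S, ℝ), ClassCX ⊤ f ∧
    h = fun p => f (p.1, p.2.2) p.2.1) ?_ ⟨f, hf, rfl⟩
  rintro _ ⟨f, hf, rfl⟩
  refine ⟨?_, fun y => (ContinuousMap.evalCLM (M := ℝ) ℝ y.1).differentiable.comp
    (hf.differentiable y.2), fun i => ⟨_, hf.xpd i, xpd_apply_continuousMap hf i⟩⟩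
  exact continuous_eval.comp ((hf.continuous.comp (by fun_prop)).prodMk (by fun_prop))

theorem tsupport_xpd_subset (i : Fin 3) (f : E3 × Y → X) :
    tsupport (xpd i f) ⊆ tsupport f := by
  refine closure_minimal (fun p hp => ?_) (isClosed_tsupport f)
  by_contra hpf
  have hx : Tendsto (fun x : E3 => (x, p.2)) (𝓝 p.1) (𝓝 p) :=
    (continuous_id.prodMk continuous_const).tendsto p.1
  have h0 : (fun x => f (x, p.2)) =ᶠ[𝓝 p.1] fun _ => 0 :=
    hx.eventually (notMem_tsupport_iff_eventuallyEq.1 hpf)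
  exact hp (by simp [xpd, h0.fderiv_eq])

theorem xpd_comm {f : E3 × Y → X} (hf : ClassCX ⊤ f) (i j : Fin 3) :
    xpd i (xpd j f) = xpd j (xpd i f) := by
  funext p
  have hd : DifferentiableAt ℝ (fderiv ℝ fun x => f (x, p.2)) p.1 :=
    (((hf.1 p.2).fderiv_right (m := ((⊤ : ℕ∞) : WithTop ℕ∞)) (by norm_cast)).differentiable
      (by simp)) p.1
  have key (a b : Fin 3) : xpd a (xpd b f) p =
      fderiv ℝ (fderiv ℝ fun x => f (x, p.2)) p.1
        (EuclideanSpace.single a 1) (EuclideanSpace.single b 1) := by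
    change fderiv ℝ (fun y => fderiv ℝ (fun x => f (x, p.2)) y (EuclideanSpace.single b 1)) p.1 _ =
      _
    rw [fderiv_clm_apply hd (differentiableAt_const _)]
    simp
  rw [key, key]
  refine ((hf.1 p.2).contDiffAt.isSymmSndFDerivAt ?_) _ _
  rw [minSmoothness_of_isRCLikeNormedField]
  exact WithTop.coe_le_coe.2 (le_top : (2 : ℕ∞) ≤ ⊤)

theorem iterate_xpd_comm {f : E3 × Y → X} (hf : ClassCX ⊤ f) (i j : Fin 3) (n : ℕ) :
    (xpd j)^[n] (xpd i f) = xpd i ((xpd j)^[n] f) := by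
  induction n generalizing f with
  | zero => rfl
  | succ _ ih => rw [Function.iterate_succ_apply, Function.iterate_succ_apply, ← ih (hf.xpd j),
      xpd_comm hf]

theorem ClassCX.iterate_xpd {f : E3 × Y → X} (hf : ClassCX ⊤ f) (i : Fin 3) (n : ℕ) :
    ClassCX ⊤ ((xpd i)^[n] f) := by
  induction n generalizing f with
  | zero => exact hf
  | succ _ ih => exact ih (hf.xpd i)

end ClassCX

/-! ### Multi-indices and the Leibniz rule -/

section MultiIndex

/-- The multi-index of the derivative `∂_{i₁} ⋯ ∂_{iₙ}`, for the unordered word `s = {i₁, …, iₙ}`.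
Words make the Leibniz rule free of binomial coefficients. -/
def multiIndex (s : Multiset (Fin 3)) : Fin 3 → ℕ := fun i => s.count i

/-- The unordered word with multi-index `α`. -/
def letters (α : Fin 3 → ℕ) : Multiset (Fin 3) :=
  Finsupp.toMultiset (Finsupp.equivFunOnFinite.symm α)

theorem multiIndex_zero : multiIndex 0 = 0 := funext fun _ => Multiset.count_zero _

theorem multiIndex_letters (α : Fin 3 → ℕ) : multiIndex (letters α) = α :=
  funext fun i => Finsupp.count_toMultiset _ i

theorem sum_multiIndex (s : Multiset (Fin 3)) : ∑ i, multiIndex s i = s.card :=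
  Multiset.sum_count_eq_card fun i _ => Finset.mem_univ i

theorem card_letters (α : Fin 3 → ℕ) : (letters α).card = ∑ i, α i := by
  rw [← sum_multiIndex, multiIndex_letters]

/-- The multi-index of the word `s` as an element of `MultiIdx m`; words with more than `m` letters
are sent to the junk value `0`. -/
def MultiIdx.ofMultiset (m : ℕ) (s : Multiset (Fin 3)) : MultiIdx m :=
  if h : s.card ≤ m then
    ⟨fun i => ⟨multiIndex s i, Nat.lt_succ_of_le ((Multiset.count_le_card i s).trans h)⟩,
      (sum_multiIndex s).trans_le h⟩
  else MultiIdx.zero m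

theorem MultiIdx.toFun_ofMultiset {m : ℕ} {s : Multiset (Fin 3)} (h : s.card ≤ m) :
    (MultiIdx.ofMultiset m s).toFun = multiIndex s := by
  simp only [MultiIdx.ofMultiset, dif_pos h]
  rfl

theorem MultiIdx.toFun_injective {m : ℕ} : Function.Injective (MultiIdx.toFun (m := m)) :=
  fun _ _ h => Subtype.ext (funext fun i => Fin.ext (congrFun h i))

theorem MultiIdx.card_letters_le {m : ℕ} (α : MultiIdx m) : (letters α.toFun).card ≤ m :=
  (card_letters _).trans_le α.2

theorem MultiIdx.letters_zero (m : ℕ) : letters (MultiIdx.zero m).toFun = 0 :=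
  Multiset.card_eq_zero.1 ((card_letters _).trans (by simp [MultiIdx.toFun, MultiIdx.zero]))

theorem MultiIdx.ofMultiset_zero (m : ℕ) : MultiIdx.ofMultiset m 0 = MultiIdx.zero m :=
  MultiIdx.toFun_injective (by rw [MultiIdx.toFun_ofMultiset (by simp), multiIndex_zero]; rfl)

variable {A : Type*} [CommSemiring A]

/-- The jet of the product of two functions with jets `D` and `E`, according to the Leibniz rule. -/
def leibniz (D E : Multiset (Fin 3) → A) (s : Multiset (Fin 3)) : A :=
  (s.antidiagonal.map fun q => D q.1 * E q.2).sum

theorem leibniz_zero (D E : Multiset (Fin 3) → A) : leibniz D E 0 = D 0 * E 0 := by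
  simp [leibniz]

theorem leibniz_cons (D E : Multiset (Fin 3) → A) (i : Fin 3) (s : Multiset (Fin 3)) :
    leibniz D E (i ::ₘ s) =
      (s.antidiagonal.map fun q => D q.1 * E (i ::ₘ q.2) + D (i ::ₘ q.1) * E q.2).sum := by
  simp [leibniz, Multiset.sum_map_add]

end MultiIndex

section XPartial

variable {Y : Type v}

theorem iterate_xpd_apply (i : Fin 3) (n : ℕ) (φ : E3 × Y → ℝ) (y : Y) :
    (fun x => (xpd i)^[n] φ (x, y)) = (pd i)^[n] fun x => φ (x, y) := by
  induction n generalizing φ with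
  | zero => rfl
  | succ n ih => rw [Function.iterate_succ_apply, Function.iterate_succ_apply, ih]; rfl

theorem xPartial_eq_iterate_xpd (α : Fin 3 → ℕ) (φ : E3 × Y → ℝ) :
    xPartial α φ = (xpd 0)^[α 0] ((xpd 1)^[α 1] ((xpd 2)^[α 2] φ)) := by
  funext p
  rw [xPartial, ← iterate_xpd_apply 2, ← iterate_xpd_apply 1, ← iterate_xpd_apply 0]

theorem xPartial_zero (φ : E3 × Y → ℝ) : xPartial (multiIndex 0) φ = φ := rfl

variable [TopologicalSpace Y]

theorem xPartial_cons {φ : E3 × Y → ℝ} (hφ : ClassCX ⊤ φ) (i : Fin 3) (s : Multiset (Fin 3)) :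
    xPartial (multiIndex (i ::ₘ s)) φ = xPartial (multiIndex s) (xpd i φ) := by
  have h2 := hφ.iterate_xpd 2 (s.count 2)
  simp only [xPartial_eq_iterate_xpd, multiIndex]
  fin_cases i <;>
    simp [Function.iterate_succ_apply, iterate_xpd_comm hφ, iterate_xpd_comm h2]

theorem xPartial_singleton {φ : E3 × Y → ℝ} (hφ : ClassCX ⊤ φ) (i : Fin 3) :
    xPartial (multiIndex {i}) φ = xpd i φ :=
  xPartial_cons hφ i 0

theorem xPartial_xpd {φ : E3 × Y → ℝ} (hφ : ClassCX ⊤ φ) (i : Fin 3) (α : Fin 3 → ℕ) :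
    xPartial α (xpd i φ) = xpd i (xPartial α φ) := by
  have h2 := hφ.iterate_xpd 2 (α 2)
  simp only [xPartial_eq_iterate_xpd, iterate_xpd_comm hφ, iterate_xpd_comm h2,
    iterate_xpd_comm (h2.iterate_xpd 1 (α 1))]

theorem ClassCX.xPartial {φ : E3 × Y → ℝ} (hφ : ClassCX ⊤ φ) (α : Fin 3 → ℕ) :
    ClassCX ⊤ (xPartial α φ) := by
  rw [xPartial_eq_iterate_xpd]
  exact ((hφ.iterate_xpd _ _).iterate_xpd _ _).iterate_xpd _ _

theorem IsTest.xpd {G : Set E3} {V : Set Y} {φ : E3 × Y → ℝ} (hφ : IsTest G V φ) (i : Fin 3) :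
    IsTest G V (xpd i φ) :=
  ⟨hφ.1.xpd i, hφ.2.1.mono' ((subset_tsupport _).trans (tsupport_xpd_subset i φ)),
    (tsupport_xpd_subset i φ).trans hφ.2.2⟩

theorem IsTest.mul_classCX {G : Set E3} {V : Set Y} {φ Ψ : E3 × Y → ℝ} (hφ : IsTest G V φ)
    (hΨ : ClassCX ⊤ Ψ) : IsTest G V fun p => Ψ p * φ p :=
  ⟨hΨ.mul hφ.1, hφ.2.1.mul_left (f := Ψ),
    (closure_mono (Function.support_mul_subset_right Ψ φ)).trans hφ.2.2⟩

end XPartial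

section Leibniz

variable {Y : Type v} [TopologicalSpace Y] [MeasurableSpace Y] {G : Set E3} {V : Set Y}
  {μ : Measure (E3 × Y)} {u v w : E3 × Y → ℝ}

theorem HasWeakXDeriv.multiset_sum {ι : Type*} {α : Fin 3 → ℕ} {t : Multiset ι}
    {u v : ι → E3 × Y → ℝ} (h : ∀ j ∈ t, HasWeakXDeriv G V μ α (u j) (v j)) :
    HasWeakXDeriv G V μ α (t.map u).sum (t.map v).sum := by
  induction t using Multiset.induction_on with
  | empty => intro φ _; simp
  | cons j t ih =>
    simp only [Multiset.map_cons, Multiset.sum_cons]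
    exact (h j (Multiset.mem_cons_self j t)).add (ih fun k hk => h k (Multiset.mem_cons_of_mem hk))

theorem HasWeakXDeriv.cons {i : Fin 3} {s : Multiset (Fin 3)}
    (h : HasWeakXDeriv G V μ (multiIndex s) u v) (h' : HasWeakXDeriv G V μ (multiIndex {i}) v w) :
    HasWeakXDeriv G V μ (multiIndex (i ::ₘ s)) u w := by
  intro φ hφ
  obtain ⟨hu, -, huv⟩ := h _ (hφ.xpd i)
  obtain ⟨-, hw, hvw⟩ := h' φ hφ
  rw [xPartial_singleton hφ.1] at hvw
  rw [xPartial_cons hφ.1, huv, hvw]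
  refine ⟨hu, hw, ?_⟩
  simp only [sum_multiIndex, Multiset.card_cons, Multiset.card_singleton]
  ring

theorem HasWeakXDeriv.of_cons {i : Fin 3} {s : Multiset (Fin 3)}
    (h : HasWeakXDeriv G V μ (multiIndex s) u v)
    (h' : HasWeakXDeriv G V μ (multiIndex (i ::ₘ s)) u w) :
    HasWeakXDeriv G V μ (multiIndex {i}) v w := by
  intro φ hφ
  obtain ⟨-, hv, huv⟩ := h _ (hφ.xpd i)
  obtain ⟨-, hw, huw⟩ := h' φ hφ
  rw [xPartial_cons hφ.1, huv] at huw
  rw [xPartial_singleton hφ.1]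
  refine ⟨hv, hw, mul_left_cancel₀ (pow_ne_zero s.card (neg_ne_zero.2 (one_ne_zero' ℝ))) ?_⟩
  simp only [sum_multiIndex, Multiset.card_cons, Multiset.card_singleton] at huw ⊢
  rw [huw]
  ring

theorem HasWeakXDeriv.mul_classCX {i : Fin 3} (h : HasWeakXDeriv G V μ (multiIndex {i}) u v)
    (hu : ∀ φ, IsTest G V φ → Integrable (fun p => u p * φ p) μ) {Ψ : E3 × Y → ℝ}
    (hΨ : ClassCX ⊤ Ψ) :
    HasWeakXDeriv G V μ (multiIndex {i}) (u * Ψ) (u * xpd i Ψ + v * Ψ) := by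
  intro φ hφ
  have h₁ := hu _ ((hφ.xpd i).mul_classCX hΨ)
  have h₂ := hu _ (hφ.mul_classCX (hΨ.xpd i))
  obtain ⟨-, h₃, h₄⟩ := h _ (hφ.mul_classCX hΨ)
  simp only [xPartial_singleton (hΨ.mul hφ.1), xPartial_singleton hφ.1, xpd_mul hΨ hφ.1,
    sum_multiIndex, Multiset.card_singleton, pow_one, neg_one_mul, Pi.add_apply, Pi.mul_apply,
    mul_add, add_mul, mul_assoc] at h₁ h₂ h₃ h₄ ⊢
  rw [integral_add h₁ h₂] at h₄
  rw [integral_add h₂ h₃]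
  exact ⟨h₁, h₂.add h₃, by linarith⟩

/-- `D s` is the weak derivative of `D 0` with multi-index `multiIndex s`, for all words `s` of
length at most `m`: the `m`-jet of a weakly differentiable function. -/
def IsWeakJet (m : ℕ) (G : Set E3) (V : Set Y) (μ : Measure (E3 × Y))
    (D : Multiset (Fin 3) → E3 × Y → ℝ) : Prop :=
  ∀ s : Multiset (Fin 3), s.card ≤ m → HasWeakXDeriv G V μ (multiIndex s) (D 0) (D s)

theorem IsWeakJet.leibniz {m : ℕ} {D : Multiset (Fin 3) → E3 × Y → ℝ} (hD : IsWeakJet m G V μ D)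
    {Ψ : E3 × Y → ℝ} (hΨ : ClassCX ⊤ Ψ) :
    IsWeakJet m G V μ (leibniz D fun s => xPartial (multiIndex s) Ψ) := by
  intro s
  induction s using Multiset.induction_on with
  | empty =>
    intro _ φ hφ
    have h := hD 0 m.zero_le _ (hφ.mul_classCX hΨ)
    simpa [leibniz_zero, xPartial_zero, sum_multiIndex, mul_assoc] using h.2.1
  | cons i s ih =>
    intro hs
    have hs' : s.card + 1 ≤ m := by simpa using hs
    refine (ih (by omega)).cons ?_
    rw [leibniz_cons]
    refine HasWeakXDeriv.multiset_sum fun q hq => ?_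
    have hq' : q.1.card ≤ s.card :=
      Multiset.card_le_card (Multiset.mem_antidiagonal.1 hq ▸ Multiset.le_add_right q.1 q.2)
    rw [xPartial_cons hΨ, xPartial_xpd hΨ]
    exact ((hD q.1 (by omega)).of_cons (hD (i ::ₘ q.1) (by simp; omega))).mul_classCX
      (fun φ hφ => (hD q.1 (by omega) φ hφ).2.1) (hΨ.xPartial _)

end Leibniz

/-! ### The fundamental lemma of the calculus of variations -/

section FundamentalLemma

theorem exists_seq_contDiff_tendsto_indicator {E : Type*} [NormedAddCommGroup E]
    [NormedSpace ℝ E] [FiniteDimensional ℝ E] {F : Set E} (hF : IsClosed F) :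
    ∃ f : ℕ → E → ℝ, (∀ n, ContDiff ℝ (⊤ : ℕ∞) (f n)) ∧ (∀ n x, f n x ∈ Icc (0 : ℝ) 1) ∧
      ∀ x, Tendsto (fun n => f n x) atTop (𝓝 (F.indicator (fun _ => 1) x)) := by
  obtain ⟨f, hf_supp, hf, hf01⟩ := hF.isOpen_compl.exists_contDiff_support_eq (n := ⊤)
  have hf01 (x : E) : f x ∈ Icc (0 : ℝ) 1 := hf01 (mem_range_self x)
  have hmem (x : E) : f x = 0 ↔ x ∈ F := by
    rw [← Function.notMem_support, hf_supp, notMem_compl_iff]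
  refine ⟨fun n x => (1 - f x) ^ n, fun n => (contDiff_const.sub hf).pow n, fun n x =>
    ⟨pow_nonneg (sub_nonneg.2 (hf01 x).2) n,
      pow_le_one₀ (sub_nonneg.2 (hf01 x).2) (sub_le_self 1 (hf01 x).1)⟩, fun x => ?_⟩
  by_cases hx : x ∈ F
  · simp [hx, (hmem x).2 hx]
  · have hpos : 0 < f x := (hf01 x).1.lt_of_ne' (mt (hmem x).1 hx)
    simpa [hx] using tendsto_pow_atTop_nhds_zero_of_lt_one (sub_nonneg.2 (hf01 x).2)
      (sub_lt_self 1 hpos)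

variable {Y : Type v} [TopologicalSpace Y]

theorem isTest_mul_prod {G : Set E3} {V : Set Y} {f : E3 → ℝ} (hf : ContDiff ℝ (⊤ : ℕ∞) f)
    (hfc : HasCompactSupport f) (hfG : tsupport f ⊆ G) {g : Y → ℝ} (hg : Continuous g)
    (hgc : HasCompactSupport g) (hgV : tsupport g ⊆ V) :
    IsTest G V fun p : E3 × Y => f p.1 * g p.2 := by
  have hsub : tsupport (fun p : E3 × Y => f p.1 * g p.2) ⊆ tsupport f ×ˢ tsupport g := by
    refine closure_minimal (fun p hp => ?_) ((isClosed_tsupport f).prod (isClosed_tsupport g))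
    have hp' : f p.1 * g p.2 ≠ 0 := hp
    exact ⟨subset_tsupport f (left_ne_zero_of_mul hp'),
      subset_tsupport g (right_ne_zero_of_mul hp')⟩
  exact ⟨(classCX_of_contDiff hf).mul (classCX_of_continuous hg),
    IsCompact.of_isClosed_subset (hfc.prod hgc) (isClosed_tsupport _) hsub,
    hsub.trans (prod_mono hfG hgV)⟩

theorem exists_isTest_ne_zero [RegularSpace Y] [LocallyCompactSpace Y] {G : Set E3} {V : Set Y}
    (hG : IsOpen G) (hV : IsOpen V) {p : E3 × Y} (hp : p ∈ G ×ˢ V) :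
    ∃ φ, IsTest G V φ ∧ φ p ≠ 0 := by
  obtain ⟨f, hfG, hfc, hf, -, hf1⟩ := exists_contDiff_tsupport_subset (n := ⊤) (hG.mem_nhds hp.1)
  obtain ⟨k, -, k_closed, sk, kV⟩ := exists_compact_closed_between
    (isCompact_singleton (x := p.2)) hV (singleton_subset_iff.2 hp.2)
  obtain ⟨g, hg1, hg0, hgc, -⟩ := exists_continuous_one_zero_of_isCompact
    (isCompact_singleton (x := p.2)) (isOpen_interior (s := k)).isClosed_compl
    (disjoint_compl_right_iff_subset.2 sk)
  have hgk : tsupport g ⊆ k := closure_minimal (fun y hy => by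
    by_contra hyk
    exact hy (hg0 fun h => hyk (interior_subset h))) k_closed
  refine ⟨_, isTest_mul_prod hf hfc hfG g.continuous hgc (hgk.trans kV), ?_⟩
  have : g p.2 = 1 := hg1 rfl
  simp [hf1, this]

variable [HasOuterApproxClosed Y] [MeasurableSpace Y] [BorelSpace Y] {μ : Measure (E3 × Y)}
  {h : E3 × Y → ℝ}

theorem setIntegral_prod_eq_zero_of_forall_contDiff (hh : Integrable h μ)
    (h0 : ∀ f : E3 → ℝ, ContDiff ℝ (⊤ : ℕ∞) f → ∀ g : Y → ℝ, Continuous g →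
      ∫ p, h p * (f p.1 * g p.2) ∂μ = 0)
    {F : Set E3} (hF : IsClosed F) {K : Set Y} (hK : IsClosed K) :
    ∫ p in F ×ˢ K, h p ∂μ = 0 := by
  obtain ⟨f, hf, hf01, hfF⟩ := exists_seq_contDiff_tendsto_indicator hF
  have hg (n : ℕ) : Continuous fun y => (hK.apprSeq n y : ℝ) := by fun_prop
  have hgK (y : Y) : Tendsto (fun n => (hK.apprSeq n y : ℝ)) atTop
      (𝓝 (K.indicator (fun _ => (1 : ℝ≥0)) y : ℝ≥0)) :=
    NNReal.tendsto_coe.2 ((tendsto_pi_nhds.1 (HasOuterApproxClosed.tendsto_apprSeq hK)) y)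
  have hlim : Tendsto (fun n => ∫ p, h p * (f n p.1 * hK.apprSeq n p.2) ∂μ) atTop
      (𝓝 (∫ p, (F ×ˢ K).indicator h p ∂μ)) := by
    refine tendsto_integral_of_dominated_convergence (fun p => ‖h p‖) (fun n => ?_) hh.norm
      (fun n => ae_of_all μ fun p => ?_) (ae_of_all μ fun p => ?_)
    · exact hh.1.mul (((hf n).continuous.measurable.comp measurable_fst).mul
        ((hg n).measurable.comp measurable_snd)).aestronglyMeasurable
    · rw [norm_mul]
      refine mul_le_of_le_one_right (norm_nonneg _) ?_
      rw [Real.norm_of_nonneg (mul_nonneg (hf01 n p.1).1 NNReal.zero_le_coe)]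
      exact mul_le_one₀ (hf01 n p.1).2 NNReal.zero_le_coe
        (HasOuterApproxClosed.apprSeq_apply_le_one hK n p.2)
    · convert ((hfF p.1).mul (hgK p.2)).const_mul (h p) using 2
      by_cases hpF : p.1 ∈ F <;> by_cases hpK : p.2 ∈ K <;> simp [hpF, hpK]
  rw [← integral_indicator (hF.measurableSet.prod hK.measurableSet)]
  exact tendsto_nhds_unique hlim (by simp [h0 _ (hf _) _ (hg _)])

theorem ae_eq_zero_of_forall_contDiff [SecondCountableTopology Y] (hh : Integrable h μ)
    (h0 : ∀ f : E3 → ℝ, ContDiff ℝ (⊤ : ℕ∞) f → ∀ g : Y → ℝ, Continuous g →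
      ∫ p, h p * (f p.1 * g p.2) ∂μ = 0) : h =ᵐ[μ] 0 := by
  have hgen : (inferInstance : MeasurableSpace (E3 × Y)) = MeasurableSpace.generateFrom
      (image2 (· ×ˢ ·) {F : Set E3 | IsClosed F} {K : Set Y | IsClosed K}) := by
    refine (generateFrom_eq_prod ?_ ?_ ?_ ?_).symm
    · rw [← borel_eq_generateFrom_isClosed, BorelSpace.measurable_eq (α := E3)]
    · rw [← borel_eq_generateFrom_isClosed, BorelSpace.measurable_eq (α := Y)]
    · exact ⟨fun _ => univ, fun _ => isClosed_univ, iUnion_const _⟩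
    · exact ⟨fun _ => univ, fun _ => isClosed_univ, iUnion_const _⟩
  have hbox {F : Set E3} (hF : IsClosed F) {K : Set Y} (hK : IsClosed K) :=
    setIntegral_prod_eq_zero_of_forall_contDiff hh h0 hF hK
  suffices ∀ t, MeasurableSet t → ∫ p in t, h p ∂μ = 0 from
    hh.ae_eq_zero_of_forall_setIntegral_eq_zero fun t ht _ => this t ht
  intro t ht
  induction t, ht using MeasurableSpace.induction_on_inter hgen
    (isPiSystem_isClosed.prod isPiSystem_isClosed) with
  | empty => simp
  | basic t ht =>
    obtain ⟨F, hF, K, hK, rfl⟩ := ht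
    exact hbox hF hK
  | compl t ht ih =>
    have huniv := hbox isClosed_univ isClosed_univ
    rw [univ_prod_univ, setIntegral_univ] at huniv
    rw [setIntegral_compl ht hh, ih, huniv, sub_zero]
  | iUnion t hd ht ih =>
    rw [integral_iUnion ht hd hh.integrableOn, tsum_congr ih, tsum_zero]

variable [SecondCountableTopology Y] [RegularSpace Y] [LocallyCompactSpace Y] {G : Set E3}
  {V : Set Y}

theorem ae_eq_zero_of_forall_isTest (hG : IsOpen G) (hV : IsOpen V)
    (hμ : ∀ᵐ p ∂μ, p ∈ G ×ˢ V) {w : E3 × Y → ℝ}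
    (hw : ∀ φ, IsTest G V φ → Integrable (fun p => w p * φ p) μ)
    (hw0 : ∀ φ, IsTest G V φ → ∫ p, w p * φ p ∂μ = 0) : w =ᵐ[μ] 0 := by
  have hwφ : ∀ φ, IsTest G V φ → (fun p => w p * φ p) =ᵐ[μ] 0 := fun φ hφ =>
    ae_eq_zero_of_forall_contDiff (hw φ hφ) fun f hf g hg => by
      have := hw0 _ (hφ.mul_classCX ((classCX_of_contDiff hf).mul (classCX_of_continuous hg)))
      simpa only [mul_assoc, mul_comm (φ _)] using this
  have hnull : μ ({p | w p ≠ 0} ∩ G ×ˢ V) = 0 := by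
    refine measure_null_of_locally_null _ fun p hp => ?_
    obtain ⟨φ, hφ, hφp⟩ := exists_isTest_ne_zero hG hV hp.2
    refine ⟨{q | w q * φ q ≠ 0}, ?_, hwφ φ hφ⟩
    have h1 : {q | φ q ≠ 0} ∈ 𝓝 p := (hφ.1.continuous.isOpen_preimage _ isOpen_ne).mem_nhds hφp
    filter_upwards [mem_nhdsWithin_of_mem_nhds h1, self_mem_nhdsWithin] with q hq hq'
    exact mul_ne_zero hq'.1 hq
  filter_upwards [hμ, measure_eq_zero_iff_ae_notMem.1 hnull] with p hp hp'
  by_contra hwp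
  exact hp' ⟨hwp, hp⟩

theorem HasWeakXDeriv.ae_unique (hG : IsOpen G) (hV : IsOpen V) (hμ : ∀ᵐ p ∂μ, p ∈ G ×ˢ V)
    {α : Fin 3 → ℕ} {u v v' : E3 × Y → ℝ} (h : HasWeakXDeriv G V μ α u v)
    (h' : HasWeakXDeriv G V μ α u v') : v =ᵐ[μ] v' := by
  rw [← sub_ae_eq_zero]
  refine ae_eq_zero_of_forall_isTest hG hV hμ (fun φ hφ => ?_) fun φ hφ => ?_
  · simp only [Pi.sub_apply, sub_mul]
    exact (h φ hφ).2.1.sub (h' φ hφ).2.1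
  · obtain ⟨-, hv, huv⟩ := h φ hφ
    obtain ⟨-, hv', huv'⟩ := h' φ hφ
    simp only [Pi.sub_apply, sub_mul]
    rw [integral_sub hv hv', sub_eq_zero]
    exact mul_left_cancel₀ (pow_ne_zero _ (neg_ne_zero.2 one_ne_zero)) (huv.symm.trans huv')

end FundamentalLemma

/-! ### Integral operators and the Schur test -/

section Schur

variable {P A : Type*} [MeasurableSpace P] [MeasurableSpace A] {μ : Measure P} {ν : Measure A}
  {s : P × A → P × A} {κ : P × A → ℝ} {N₁ N₂ : ℝ≥0}

theorem sq_lintegral_mul_le {k f : A → ℝ≥0∞} (hk : Measurable k) (hf : Measurable f) :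
    (∫⁻ b, k b * f b ∂ν) ^ 2 ≤ (∫⁻ b, k b ∂ν) * ∫⁻ b, k b * f b ^ 2 ∂ν := by
  have h := ENNReal.lintegral_mul_le_Lp_mul_Lq (ν.withDensity k) Real.HolderConjugate.two_two
    (f := fun _ => 1) (g := f) aemeasurable_const hf.aemeasurable
  simp only [Pi.mul_apply, one_mul, ENNReal.one_rpow] at h
  rw [lintegral_withDensity_eq_lintegral_mul _ hk hf,
    lintegral_withDensity_eq_lintegral_mul _ hk measurable_const,
    lintegral_withDensity_eq_lintegral_mul _ hk (hf.pow_const _)] at h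
  simp only [Pi.mul_apply, mul_one] at h
  calc (∫⁻ b, k b * f b ∂ν) ^ 2 ≤ ((∫⁻ b, k b ∂ν) ^ (1 / (2 : ℝ)) *
        (∫⁻ b, k b * f b ^ (2 : ℝ) ∂ν) ^ (1 / (2 : ℝ))) ^ 2 := by gcongr
    _ = _ := by
      rw [mul_pow, ← ENNReal.rpow_natCast, ← ENNReal.rpow_mul, ← ENNReal.rpow_natCast,
        ← ENNReal.rpow_mul]
      norm_num

theorem eLpNorm_two_sq_eq_lintegral {f : P → ℝ} : eLpNorm f 2 μ ^ 2 = ∫⁻ p, ‖f p‖ₑ ^ 2 ∂μ := by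
  have := eLpNorm_nnreal_pow_eq_lintegral (μ := μ) (f := f) (p := 2) (by norm_num)
  simpa using this

/-- `κ` is the kernel of an integral operator `f ↦ ∫ κ(p, b) f((s(p, b)).1) db` which satisfies
the hypotheses of the Schur test. The involution `s` of `P × A` exchanges the outer and the inner
integration variable, the remaining variables of `p` being parameters. -/
structure SchurKernel (μ : Measure P) (ν : Measure A) (s : P × A → P × A) (κ : P × A → ℝ)
    (N₁ N₂ : ℝ≥0) : Prop where
  mp : MeasurePreserving s (μ.prod ν) (μ.prod ν)
  invol : ∀ r, s (s r) = r
  measurable : Measurable κ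
  bound : ∀ᵐ p ∂μ, ∫⁻ b, ‖κ (p, b)‖ₑ ∂ν ≤ N₁
  bound' : ∀ᵐ p ∂μ, ∫⁻ b, ‖κ (s (p, b))‖ₑ ∂ν ≤ N₂

/-- The integral operator with kernel `κ`; see `SchurKernel` for the role of `s`. -/
def schurFun (ν : Measure A) (s : P × A → P × A) (κ : P × A → ℝ) (f : P → ℝ) (p : P) : ℝ :=
  ∫ b, κ (p, b) * f (s (p, b)).1 ∂ν

theorem SchurKernel.measurable_integrand (h : SchurKernel μ ν s κ N₁ N₂) {f : P → ℝ}
    (hf : Measurable f) : Measurable fun r => κ r * f (s r).1 :=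
  h.measurable.mul (hf.comp (measurable_fst.comp h.mp.measurable))

variable [SFinite ν]

theorem SchurKernel.lintegral_sq_le (h : SchurKernel μ ν s κ N₁ N₂) {f : P → ℝ}
    (hf : Measurable f) :
    ∫⁻ p, (∫⁻ b, ‖κ (p, b)‖ₑ * ‖f (s (p, b)).1‖ₑ ∂ν) ^ 2 ∂μ ≤
      N₁ * N₂ * ∫⁻ p, ‖f p‖ₑ ^ 2 ∂μ := by
  have hκ := h.measurable
  have hs := h.mp.measurable
  have hfs : Measurable fun r => f (s r).1 := hf.comp (measurable_fst.comp hs)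
  have m1 : Measurable fun r : P × A => ‖κ r‖ₑ * ‖f (s r).1‖ₑ ^ 2 :=
    hκ.enorm.mul (hfs.enorm.pow_const 2)
  have m2 : Measurable fun r : P × A => ‖κ (s r)‖ₑ * ‖f r.1‖ₑ ^ 2 :=
    (hκ.comp hs).enorm.mul ((hf.comp measurable_fst).enorm.pow_const 2)
  calc ∫⁻ p, (∫⁻ b, ‖κ (p, b)‖ₑ * ‖f (s (p, b)).1‖ₑ ∂ν) ^ 2 ∂μ
      ≤ ∫⁻ p, N₁ * ∫⁻ b, ‖κ (p, b)‖ₑ * ‖f (s (p, b)).1‖ₑ ^ 2 ∂ν ∂μ := by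
        refine lintegral_mono_ae ?_
        filter_upwards [h.bound] with p hp
        refine (sq_lintegral_mul_le (hκ.comp measurable_prodMk_left).enorm
          (hfs.comp measurable_prodMk_left).enorm).trans ?_
        exact mul_le_mul' hp le_rfl
    _ = N₁ * ∫⁻ r, ‖κ r‖ₑ * ‖f (s r).1‖ₑ ^ 2 ∂(μ.prod ν) := by
        rw [lintegral_const_mul _ m1.lintegral_prod_right', lintegral_prod _ m1.aemeasurable]
    _ = N₁ * ∫⁻ r, ‖κ (s r)‖ₑ * ‖f r.1‖ₑ ^ 2 ∂(μ.prod ν) := by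
        rw [← h.mp.lintegral_comp m1]
        simp only [h.invol]
    _ = N₁ * ∫⁻ p, (∫⁻ b, ‖κ (s (p, b))‖ₑ ∂ν) * ‖f p‖ₑ ^ 2 ∂μ := by
        rw [lintegral_prod _ m2.aemeasurable]
        congr 1
        refine lintegral_congr fun p => ?_
        have hm : Measurable fun b => ‖κ (s (p, b))‖ₑ :=
          ((hκ.comp hs).comp measurable_prodMk_left).enorm
        exact lintegral_mul_const (μ := ν) (‖f p‖ₑ ^ 2) hm
    _ ≤ N₁ * ∫⁻ p, N₂ * ‖f p‖ₑ ^ 2 ∂μ := by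
        refine mul_le_mul' le_rfl (lintegral_mono_ae ?_)
        filter_upwards [h.bound'] with p hp
        exact mul_le_mul' hp le_rfl
    _ = _ := by rw [lintegral_const_mul _ (hf.enorm.pow_const 2), mul_assoc]

theorem SchurKernel.measurable_lintegral (h : SchurKernel μ ν s κ N₁ N₂) {f : P → ℝ}
    (hf : Measurable f) :
    Measurable fun p => ∫⁻ b, ‖κ (p, b)‖ₑ * ‖f (s (p, b)).1‖ₑ ∂ν := by
  have := (h.measurable_integrand hf).enorm.lintegral_prod_right' (ν := ν)
  simpa [enorm_mul] using this

theorem SchurKernel.lintegral_sq_lt_top (h : SchurKernel μ ν s κ N₁ N₂) {f : P → ℝ}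
    (hf : Measurable f) (hf2 : MemLp f 2 μ) :
    ∫⁻ p, (∫⁻ b, ‖κ (p, b)‖ₑ * ‖f (s (p, b)).1‖ₑ ∂ν) ^ 2 ∂μ < ∞ := by
  refine (h.lintegral_sq_le hf).trans_lt ?_
  rw [← eLpNorm_two_sq_eq_lintegral]
  exact ENNReal.mul_lt_top (ENNReal.mul_lt_top ENNReal.coe_lt_top ENNReal.coe_lt_top)
    (ENNReal.pow_lt_top hf2.2)

theorem SchurKernel.ae_integrable (h : SchurKernel μ ν s κ N₁ N₂) {f : P → ℝ}
    (hf : Measurable f) (hf2 : MemLp f 2 μ) :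
    ∀ᵐ p ∂μ, Integrable (fun b => κ (p, b) * f (s (p, b)).1) ν := by
  have h1 := ae_lt_top ((h.measurable_lintegral hf).pow_const 2) (h.lintegral_sq_lt_top hf hf2).ne
  filter_upwards [h1] with p hp
  refine ⟨((h.measurable_integrand hf).comp measurable_prodMk_left).aestronglyMeasurable, ?_⟩
  simpa only [HasFiniteIntegral, enorm_mul] using (ENNReal.pow_lt_top_iff.1 hp).resolve_right
    two_ne_zero

theorem SchurKernel.measurable_schurFun (h : SchurKernel μ ν s κ N₁ N₂) {f : P → ℝ}
    (hf : Measurable f) : StronglyMeasurable (schurFun ν s κ f) :=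
  (h.measurable_integrand hf).stronglyMeasurable.integral_prod_right'

theorem SchurKernel.eLpNorm_schurFun_le (h : SchurKernel μ ν s κ N₁ N₂) {f : P → ℝ}
    (hf : Measurable f) :
    eLpNorm (schurFun ν s κ f) 2 μ ≤ NNReal.sqrt (N₁ * N₂) * eLpNorm f 2 μ := by
  rw [← ENNReal.pow_le_pow_left_iff two_ne_zero, mul_pow, ← ENNReal.coe_pow, NNReal.sq_sqrt,
    ENNReal.coe_mul, eLpNorm_two_sq_eq_lintegral, eLpNorm_two_sq_eq_lintegral]
  refine (lintegral_mono fun p => ?_).trans (h.lintegral_sq_le hf)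
  gcongr
  simpa only [schurFun, enorm_mul] using
    enorm_integral_le_lintegral_enorm fun b => κ (p, b) * f (s (p, b)).1

theorem SchurKernel.memLp (h : SchurKernel μ ν s κ N₁ N₂) {f : P → ℝ}
    (hf : Measurable f) (hf2 : MemLp f 2 μ) : MemLp (schurFun ν s κ f) 2 μ :=
  ⟨(h.measurable_schurFun hf).aestronglyMeasurable,
    (h.eLpNorm_schurFun_le hf).trans_lt (ENNReal.mul_lt_top ENNReal.coe_lt_top hf2.2)⟩

theorem ae_ae_comp_fst_of_measurePreserving {Q : P → Prop}
    (hs : MeasurePreserving s (μ.prod ν) (μ.prod ν)) (hQ : ∀ᵐ p ∂μ, Q p) :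
    ∀ᵐ p ∂μ, ∀ᵐ b ∂ν, Q (s (p, b)).1 :=
  Measure.ae_ae_of_ae_prod (hs.quasiMeasurePreserving.ae (Measure.quasiMeasurePreserving_fst.ae hQ))

theorem schurFun_congr {f g : P → ℝ} (hs : MeasurePreserving s (μ.prod ν) (μ.prod ν))
    (hfg : f =ᵐ[μ] g) : schurFun ν s κ f =ᵐ[μ] schurFun ν s κ g := by
  filter_upwards [ae_ae_comp_fst_of_measurePreserving hs hfg] with p hp
  refine integral_congr_ae ?_
  filter_upwards [hp] with b hb
  rw [hb]

theorem SchurKernel.schurFun_add (h : SchurKernel μ ν s κ N₁ N₂) (f g : Lp ℝ 2 μ) :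
    schurFun ν s κ ⇑(f + g) =ᵐ[μ] schurFun ν s κ f + schurFun ν s κ g := by
  refine (schurFun_congr h.mp (Lp.coeFn_add f g)).trans ?_
  filter_upwards [h.ae_integrable (Lp.stronglyMeasurable f).measurable (Lp.memLp f),
    h.ae_integrable (Lp.stronglyMeasurable g).measurable (Lp.memLp g)] with p hf hg
  simp only [schurFun, Pi.add_apply, mul_add]
  exact integral_add hf hg

theorem SchurKernel.schurFun_smul (h : SchurKernel μ ν s κ N₁ N₂) (c : ℝ) (f : Lp ℝ 2 μ) :
    schurFun ν s κ ⇑(c • f) =ᵐ[μ] c • schurFun ν s κ f := by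
  refine (schurFun_congr h.mp (Lp.coeFn_smul c f)).trans (ae_of_all _ fun p => ?_)
  simp only [schurFun, Pi.smul_apply, smul_eq_mul, mul_left_comm _ c]
  exact integral_const_mul _ _

/-- The bounded operator on `L²` with kernel `κ`. -/
def SchurKernel.toCLM (h : SchurKernel μ ν s κ N₁ N₂) : Lp ℝ 2 μ →L[ℝ] Lp ℝ 2 μ :=
  LinearMap.mkContinuous
    { toFun := fun f => (h.memLp (Lp.stronglyMeasurable f).measurable (Lp.memLp f)).toLp _
      map_add' := fun f g => by
        rw [← MemLp.toLp_add]
        exact (MemLp.toLp_eq_toLp_iff _ _).2 (h.schurFun_add f g)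
      map_smul' := fun c f => by
        rw [RingHom.id_apply, ← MemLp.toLp_const_smul]
        exact (MemLp.toLp_eq_toLp_iff _ _).2 (h.schurFun_smul c f) }
    (NNReal.sqrt (N₁ * N₂)) fun f => by
      rw [LinearMap.coe_mk, AddHom.coe_mk, Lp.norm_toLp, Lp.norm_def]
      simpa only [ENNReal.toReal_mul, ENNReal.coe_toReal] using ENNReal.toReal_mono
        (ENNReal.mul_ne_top ENNReal.coe_ne_top (Lp.eLpNorm_ne_top f))
        (h.eLpNorm_schurFun_le (Lp.stronglyMeasurable f).measurable)

theorem SchurKernel.coeFn_toCLM (h : SchurKernel μ ν s κ N₁ N₂) (f : Lp ℝ 2 μ) :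
    h.toCLM f =ᵐ[μ] schurFun ν s κ f :=
  MemLp.coeFn_toLp (h.memLp (Lp.stronglyMeasurable f).measurable (Lp.memLp f))

theorem SchurKernel.norm_toCLM_le (h : SchurKernel μ ν s κ N₁ N₂) :
    ‖h.toCLM‖ ≤ √(N₁ * N₂) := by
  refine (LinearMap.mkContinuous_norm_le _ (NNReal.coe_nonneg _) _).trans_eq ?_
  simp

theorem SchurKernel.integrable_mul (h : SchurKernel μ ν s κ N₁ N₂) {f φ : P → ℝ}
    (hf : Measurable f) (hf2 : MemLp f 2 μ) (hφ : Measurable φ) (hφ2 : MemLp φ 2 μ) :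
    Integrable (fun r => κ r * f (s r).1 * φ r.1) (μ.prod ν) := by
  have hm : Measurable fun r => κ r * f (s r).1 * φ r.1 :=
    (h.measurable_integrand hf).mul (hφ.comp measurable_fst)
  refine ⟨hm.aestronglyMeasurable, ?_⟩
  rw [HasFiniteIntegral, lintegral_prod _ hm.enorm.aemeasurable]
  have hm' := h.measurable_lintegral hf
  have e : ∀ p, ∫⁻ b, ‖κ (p, b) * f (s (p, b)).1 * φ p‖ₑ ∂ν =
      (∫⁻ b, ‖κ (p, b)‖ₑ * ‖f (s (p, b)).1‖ₑ ∂ν) * ‖φ p‖ₑ := by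
    intro p
    have := ((h.measurable_integrand hf).comp (measurable_prodMk_left (x := p))).enorm
    simp only [Function.comp_def, enorm_mul] at this
    rw [← lintegral_mul_const _ this]
    simp only [enorm_mul]
  simp only [e]
  have hold := ENNReal.lintegral_mul_le_Lp_mul_Lq μ Real.HolderConjugate.two_two
    hm'.aemeasurable hφ.enorm.aemeasurable
  refine hold.trans_lt (ENNReal.mul_lt_top ?_ ?_)
  · refine ENNReal.rpow_lt_top_of_nonneg (by norm_num) ?_
    simpa using (h.lintegral_sq_lt_top hf hf2).ne
  · refine ENNReal.rpow_lt_top_of_nonneg (by norm_num) ?_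
    have : ∫⁻ p, ‖φ p‖ₑ ^ 2 ∂μ < ∞ := by
      rw [← eLpNorm_two_sq_eq_lintegral]; exact ENNReal.pow_lt_top hφ2.2
    simpa using this.ne

variable [SFinite μ]

theorem SchurKernel.integral_schurFun_mul (h : SchurKernel μ ν s κ N₁ N₂) {f φ : P → ℝ}
    (hf : Measurable f) (hf2 : MemLp f 2 μ) (hφ : Measurable φ) (hφ2 : MemLp φ 2 μ) :
    ∫ p, schurFun ν s κ f p * φ p ∂μ = ∫ r, κ r * f (s r).1 * φ r.1 ∂(μ.prod ν) := by
  rw [integral_prod _ (h.integrable_mul hf hf2 hφ hφ2)]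
  refine integral_congr_ae (ae_of_all _ fun p => ?_)
  simp only [schurFun]
  rw [integral_mul_const]

end Schur

/-! ### The measures -/

section Measures

instance : IsFiniteMeasure sphereMeasure :=
  inferInstanceAs (IsFiniteMeasure (volume : Measure E3).toSphere)

variable (G : Set E3) (E₀ Em : ℝ)

instance : SFinite (phaseMeasure G E₀ Em) := by
  have : SFinite ((volume : Measure E3).restrict G) := inferInstance
  unfold phaseMeasure
  infer_instance

variable {G}

theorem isFiniteMeasure_restrict_of_isBounded (hG : Bornology.IsBounded G) :
    IsFiniteMeasure ((volume : Measure E3).restrict G) :=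
  isFiniteMeasure_restrict.2 hG.measure_lt_top.ne

theorem isFiniteMeasure_phaseMeasure (hG : Bornology.IsBounded G) :
    IsFiniteMeasure (phaseMeasure G E₀ Em) := by
  have := isFiniteMeasure_restrict_of_isBounded hG
  unfold phaseMeasure
  infer_instance

theorem ae_restrict_Icc_mem_Ioo : ∀ᵐ E ∂(volume : Measure ℝ).restrict (Icc E₀ Em),
    E ∈ Ioo E₀ Em := by
  rw [← restrict_Ioo_eq_restrict_Icc]
  exact ae_restrict_mem measurableSet_Ioo

theorem ae_mem_phaseDomain (hG : IsOpen G) :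
    ∀ᵐ p ∂phaseMeasure G E₀ Em, p ∈ G ×ˢ ((univ : Set S2) ×ˢ Ioo E₀ Em) := by
  filter_upwards [Measure.quasiMeasurePreserving_fst.ae (ae_restrict_mem hG.measurableSet),
    Measure.quasiMeasurePreserving_snd.ae (Measure.quasiMeasurePreserving_snd.ae
      (ae_restrict_Icc_mem_Ioo E₀ Em))] with p hx hE
  exact ⟨hx, mem_univ _, hE⟩

theorem ae_mem_kernelDomain (hG : IsOpen G) : ∀ᵐ p ∂kernelMeasure G E₀ Em,
    p ∈ G ×ˢ ((univ : Set S2) ×ˢ ((univ : Set S2) ×ˢ Ioo E₀ Em)) := by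
  filter_upwards [Measure.quasiMeasurePreserving_fst.ae (ae_restrict_mem hG.measurableSet),
    Measure.quasiMeasurePreserving_snd.ae (Measure.quasiMeasurePreserving_snd.ae
      (Measure.quasiMeasurePreserving_snd.ae (ae_restrict_Icc_mem_Ioo E₀ Em)))] with p hx hE
  exact ⟨hx, mem_univ _, mem_univ _, hE⟩

/-- Exchange of the first and the last variable. -/
def swapOuter {A Y : Type*} (r : (A × Y) × A) : (A × Y) × A := ((r.2, r.1.2), r.1.1)

theorem measurePreserving_swapOuter {A Y : Type*} [MeasurableSpace A] [MeasurableSpace Y]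
    (γ : Measure A) (ρ : Measure Y) [SFinite γ] [SFinite ρ] :
    MeasurePreserving (swapOuter (A := A) (Y := Y)) ((γ.prod ρ).prod γ) ((γ.prod ρ).prod γ) :=
  ((Measure.measurePreserving_swap (μ := ρ) (ν := γ)).prod (MeasurePreserving.id γ)).comp
    ((Measure.measurePreserving_swap (μ := γ) (ν := ρ.prod γ)).comp
      (measurePreserving_prodAssoc γ ρ γ))

/-- Exchange of the two directions in `((x, ω, E), ω')`. -/
def swapAngles (r : Phase × S2) : Phase × S2 := ((r.1.1, r.2, r.1.2.2), r.1.2.1)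

variable (G)

theorem measurePreserving_swapAngles :
    MeasurePreserving swapAngles ((phaseMeasure G E₀ Em).prod sphereMeasure)
      ((phaseMeasure G E₀ Em).prod sphereMeasure) := by
  have hassoc := measurePreserving_prodAssoc ((volume : Measure E3).restrict G)
    (sphereMeasure.prod ((volume : Measure ℝ).restrict (Icc E₀ Em))) sphereMeasure
  have hswap := (MeasurePreserving.id ((volume : Measure E3).restrict G)).prod
    (measurePreserving_swapOuter sphereMeasure ((volume : Measure ℝ).restrict (Icc E₀ Em)))
  exact (hassoc.symm.comp hswap).comp hassoc

/-- The rearrangement `((x, ω, E), ω') ↦ (x, ω', ω, E)`. -/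
def toKernelDom : Phase × S2 ≃ᵐ KernelDom :=
  MeasurableEquiv.prodAssoc.trans
    (MeasurableEquiv.prodCongr (MeasurableEquiv.refl E3) MeasurableEquiv.prodComm)

theorem measurePreserving_toKernelDom :
    MeasurePreserving toKernelDom ((phaseMeasure G E₀ Em).prod sphereMeasure)
      (kernelMeasure G E₀ Em) :=
  ((MeasurePreserving.id ((volume : Measure E3).restrict G)).prod
    (Measure.measurePreserving_swap (ν := sphereMeasure))).comp
      (measurePreserving_prodAssoc ((volume : Measure E3).restrict G)
        (sphereMeasure.prod ((volume : Measure ℝ).restrict (Icc E₀ Em))) sphereMeasure)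

end Measures

/-! ### Density of smooth functions in the Sobolev space of a convex domain -/

section Convolution

variable {X : Type u} [NormedAddCommGroup X] [NormedSpace ℝ X] {Y : Type v} {θ : E3 → ℝ}

/-- The convolution `(x, y) ↦ ∫ θ(x - u) g(u, y) du` in the spatial variable. -/
def xConv (θ : E3 → ℝ) (g : E3 × Y → X) (p : E3 × Y) : X := ∫ u, θ (p.1 - u) • g (u, p.2)

variable [TopologicalSpace Y] {g : E3 × Y → X}

theorem continuous_xConv (hθ : Continuous θ) (hg : Continuous g) (hgc : HasCompactSupport g) :
    Continuous (xConv θ g) := by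
  have h : Continuous fun q : Y × E3 =>
      convolution θ (fun x => g (x, q.1)) (ContinuousLinearMap.lsmul ℝ ℝ) volume q.2 := by
    rw [← continuousOn_univ, ← univ_prod_univ]
    refine continuousOn_convolution_right_with_param (ContinuousLinearMap.lsmul ℝ ℝ)
      (g := fun y x => g (x, y)) (hgc.image continuous_fst) (fun y x _ hx => ?_)
      hθ.locallyIntegrable (hg.comp continuous_swap).continuousOn
    by_contra hgx
    exact hx ⟨(x, y), subset_tsupport g hgx, rfl⟩
  exact (h.comp continuous_swap).congr fun p =>
    convolution_lsmul_swap (f := θ) (g := fun x => g (x, p.2))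

theorem hasFDerivAt_xConv (hθ : ContDiff ℝ 1 θ) (hθc : HasCompactSupport θ) (hg : Continuous g)
    (p : E3 × Y) : HasFDerivAt (fun x => xConv θ g (x, p.2))
      (convolution (fun x => g (x, p.2)) (fderiv ℝ θ)
        ((ContinuousLinearMap.lsmul ℝ ℝ).flip.precompR E3) volume p.1) p.1 :=
  hθc.hasFDerivAt_convolution_right (ContinuousLinearMap.lsmul ℝ ℝ (E := X)).flip
    (hg.comp (.prodMk_left p.2)).locallyIntegrable hθ p.1

theorem xpd_xConv (hθ : ContDiff ℝ 1 θ) (hθc : HasCompactSupport θ) (hg : Continuous g)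
    (i : Fin 3) : xpd i (xConv θ g) = xConv (pd i θ) g := by
  funext p
  rw [xpd, (hasFDerivAt_xConv hθ hθc hg p).fderiv]
  exact convolution_precompR_apply (ContinuousLinearMap.lsmul ℝ ℝ (E := X)).flip
    (hg.comp (.prodMk_left p.2)).locallyIntegrable (hθc.fderiv ℝ)
    (hθ.continuous_fderiv one_ne_zero) p.1 _

theorem contDiff_pd (hθ : ContDiff ℝ (⊤ : ℕ∞) θ) (i : Fin 3) : ContDiff ℝ (⊤ : ℕ∞) (pd i θ) :=
  (hθ.fderiv_right le_rfl).clm_apply contDiff_const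

theorem hasCompactSupport_pd (hθc : HasCompactSupport θ) (i : Fin 3) :
    HasCompactSupport (pd i θ) :=
  hθc.fderiv_apply ℝ _

theorem classCX_xConv (hθ : ContDiff ℝ (⊤ : ℕ∞) θ) (hθc : HasCompactSupport θ)
    (hg : Continuous g) (hgc : HasCompactSupport g) : ClassCX ⊤ (xConv θ g) := by
  refine classCX_top_of_forall_xpd (fun f => ∃ θ : E3 → ℝ, ContDiff ℝ (⊤ : ℕ∞) θ ∧
    HasCompactSupport θ ∧ f = xConv θ g) ?_ ⟨θ, hθ, hθc, rfl⟩
  rintro _ ⟨θ, hθ, hθc, rfl⟩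
  have hθ1 : ContDiff ℝ 1 θ := hθ.of_le (by exact_mod_cast le_top)
  exact ⟨continuous_xConv hθ.continuous hg hgc,
    fun y x => (hasFDerivAt_xConv hθ1 hθc hg (x, y)).differentiableAt,
    fun i => ⟨pd i θ, contDiff_pd hθ i, hasCompactSupport_pd hθc i, xpd_xConv hθ1 hθc hg i⟩⟩

end Convolution

section IteratedPd

variable {Y : Type v} {θ : E3 → ℝ}

/-- The iterated partial derivative `∂_{i₁} ⋯ ∂_{iₖ} θ` for a word `s = {i₁, …, iₖ}`. -/
def iteratedPd (s : Multiset (Fin 3)) (θ : E3 → ℝ) (x : E3) : ℝ :=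
  xPartial (multiIndex s) (fun p : E3 × Unit => θ p.1) (x, ())

theorem iteratedPd_cons (hθ : ContDiff ℝ (⊤ : ℕ∞) θ) (i : Fin 3) (s : Multiset (Fin 3)) :
    iteratedPd (i ::ₘ s) θ = iteratedPd s (pd i θ) :=
  funext fun x => congrFun (xPartial_cons (classCX_of_contDiff hθ) i s) (x, ())

theorem contDiff_iteratedPd (hθ : ContDiff ℝ (⊤ : ℕ∞) θ) (s : Multiset (Fin 3)) :
    ContDiff ℝ (⊤ : ℕ∞) (iteratedPd s θ) :=
  ((classCX_of_contDiff hθ).xPartial (multiIndex s)).1 ()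

theorem tsupport_iteratedPd_subset (hθ : ContDiff ℝ (⊤ : ℕ∞) θ) (s : Multiset (Fin 3)) :
    tsupport (iteratedPd s θ) ⊆ tsupport θ := by
  induction s using Multiset.induction generalizing θ with
  | empty => rfl
  | cons i s ih =>
    rw [iteratedPd_cons hθ]
    exact (ih (contDiff_pd hθ i)).trans (tsupport_fderiv_apply_subset ℝ _)

theorem hasCompactSupport_iteratedPd (hθ : ContDiff ℝ (⊤ : ℕ∞) θ) (hθc : HasCompactSupport θ)
    (s : Multiset (Fin 3)) : HasCompactSupport (iteratedPd s θ) :=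
  hθc.of_isClosed_subset (isClosed_tsupport _) (tsupport_iteratedPd_subset hθ s)

variable [TopologicalSpace Y]

theorem xPartial_xConv (hθ : ContDiff ℝ (⊤ : ℕ∞) θ) (hθc : HasCompactSupport θ) {g : E3 × Y → ℝ}
    (hg : Continuous g) (hgc : HasCompactSupport g) (s : Multiset (Fin 3)) :
    xPartial (multiIndex s) (xConv θ g) = xConv (iteratedPd s θ) g := by
  induction s using Multiset.induction generalizing θ with
  | empty => rfl
  | cons i s ih =>
    rw [xPartial_cons (classCX_xConv hθ hθc hg hgc), iteratedPd_cons hθ,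
      xpd_xConv (hθ.of_le (by exact_mod_cast le_top)) hθc hg,
      ih (contDiff_pd hθ i) (hasCompactSupport_pd hθc i)]

theorem xpd_mul_snd {f : E3 × Y → ℝ} (hf : ClassCX ⊤ f) (g : Y → ℝ) (i : Fin 3) :
    xpd i (fun p => f p * g p.2) = fun p => xpd i f p * g p.2 := by
  funext p
  change fderiv ℝ (fun x => f (x, p.2) * g p.2) p.1 _ = _
  rw [fderiv_mul_const (hf.differentiable p.2 p.1)]
  exact mul_comm _ _

theorem xPartial_mul_snd {f : E3 × Y → ℝ} (hf : ClassCX ⊤ f) {g : Y → ℝ} (hg : Continuous g)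
    (s : Multiset (Fin 3)) : xPartial (multiIndex s) (fun p => f p * g p.2) =
      fun p => xPartial (multiIndex s) f p * g p.2 := by
  induction s using Multiset.induction generalizing f with
  | empty => rfl
  | cons i s ih =>
    rw [xPartial_cons (hf.mul (classCX_of_continuous hg)), xPartial_cons hf, xpd_mul_snd hf,
      ih (hf.xpd i)]

theorem xPartial_comp_smul_add {f : E3 × Y → ℝ} (hf : ClassCX ⊤ f) (c : ℝ) (a : E3)
    (s : Multiset (Fin 3)) : xPartial (multiIndex s) (fun p : E3 × Y => f (c • p.1 + a, p.2)) =
      fun p => c ^ s.card * xPartial (multiIndex s) f (c • p.1 + a, p.2) := by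
  induction s using Multiset.induction generalizing f with
  | empty => simp [xPartial_zero]
  | cons i s ih =>
    have h := xPartial_mul_snd ((hf.xpd i).comp_smul_add c a) (continuous_const (y := c)) s
    have e : c • (fun p : E3 × Y => xpd i f (c • p.1 + a, p.2)) =
        fun p => xpd i f (c • p.1 + a, p.2) * c := funext fun p => mul_comm _ _
    rw [xPartial_cons (hf.comp_smul_add c a), xPartial_cons hf, xpd_comp_smul_add, e, h,
      ih (hf.xpd i), Multiset.card_cons]
    funext p
    ring

end IteratedPd

section Dilation

variable {Y : Type v} {G : Set E3} {θ : E3 → ℝ} {c : ℝ}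

/-- The kernel `θ(c x + a - u)`, in the variables `((x, y), u)`, of a dilation followed by a
convolution with `θ`. -/
def dilationKernel (θ : E3 → ℝ) (c : ℝ) (a : E3) (r : (E3 × Y) × E3) : ℝ :=
  θ (c • r.1.1 + a - r.2)

theorem lintegral_comp_smul_add_le (hθ : Continuous θ) (hc : 1 / 2 ≤ c) (a : E3) :
    ∫⁻ x, ‖θ (c • x + a)‖ₑ ≤ 8 * ∫⁻ x, ‖θ x‖ₑ := by
  have hc0 : c ≠ 0 := by linarith
  have h8 : |(c ^ 3)⁻¹| ≤ 8 := by
    have h3 : (1 / 2) ^ 3 ≤ c ^ 3 := by gcongr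
    rw [abs_of_nonneg (by positivity)]
    exact inv_le_of_inv_le₀ (by norm_num) (by linarith)
  calc ∫⁻ x, ‖θ (c • x + a)‖ₑ
      = ∫⁻ z, ‖θ (z + a)‖ₑ ∂Measure.map (c • ·) (volume : Measure E3) :=
        (lintegral_map (hθ.comp (continuous_add_const a)).measurable.enorm
          (measurable_const_smul c)).symm
    _ = ENNReal.ofReal |(c ^ 3)⁻¹| * ∫⁻ x, ‖θ x‖ₑ := by
        rw [Measure.map_addHaar_smul _ hc0, lintegral_smul_measure,
          lintegral_add_right_eq_self fun z => ‖θ z‖ₑ, finrank_euclideanSpace_fin, smul_eq_mul]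
    _ ≤ 8 * ∫⁻ x, ‖θ x‖ₑ := by
        gcongr
        exact (ENNReal.ofReal_le_ofReal h8).trans_eq (by simp)

variable [MeasurableSpace Y] {ρ : Measure Y} [SFinite ρ]

theorem schurKernel_dilationKernel {N : ℝ≥0} (hθ : Continuous θ) (hN : ∫⁻ x, ‖θ x‖ₑ ≤ N)
    (hc : 1 / 2 ≤ c) (a : E3) : SchurKernel ((volume.restrict G).prod ρ) (volume.restrict G)
      swapOuter (dilationKernel θ c a) N (8 * N) where
  mp := measurePreserving_swapOuter _ _
  invol _ := rfl
  measurable := by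
    have h : Measurable fun r : (E3 × Y) × E3 => c • r.1.1 + a - r.2 := by fun_prop
    exact hθ.measurable.comp h
  bound := ae_of_all _ fun p => (setLIntegral_le_lintegral _ _).trans <|
    (lintegral_sub_left_eq_self (fun z => ‖θ z‖ₑ) (c • p.1 + a)).trans_le hN
  bound' := ae_of_all _ fun p => by
    refine (setLIntegral_le_lintegral _ _).trans ?_
    simp only [dilationKernel, swapOuter, add_sub_assoc]
    refine (lintegral_comp_smul_add_le hθ hc (a - p.1)).trans ?_
    rw [ENNReal.coe_mul]
    exact mul_le_mul' le_rfl hN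

theorem exists_schurKernel_dilationKernel (hθ : Continuous θ) (hθc : HasCompactSupport θ)
    (hc : 1 / 2 ≤ c) (a : E3) : ∃ N, SchurKernel ((volume.restrict G).prod ρ) (volume.restrict G)
      swapOuter (dilationKernel θ c a) N (8 * N) :=
  ⟨(∫⁻ x, ‖θ x‖ₑ).toNNReal, schurKernel_dilationKernel hθ
    (ENNReal.coe_toNNReal (hθ.integrable_of_hasCompactSupport hθc).2.ne).ge hc a⟩

theorem integral_schurFun_dilationKernel_mul (hθ : Continuous θ) (hθc : HasCompactSupport θ)
    (hc : 1 / 2 ≤ c) (a : E3) {f φ : E3 × Y → ℝ} (hf : Measurable f)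
    (hf2 : MemLp f 2 ((volume.restrict G).prod ρ)) (hφ : Measurable φ)
    (hφ2 : MemLp φ 2 ((volume.restrict G).prod ρ)) :
    ∫ p, schurFun (volume.restrict G) swapOuter (dilationKernel θ c a) f p * φ p
        ∂(volume.restrict G).prod ρ =
      ∫ x in G, ∫ q, f q * (θ (c • x + a - q.1) * φ (x, q.2)) ∂(volume.restrict G).prod ρ := by
  obtain ⟨N, hK⟩ := exists_schurKernel_dilationKernel (G := G) (ρ := ρ) hθ hθc hc a
  have hint := hK.integrable_mul hf hf2 hφ hφ2
  have hint' := hint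
  rw [← hK.mp.map_eq] at hint'
  rw [hK.integral_schurFun_mul hf hf2 hφ hφ2, ← hK.mp.map_eq,
    integral_map hK.mp.measurable.aemeasurable hint'.aestronglyMeasurable, integral_prod_symm]
  · simp only [dilationKernel, swapOuter, mul_comm (θ _), mul_assoc]
  · exact (integrable_map_measure hint'.aestronglyMeasurable hK.mp.measurable.aemeasurable).1 hint'

end Dilation

section DilationDeriv

variable {Y : Type v} [TopologicalSpace Y] {G : Set E3} {V : Set Y} {θ : E3 → ℝ} {c : ℝ} {a : E3}

theorem xPartial_sub_mul (hθ : ContDiff ℝ (⊤ : ℕ∞) θ) {g : Y → ℝ} (hg : Continuous g)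
    (s : Multiset (Fin 3)) (b : E3) :
    xPartial (multiIndex s) (fun q : E3 × Y => θ (b - q.1) * g q.2) =
      fun q => (-1) ^ s.card * (iteratedPd s θ (b - q.1) * g q.2) := by
  have hθ' : ClassCX ⊤ fun p : E3 × Y => θ p.1 := classCX_of_contDiff hθ
  have e : (fun q : E3 × Y => θ (b - q.1) * g q.2) =
      fun q => θ ((-1 : ℝ) • q.1 + b) * g q.2 := by
    simp only [neg_one_smul, neg_add_eq_sub]
  rw [e, xPartial_mul_snd (f := fun q => θ ((-1 : ℝ) • q.1 + b)) (hθ'.comp_smul_add (-1) b) hg,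
    xPartial_comp_smul_add hθ']
  simp only [neg_one_smul, neg_add_eq_sub, mul_assoc]
  rfl

theorem isTest_sub_mul (hθ : ContDiff ℝ (⊤ : ℕ∞) θ) (hθc : HasCompactSupport θ) {b : E3}
    (hθG : tsupport (fun u => θ (b - u)) ⊆ G) {φ : E3 × Y → ℝ} (hφ : IsTest G V φ) (x : E3) :
    IsTest G V fun q => θ (b - q.1) * φ (x, q.2) := by
  have hx : IsClosedEmbedding (Prod.mk x : Y → E3 × Y) :=
    ⟨isEmbedding_prodMkRight x, by
      rw [← image_univ, ← singleton_prod]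
      exact isClosed_singleton.prod isClosed_univ⟩
  have hsub : tsupport (fun y => φ (x, y)) ⊆ Prod.mk x ⁻¹' tsupport φ :=
    tsupport_comp_subset_preimage φ hx.continuous
  exact isTest_mul_prod (f := fun u => θ (b - u)) (g := fun y => φ (x, y))
    (hθ.comp (contDiff_const.sub contDiff_id)) (hθc.comp_homeomorph (Homeomorph.subLeft b)) hθG
    (hφ.1.continuous.comp hx.continuous) (hφ.2.1.comp_isClosedEmbedding hx)
    (hsub.trans fun y hy => (hφ.2.2 hy).2)

theorem HasWeakXDeriv.integral_sub_mul [MeasurableSpace Y] {μ : Measure (E3 × Y)}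
    {s : Multiset (Fin 3)} {u v : E3 × Y → ℝ} (h : HasWeakXDeriv G V μ (multiIndex s) u v)
    (hθ : ContDiff ℝ (⊤ : ℕ∞) θ) (hθc : HasCompactSupport θ) {b : E3}
    (hθG : tsupport (fun u => θ (b - u)) ⊆ G) {φ : E3 × Y → ℝ} (hφ : IsTest G V φ) (x : E3) :
    ∫ q, u q * (iteratedPd s θ (b - q.1) * φ (x, q.2)) ∂μ =
      ∫ q, v q * (θ (b - q.1) * φ (x, q.2)) ∂μ := by
  have h' := (h _ (isTest_sub_mul hθ hθc hθG hφ x)).2.2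
  rw [xPartial_sub_mul hθ (g := fun y => φ (x, y)) (hφ.1.continuous.comp (.prodMk_right x)),
    sum_multiIndex] at h'
  simp only [mul_left_comm _ ((-1 : ℝ) ^ _), integral_const_mul] at h'
  exact mul_left_cancel₀ (pow_ne_zero _ (by norm_num)) h'

variable [HasOuterApproxClosed Y] [MeasurableSpace Y] [BorelSpace Y] [SecondCountableTopology Y]
  [RegularSpace Y] [LocallyCompactSpace Y] {ρ : Measure Y} [IsFiniteMeasure ρ]

theorem HasWeakXDeriv.schurFun_dilationKernel_iteratedPd (hG : IsOpen G)
    (hG' : Bornology.IsBounded G) (hV : IsOpen V)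
    (hρ : ∀ᵐ p ∂(volume.restrict G).prod ρ, p ∈ G ×ˢ V) (hθ : ContDiff ℝ (⊤ : ℕ∞) θ)
    (hθc : HasCompactSupport θ) (hc : 1 / 2 ≤ c)
    (hθG : ∀ x ∈ G, tsupport (fun u => θ (c • x + a - u)) ⊆ G) {s : Multiset (Fin 3)}
    {u v : Lp ℝ 2 ((volume.restrict G).prod ρ)}
    (h : HasWeakXDeriv G V ((volume.restrict G).prod ρ) (multiIndex s) u v) :
    schurFun (volume.restrict G) swapOuter (dilationKernel (iteratedPd s θ) c a) u
      =ᵐ[(volume.restrict G).prod ρ]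
      schurFun (volume.restrict G) swapOuter (dilationKernel θ c a) v := by
  have := isFiniteMeasure_restrict_of_isBounded hG'
  have hθ' := contDiff_iteratedPd hθ s
  have hθc' := hasCompactSupport_iteratedPd hθ hθc s
  obtain ⟨N, hK⟩ := exists_schurKernel_dilationKernel (G := G) (ρ := ρ) hθ.continuous hθc hc a
  obtain ⟨N', hK'⟩ :=
    exists_schurKernel_dilationKernel (G := G) (ρ := ρ) hθ'.continuous hθc' hc a
  have hu := (Lp.stronglyMeasurable u).measurable
  have hv := (Lp.stronglyMeasurable v).measurable
  have hφ2 {φ} (hφ : IsTest G V φ) : Measurable φ ∧ MemLp φ 2 ((volume.restrict G).prod ρ) :=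
    ⟨hφ.1.continuous.measurable, hφ.1.continuous.memLp_of_hasCompactSupport hφ.2.1⟩
  have hi {φ} (hφ : IsTest G V φ) := (hK'.memLp hu (Lp.memLp u)).integrable_mul (hφ2 hφ).2
  have hi' {φ} (hφ : IsTest G V φ) := (hK.memLp hv (Lp.memLp v)).integrable_mul (hφ2 hφ).2
  rw [← sub_ae_eq_zero]
  refine ae_eq_zero_of_forall_isTest hG hV hρ (fun φ hφ => ?_) fun φ hφ => ?_
  · simp only [Pi.sub_apply, sub_mul]
    exact (hi hφ).sub (hi' hφ)
  · simp only [Pi.sub_apply, sub_mul]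
    refine (integral_sub (hi hφ) (hi' hφ)).trans (sub_eq_zero.2 ?_)
    refine (integral_schurFun_dilationKernel_mul hθ'.continuous hθc' hc a hu (Lp.memLp u)
      (hφ2 hφ).1 (hφ2 hφ).2).trans (Eq.trans ?_ (integral_schurFun_dilationKernel_mul
        hθ.continuous hθc hc a hv (Lp.memLp v) (hφ2 hφ).1 (hφ2 hφ).2).symm)
    exact setIntegral_congr_fun hG.measurableSet fun x hx =>
      h.integral_sub_mul hθ hθc (hθG x hx) hφ x

end DilationDeriv

section DilationMollifier

/-- The dilations `x ↦ cₙ x + aₙ` converge to the identity and move `G` so far into itself that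
`G` contains the supports, centred at the points `cₙ x + aₙ` with `x ∈ G`, of the shrinking bump
functions `φₙ`. -/
structure IsDilationMollifier (G : Set E3) (c : ℕ → ℝ) (a : ℕ → E3)
    (φ : ℕ → ContDiffBump (0 : E3)) : Prop where
  half_le : ∀ n, 1 / 2 ≤ c n
  tendsto_scale : Tendsto c atTop (𝓝 1)
  tendsto_shift : Tendsto a atTop (𝓝 0)
  tendsto_rOut : Tendsto (fun n => (φ n).rOut) atTop (𝓝 0)
  closedBall_subset : ∀ n, ∀ x ∈ G, Metric.closedBall (c n • x + a n) (φ n).rOut ⊆ G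

variable {G : Set E3}

theorem exists_isDilationMollifier (hG : IsOpen G) (hconv : Convex ℝ G) :
    ∃ c a φ, IsDilationMollifier G c a φ := by
  obtain ⟨x₀, r, hr, hrG⟩ : ∃ x₀ : E3, ∃ r > 0, ∀ x ∈ G, Metric.closedBall x₀ r ⊆ G := by
    rcases G.eq_empty_or_nonempty with rfl | ⟨x₀, hx₀⟩
    · exact ⟨0, 1, one_pos, by simp⟩
    · obtain ⟨r, hr, h⟩ := Metric.nhds_basis_closedBall.mem_iff.1 (hG.mem_nhds hx₀)
      exact ⟨x₀, r, hr, fun _ _ => h⟩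
  let ε : ℕ → ℝ := fun n => (1 / 2) ^ (n + 1)
  have hε n : 0 < ε n := by positivity
  have hε' n : ε n ≤ 1 / 2 := pow_le_of_le_one (by norm_num) (by norm_num) (by simp)
  have hε0 : Tendsto ε atTop (𝓝 0) := (tendsto_add_atTop_iff_nat 1).2
    (tendsto_pow_atTop_nhds_zero_of_lt_one (by norm_num) (by norm_num))
  refine ⟨fun n => 1 - ε n, fun n => ε n • x₀, fun n => ⟨ε n * r / 2, ε n * r, ?_, ?_⟩, ?_⟩
  · exact half_pos (mul_pos (hε n) hr)
  · exact half_lt_self (mul_pos (hε n) hr)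
  refine ⟨fun n => by linarith [hε' n], by simpa using hε0.const_sub 1,
    by simpa using hε0.smul_const x₀, by simpa using hε0.mul_const r, fun n x hx z hz => ?_⟩
  have hw : x₀ + (ε n)⁻¹ • (z - ((1 - ε n) • x + ε n • x₀)) ∈ G := by
    refine hrG x hx ?_
    rw [mem_closedBall_iff_norm, add_sub_cancel_left, norm_smul, norm_inv,
      Real.norm_of_nonneg (hε n).le, inv_mul_le_iff₀ (hε n)]
    exact mem_closedBall_iff_norm.1 hz
  have := hconv hx hw (by linarith [hε' n]) (hε n).le (sub_add_cancel 1 (ε n))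
  rwa [smul_add, smul_inv_smul₀ (hε n).ne', ← add_assoc, add_sub_cancel] at this

variable {c : ℕ → ℝ} {a : ℕ → E3} {φ : ℕ → ContDiffBump (0 : E3)}

theorem IsDilationMollifier.mem_of_sub_mem_tsupport (h : IsDilationMollifier G c a φ) (n : ℕ)
    {x u : E3} (hx : x ∈ G) (hu : c n • x + a n - u ∈ tsupport ((φ n).normed volume)) : u ∈ G := by
  rw [ContDiffBump.tsupport_normed_eq, mem_closedBall_zero_iff] at hu
  exact h.closedBall_subset n x hx (by rwa [Metric.mem_closedBall, dist_eq_norm'])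

theorem IsDilationMollifier.tsupport_subset (h : IsDilationMollifier G c a φ) (n : ℕ) {x : E3}
    (hx : x ∈ G) : tsupport (fun u => (φ n).normed volume (c n • x + a n - u)) ⊆ G :=
  (tsupport_comp_subset_preimage ((φ n).normed volume) (f := fun u : E3 => c n • x + a n - u)
    (continuous_const.sub continuous_id)).trans fun _ hu => h.mem_of_sub_mem_tsupport n hx hu

theorem IsDilationMollifier.eventually_dist_lt (h : IsDilationMollifier G c a φ)
    (hG : Bornology.IsBounded G) {δ : ℝ} (hδ : 0 < δ) :
    ∀ᶠ n in atTop, (φ n).rOut < δ ∧ ∀ x ∈ G, dist (c n • x + a n) x < δ := by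
  obtain ⟨R, hR⟩ := hG.exists_norm_le
  have hlim : Tendsto (fun n => |c n - 1| * R + ‖a n‖) atTop (𝓝 0) := by
    simpa using ((h.tendsto_scale.sub_const 1).abs.mul_const R).add h.tendsto_shift.norm
  filter_upwards [h.tendsto_rOut.eventually_lt_const hδ, hlim.eventually_lt_const hδ] with n h1 h2
  refine ⟨h1, fun x hx => lt_of_le_of_lt ?_ h2⟩
  have e : c n • x + a n - x = (c n - 1) • x + a n := by rw [sub_smul, one_smul]; abel
  rw [dist_eq_norm, e]
  refine (norm_add_le _ _).trans ?_
  rw [norm_smul, Real.norm_eq_abs]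
  gcongr
  exact hR x hx

variable {Y : Type v}

theorem dist_xConv_normed_le [TopologicalSpace Y] (φ : ContDiffBump (0 : E3)) {w : E3 × Y → ℝ}
    (hw : Continuous w) {x : E3} {y : Y} {ε : ℝ}
    (hwε : ∀ z ∈ Metric.ball x φ.rOut, dist (w (z, y)) (w (x, y)) ≤ ε) :
    dist (xConv (φ.normed volume) w (x, y)) (w (x, y)) ≤ ε := by
  have := φ.dist_normed_convolution_le (μ := volume) (g := fun x => w (x, y)) (by fun_prop) hwε
  rwa [convolution_lsmul_swap] at this

theorem IsDilationMollifier.eventually_dist_xConv_le [PseudoMetricSpace Y]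
    (h : IsDilationMollifier G c a φ) (hG : Bornology.IsBounded G) {w : E3 × Y → ℝ}
    (hw : Continuous w) (hwc : HasCompactSupport w) {ε : ℝ} (hε : 0 < ε) :
    ∀ᶠ n in atTop, ∀ x ∈ G, ∀ y,
      dist (xConv ((φ n).normed volume) w (c n • x + a n, y)) (w (x, y)) ≤ ε := by
  obtain ⟨δ, hδ, hwδ⟩ := Metric.uniformContinuous_iff.1
    (hwc.uniformContinuous_of_continuous hw) (ε / 2) (half_pos hε)
  have hwδ' (x x' : E3) (y : Y) (hx : dist x x' < δ) : dist (w (x, y)) (w (x', y)) ≤ ε / 2 := by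
    refine (hwδ ?_).le
    rw [Prod.dist_eq, dist_self]
    exact max_lt hx hδ
  filter_upwards [h.eventually_dist_lt hG hδ] with n hn x hx y
  have hconv := dist_xConv_normed_le (φ n) hw (x := c n • x + a n) (y := y) fun z hz =>
    hwδ' z (c n • x + a n) y (lt_trans hz hn.1)
  calc dist (xConv ((φ n).normed volume) w (c n • x + a n, y)) (w (x, y))
      ≤ _ := dist_triangle _ _ _
    _ ≤ ε / 2 + ε / 2 := add_le_add hconv (hwδ' _ x y (hn.2 x hx))
    _ = ε := add_halves ε

theorem schurFun_dilationKernel_eq_xConv {θ : E3 → ℝ} {c : ℝ} {a x : E3}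
    (hθG : ∀ u ∉ G, θ (c • x + a - u) = 0) (w : E3 × Y → ℝ) (y : Y) :
    schurFun (volume.restrict G) swapOuter (dilationKernel θ c a) w (x, y) =
      xConv θ w (c • x + a, y) := by
  refine setIntegral_eq_integral_of_forall_compl_eq_zero fun u hu => ?_
  rw [dilationKernel, hθG u hu, zero_mul]

variable [MeasurableSpace Y]

theorem schurKernel_dilationKernel_normed (ρ : Measure Y) [SFinite ρ] {c : ℝ} (hc : 1 / 2 ≤ c)
    (a : E3) (φ : ContDiffBump (0 : E3)) :
    SchurKernel ((volume.restrict G).prod ρ) (volume.restrict G) swapOuter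
      (dilationKernel (φ.normed volume) c a) 1 8 := by
  have h : ∫⁻ x, ‖φ.normed volume x‖ₑ = 1 := by
    rw [← ofReal_integral_norm_eq_lintegral_enorm φ.integrable_normed]
    simp [Real.norm_of_nonneg (φ.nonneg_normed _), φ.integral_normed]
  simpa using schurKernel_dilationKernel (N := 1) φ.continuous_normed (by simp [h]) hc a

/-- The bounded operator `u ↦ (φₙ ∗ u)(cₙ x + aₙ, y)` on `L²(G × Y)`. -/
def IsDilationMollifier.toCLM (h : IsDilationMollifier G c a φ) (ρ : Measure Y) [SFinite ρ]
    (n : ℕ) : Lp ℝ 2 ((volume.restrict G).prod ρ) →L[ℝ] Lp ℝ 2 ((volume.restrict G).prod ρ) :=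
  (schurKernel_dilationKernel_normed ρ (h.half_le n) (a n) (φ n)).toCLM

theorem IsDilationMollifier.coeFn_toCLM (h : IsDilationMollifier G c a φ) {ρ : Measure Y}
    [SFinite ρ] (n : ℕ) (u : Lp ℝ 2 ((volume.restrict G).prod ρ)) :
    h.toCLM ρ n u =ᵐ[(volume.restrict G).prod ρ] schurFun (volume.restrict G) swapOuter
      (dilationKernel ((φ n).normed volume) (c n) (a n)) u :=
  SchurKernel.coeFn_toCLM _ u

theorem dense_setOf_hasCompactSupport_continuous {X : Type*} [TopologicalSpace X] [NormalSpace X]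
    [R1Space X] [WeaklyLocallyCompactSpace X] [MeasurableSpace X] [BorelSpace X] (μ : Measure X)
    [μ.Regular] :
    Dense {f : Lp ℝ 2 μ | ∃ w : X → ℝ, f =ᵐ[μ] w ∧ HasCompactSupport w ∧ Continuous w} := by
  intro f
  refine (mem_closure_iff_nhds_basis Metric.nhds_basis_closedBall).2 fun ε hε => ?_
  obtain ⟨w, hwc, hfw, hw, hw2⟩ := (Lp.memLp f).exists_hasCompactSupport_eLpNorm_sub_le
    ENNReal.ofNat_ne_top (ENNReal.ofReal_pos.2 hε).ne'
  refine ⟨hw2.toLp, ⟨w, hw2.coeFn_toLp, hwc, hw⟩, ?_⟩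
  rw [Metric.mem_closedBall, dist_comm, Lp.dist_def]
  refine ENNReal.toReal_le_of_le_ofReal hε.le (hfw.trans_eq' (eLpNorm_congr_ae ?_))
  exact (EventuallyEq.refl _ _).sub hw2.coeFn_toLp.symm

theorem tendsto_apply_of_dense {V : Type*} [NormedAddCommGroup V] [NormedSpace ℝ V]
    {T : ℕ → V →L[ℝ] V} {C : ℝ} (hT : ∀ n, ‖T n‖ ≤ C) {D : Set V} (hD : Dense D)
    (hTD : ∀ x ∈ D, Tendsto (fun n => T n x) atTop (𝓝 x)) (x : V) :
    Tendsto (fun n => T n x) atTop (𝓝 x) := by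
  have heq : Equicontinuous ((↑) ∘ T) :=
    ((NormedSpace.equicontinuous_TFAE T).out 5 1 rfl rfl).1 ⟨C, hT⟩
  exact closure_minimal hTD (heq.isClosed_setOfPred_tendsto continuous_id) (hD x)

theorem IsDilationMollifier.tendsto_toCLM [PseudoMetricSpace Y] [BorelSpace Y]
    [SecondCountableTopology Y] [WeaklyLocallyCompactSpace Y] (h : IsDilationMollifier G c a φ)
    (hG : IsOpen G) (hG' : Bornology.IsBounded G) {ρ : Measure Y} [IsFiniteMeasure ρ]
    [((volume.restrict G).prod ρ).Regular]
    (u : Lp ℝ 2 ((volume.restrict G).prod ρ)) :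
    Tendsto (fun n => h.toCLM ρ n u) atTop (𝓝 u) := by
  have := isFiniteMeasure_restrict_of_isBounded hG'
  refine tendsto_apply_of_dense (fun n => SchurKernel.norm_toCLM_le _)
    (dense_setOf_hasCompactSupport_continuous _) ?_ u
  rintro f ⟨w, hfw, hwc, hw⟩
  refine Metric.tendsto_nhds.2 fun ε hε => ?_
  let M : ℝ := measureUnivNNReal ((volume.restrict G).prod ρ) ^ (2 : ℝ≥0∞).toReal⁻¹
  have hM : 0 < M + 1 := add_pos_of_nonneg_of_pos (by positivity) one_pos
  filter_upwards [h.eventually_dist_xConv_le hG' hw hwc (div_pos hε hM)] with n hn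
  have hbound : ∀ᵐ p ∂(volume.restrict G).prod ρ, ‖(h.toCLM ρ n f - f) p‖ ≤ ε / (M + 1) := by
    filter_upwards [Lp.coeFn_sub (h.toCLM ρ n f) f, h.coeFn_toCLM n f,
      schurFun_congr (κ := dilationKernel ((φ n).normed volume) (c n) (a n))
        (measurePreserving_swapOuter _ _) hfw, hfw,
      Measure.quasiMeasurePreserving_fst.ae (ae_restrict_mem hG.measurableSet)]
      with p h1 h2 h3 h4 hp
    rw [h1, Pi.sub_apply, h2, h3, h4, ← dist_eq_norm, schurFun_dilationKernel_eq_xConv]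
    · exact hn p.1 hp p.2
    · intro u hu
      exact image_eq_zero_of_notMem_tsupport fun h' => hu (h.mem_of_sub_mem_tsupport n hp h')
  calc dist (h.toCLM ρ n f) f = ‖h.toCLM ρ n f - f‖ := dist_eq_norm _ _
    _ ≤ M * (ε / (M + 1)) := Lp.norm_le_of_ae_bound (div_pos hε hM).le hbound
    _ < ε := by
      rw [mul_div_left_comm]
      exact mul_lt_of_lt_one_right hε ((div_lt_one hM).2 (lt_add_one M))

end DilationMollifier

section SmoothJets

/-- The function `(x, ω, E) ↦ Ψ(x, E)(ω)`. -/
def evalAngle (Ψ : E3 × ℝ → C(S2, ℝ)) (p : Phase) : ℝ := Ψ (p.1, p.2.2) p.2.1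

/-- The jets of the functions which are smooth in `x`, jointly continuous with all their spatial
derivatives, seen as smooth functions of `(x, E)` with values in `C(S)`. -/
def smoothJets (m : ℕ) (G : Set E3) (E₀ Em : ℝ) :
    Set (PiLp 2 fun _ : MultiIdx m => L2Phase G E₀ Em) :=
  {u | ∃ Ψ : E3 × ℝ → C(S2, ℝ), ClassCX ⊤ Ψ ∧
    ∀ α : MultiIdx m, u α =ᵐ[phaseMeasure G E₀ Em] xPartial α.toFun (evalAngle Ψ)}

theorem exists_evalAngle_eq_xConv {θ : E3 → ℝ} (hθ : ContDiff ℝ (⊤ : ℕ∞) θ)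
    (hθc : HasCompactSupport θ) {w : Phase → ℝ} (hw : Continuous w) (hwc : HasCompactSupport w) :
    ∃ Ψ : E3 × ℝ → C(S2, ℝ), ClassCX ⊤ Ψ ∧ evalAngle Ψ = xConv θ w := by
  let W : E3 × ℝ → C(S2, ℝ) := ContinuousMap.curry
    ⟨fun q : (E3 × ℝ) × S2 => w (q.1.1, q.2, q.1.2), by fun_prop⟩
  have hW : Continuous W := ContinuousMap.continuous _
  have hWc : HasCompactSupport W := by
    refine .intro (hwc.image (f := fun p : Phase => (p.1, p.2.2)) (by fun_prop)) fun q hq => ?_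
    ext ω
    exact image_eq_zero_of_notMem_tsupport (f := w) (x := (q.1, ω, q.2)) fun h => hq ⟨_, h, rfl⟩
  refine ⟨xConv θ W, classCX_xConv hθ hθc hW hWc, funext fun p => ?_⟩
  have hint : Integrable fun u => θ (p.1 - u) • W (u, p.2.2) := by
    have hθ' : HasCompactSupport fun u => θ (p.1 - u) :=
      hθc.comp_homeomorph (Homeomorph.subLeft p.1)
    have hsmul : HasCompactSupport fun u => θ (p.1 - u) • W (u, p.2.2) := hθ'.smul_right
    exact Continuous.integrable_of_hasCompactSupport
      ((hθ.continuous.comp (by fun_prop)).smul (hW.comp (by fun_prop))) hsmul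
  exact ContinuousLinearMap.integral_comp_comm (ContinuousMap.evalCLM ℝ p.2.1) hint |>.symm

theorem exists_clm_dilationJet {θ : E3 → ℝ} (hθ : ContDiff ℝ (⊤ : ℕ∞) θ)
    (hθc : HasCompactSupport θ) {c : ℝ} (hc : 1 / 2 ≤ c) (a : E3) (m : ℕ) (G : Set E3)
    (E₀ Em : ℝ) : ∃ F : L2Phase G E₀ Em →L[ℝ] PiLp 2 fun _ : MultiIdx m => L2Phase G E₀ Em,
      ∀ u α, F u α =ᵐ[phaseMeasure G E₀ Em] fun p => c ^ (letters α.toFun).card *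
        schurFun (volume.restrict G) swapOuter
          (dilationKernel (iteratedPd (letters α.toFun) θ) c a) u p := by
  have hK (α : MultiIdx m) : ∃ N, SchurKernel (phaseMeasure G E₀ Em) (volume.restrict G) swapOuter
      (dilationKernel (iteratedPd (letters α.toFun) θ) c a) N (8 * N) :=
    exists_schurKernel_dilationKernel (contDiff_iteratedPd hθ _).continuous
      (hasCompactSupport_iteratedPd hθ hθc _) hc a
  choose N hN using hK
  refine ⟨(PiLp.continuousLinearEquiv 2 ℝ fun _ : MultiIdx m => L2Phase G E₀ Em).symm ∘L
    ContinuousLinearMap.pi fun α => c ^ (letters α.toFun).card • (hN α).toCLM, fun u α => ?_⟩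
  filter_upwards [Lp.coeFn_smul (c ^ (letters α.toFun).card) ((hN α).toCLM u),
    (hN α).coeFn_toCLM u] with p h1 h2
  simpa [h2] using h1

theorem mem_smoothJets_of_ae_eq_schurFun {m : ℕ} {G : Set E3} {E₀ Em : ℝ} (hG : IsOpen G)
    {θ : E3 → ℝ} (hθ : ContDiff ℝ (⊤ : ℕ∞) θ) (hθc : HasCompactSupport θ) {c : ℝ} {a : E3}
    (hθG : ∀ x ∈ G, ∀ u, c • x + a - u ∈ tsupport θ → u ∈ G) {u : L2Phase G E₀ Em} {w : Phase → ℝ}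
    (huw : u =ᵐ[phaseMeasure G E₀ Em] w) (hw : Continuous w) (hwc : HasCompactSupport w)
    {v : PiLp 2 fun _ : MultiIdx m => L2Phase G E₀ Em}
    (hv : ∀ α, v α =ᵐ[phaseMeasure G E₀ Em] fun p => c ^ (letters α.toFun).card *
      schurFun (volume.restrict G) swapOuter
        (dilationKernel (iteratedPd (letters α.toFun) θ) c a) u p) :
    v ∈ smoothJets m G E₀ Em := by
  obtain ⟨Ψ, hΨ, hΨw⟩ := exists_evalAngle_eq_xConv hθ hθc hw hwc
  refine ⟨fun q => Ψ (c • q.1 + a, q.2), hΨ.comp_smul_add c a, fun α => ?_⟩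
  have hpartial : xPartial α.toFun (evalAngle fun q => Ψ (c • q.1 + a, q.2)) = fun p =>
      c ^ (letters α.toFun).card * xConv (iteratedPd (letters α.toFun) θ) w (c • p.1 + a, p.2) := by
    have heval : evalAngle (fun q => Ψ (c • q.1 + a, q.2)) =
        fun p => xConv θ w (c • p.1 + a, p.2) :=
      funext fun p => congrFun hΨw (c • p.1 + a, p.2)
    rw [heval, ← multiIndex_letters α.toFun,
      xPartial_comp_smul_add (classCX_xConv hθ hθc hw hwc), xPartial_xConv hθ hθc hw hwc,
      multiIndex_letters]
  rw [hpartial]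
  filter_upwards [hv α, schurFun_congr (κ := dilationKernel (iteratedPd (letters α.toFun) θ) c a)
      (measurePreserving_swapOuter _ _) huw, ae_mem_phaseDomain E₀ Em hG] with p h1 h2 hp
  rw [h1, h2, schurFun_dilationKernel_eq_xConv fun u hu => ?_]
  exact image_eq_zero_of_notMem_tsupport fun h =>
    hu (hθG p.1 hp.1 u (tsupport_iteratedPd_subset hθ _ h))

theorem IsDilationMollifier.tendsto_jet {m : ℕ} {G : Set E3} {E₀ Em : ℝ} {c : ℕ → ℝ} {a : ℕ → E3}
    {φ : ℕ → ContDiffBump (0 : E3)} (h : IsDilationMollifier G c a φ) (hG : IsOpen G)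
    (hG' : Bornology.IsBounded G) {u : PiLp 2 fun _ : MultiIdx m => L2Phase G E₀ Em}
    (hu : u ∈ sobolevH m G E₀ Em) {v : ℕ → PiLp 2 fun _ : MultiIdx m => L2Phase G E₀ Em}
    (hv : ∀ n α, v n α =ᵐ[phaseMeasure G E₀ Em] fun p => c n ^ (letters α.toFun).card *
      schurFun (volume.restrict G) swapOuter
        (dilationKernel (iteratedPd (letters α.toFun) ((φ n).normed volume)) (c n) (a n))
        (u (MultiIdx.zero m)) p) :
    Tendsto v atTop (𝓝 u) := by
  have := isFiniteMeasure_phaseMeasure E₀ Em hG'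
  let T (n : ℕ) : L2Phase G E₀ Em →L[ℝ] L2Phase G E₀ Em :=
    h.toCLM (sphereMeasure.prod (volume.restrict (Icc E₀ Em))) n
  have hT n (α : MultiIdx m) : T n (u α) =ᵐ[phaseMeasure G E₀ Em] schurFun (volume.restrict G)
      swapOuter (dilationKernel (iteratedPd (letters α.toFun) ((φ n).normed volume)) (c n) (a n))
      (u (MultiIdx.zero m)) := by
    refine (h.coeFn_toCLM n (u α)).trans (HasWeakXDeriv.schurFun_dilationKernel_iteratedPd hG hG'
      (isOpen_univ.prod isOpen_Ioo) (ae_mem_phaseDomain E₀ Em hG) (φ n).contDiff_normed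
      (φ n).hasCompactSupport_normed (h.half_le n) (fun x hx => h.tsupport_subset n hx) ?_).symm
    rw [multiIndex_letters]
    exact hu α
  have heq n α : v n α = c n ^ (letters α.toFun).card • T n (u α) := by
    refine Lp.ext ?_
    filter_upwards [hv n α, hT n α, Lp.coeFn_smul
      (c n ^ (letters α.toFun).card) (T n (u α))] with p h1 h2 h3
    rw [h1, h3, Pi.smul_apply, h2, smul_eq_mul]
  refine (PiLp.homeomorph 2 _).isInducing.tendsto_nhds_iff.2 (tendsto_pi_nhds.2 fun α => ?_)
  have hTα : Tendsto (fun n => T n (u α)) atTop (𝓝 (u α)) := by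
    have : ((volume.restrict G).prod
      (sphereMeasure.prod (volume.restrict (Icc E₀ Em)))).Regular :=
        inferInstanceAs (phaseMeasure G E₀ Em).Regular
    exact h.tendsto_toCLM hG hG' (u α)
  have := (h.tendsto_scale.pow (letters α.toFun).card).smul hTα
  rw [one_pow, one_smul] at this
  exact this.congr fun n => (heq n α).symm

theorem sobolevH_subset_closure_smoothJets (m : ℕ) {G : Set E3} {E₀ Em : ℝ} (hG : IsOpen G)
    (hG' : Bornology.IsBounded G) (hconv : Convex ℝ G) :
    (sobolevH m G E₀ Em : Set (PiLp 2 fun _ : MultiIdx m => L2Phase G E₀ Em)) ⊆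
      closure (smoothJets m G E₀ Em) := by
  intro u hu
  obtain ⟨c, a, φ, h⟩ := exists_isDilationMollifier hG hconv
  have := isFiniteMeasure_phaseMeasure E₀ Em hG'
  have hφ n : ContDiff ℝ (⊤ : ℕ∞) ((φ n).normed volume) := (φ n).contDiff_normed
  have hφc n : HasCompactSupport ((φ n).normed volume) := (φ n).hasCompactSupport_normed
  choose F hF using fun n => exists_clm_dilationJet (hφ n) (hφc n) (h.half_le n) (a n) m G E₀ Em
  have hmem n : F n (u (MultiIdx.zero m)) ∈ closure (smoothJets m G E₀ Em) :=
    map_mem_closure (F n).continuous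
      (dense_setOf_hasCompactSupport_continuous (phaseMeasure G E₀ Em) _)
      fun f ⟨w, hfw, hwc, hw⟩ => mem_smoothJets_of_ae_eq_schurFun hG (hφ n) (hφc n)
        (fun x hx _ => h.mem_of_sub_mem_tsupport n hx) hfw hw hwc (hF n f)
  exact isClosed_closure.mem_of_tendsto
    (h.tendsto_jet hG hG' hu fun n => hF n (u (MultiIdx.zero m))) (Eventually.of_forall hmem)

end SmoothJets

/-! ### The mixed norms of a kernel -/

section MixedNorm

variable {A B : Type*} [MeasurableSpace A] [MeasurableSpace B] {μ : Measure A} {ν : Measure B}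

theorem essSup_lintegral_enorm_congr {f g : A → B → ℝ} (h : ∀ᵐ a ∂μ, ∀ᵐ b ∂ν, f a b = g a b) :
    essSup (fun a => ∫⁻ b, ‖f a b‖ₑ ∂ν) μ = essSup (fun a => ∫⁻ b, ‖g a b‖ₑ ∂ν) μ :=
  essSup_congr_ae (h.mono fun _ ha => lintegral_congr_ae (ha.mono fun _ hb => congrArg _ hb))

theorem essSup_lintegral_enorm_add_le {f g : A → B → ℝ} (hf : ∀ a, Measurable (f a)) :
    essSup (fun a => ∫⁻ b, ‖f a b + g a b‖ₑ ∂ν) μ ≤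
      essSup (fun a => ∫⁻ b, ‖f a b‖ₑ ∂ν) μ + essSup (fun a => ∫⁻ b, ‖g a b‖ₑ ∂ν) μ := by
  refine essSup_le_of_ae_le _ ?_
  filter_upwards [ae_le_essSup (μ := μ) (f := fun a => ∫⁻ b, ‖f a b‖ₑ ∂ν),
    ae_le_essSup (μ := μ) (f := fun a => ∫⁻ b, ‖g a b‖ₑ ∂ν)] with a hfa hga
  calc ∫⁻ b, ‖f a b + g a b‖ₑ ∂ν
      ≤ ∫⁻ b, ‖f a b‖ₑ + ‖g a b‖ₑ ∂ν := lintegral_mono fun b => enorm_add_le _ _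
    _ = ∫⁻ b, ‖f a b‖ₑ ∂ν + ∫⁻ b, ‖g a b‖ₑ ∂ν := lintegral_add_left (hf a).enorm _
    _ ≤ _ := add_le_add hfa hga

variable {G : Set E3} {E₀ Em : ℝ} {D D' : KernelDom → ℝ}

theorem ae_ae_of_ae_kernelMeasure {Q : KernelDom → Prop} (h : ∀ᵐ q ∂kernelMeasure G E₀ Em, Q q) :
    ∀ᵐ p ∂phaseMeasure G E₀ Em, ∀ᵐ ω' ∂sphereMeasure, Q (p.1, ω', p.2.1, p.2.2) :=
  Measure.ae_ae_of_ae_prod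
    ((measurePreserving_toKernelDom G E₀ Em).quasiMeasurePreserving.ae h)

theorem ae_ae_of_ae_kernelMeasure' {Q : KernelDom → Prop}
    (h : ∀ᵐ q ∂kernelMeasure G E₀ Em, Q q) :
    ∀ᵐ p ∂phaseMeasure G E₀ Em, ∀ᵐ ω ∂sphereMeasure, Q (p.1, p.2.1, ω, p.2.2) :=
  Measure.ae_ae_of_ae_prod ((measurePreserving_swapAngles G E₀ Em).quasiMeasurePreserving.ae
    ((measurePreserving_toKernelDom G E₀ Em).quasiMeasurePreserving.ae h))

theorem mixedNorm_congr (h : D =ᵐ[kernelMeasure G E₀ Em] D') :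
    mixedNorm G E₀ Em D = mixedNorm G E₀ Em D' :=
  essSup_lintegral_enorm_congr (ae_ae_of_ae_kernelMeasure h)

theorem mixedNorm'_congr (h : D =ᵐ[kernelMeasure G E₀ Em] D') :
    mixedNorm' G E₀ Em D = mixedNorm' G E₀ Em D' :=
  essSup_lintegral_enorm_congr (ae_ae_of_ae_kernelMeasure' h)

theorem mixedNorm_add_le (hD : Measurable D) :
    mixedNorm G E₀ Em (D + D') ≤ mixedNorm G E₀ Em D + mixedNorm G E₀ Em D' :=
  essSup_lintegral_enorm_add_le fun p : Phase => hD.comp (by fun_prop)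

theorem mixedNorm'_add_le (hD : Measurable D) :
    mixedNorm' G E₀ Em (D + D') ≤ mixedNorm' G E₀ Em D + mixedNorm' G E₀ Em D' :=
  essSup_lintegral_enorm_add_le fun p : Phase => hD.comp (by fun_prop)

theorem schurKernel_of_mixedNorm_le (hD : Measurable D) {N₁ N₂ : ℝ≥0}
    (h₁ : mixedNorm G E₀ Em D ≤ N₁) (h₂ : mixedNorm' G E₀ Em D ≤ N₂) :
    SchurKernel (phaseMeasure G E₀ Em) sphereMeasure swapAngles (fun r => D (toKernelDom r))
      N₁ N₂ where
  mp := measurePreserving_swapAngles G E₀ Em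
  invol _ := rfl
  measurable := hD.comp toKernelDom.measurable
  bound := (ae_le_essSup (μ := phaseMeasure G E₀ Em)).mono fun _ hp => le_trans hp h₁
  bound' := (ae_le_essSup (μ := phaseMeasure G E₀ Em)).mono fun _ hp => le_trans hp h₂

end MixedNorm

section WeakDerivs

variable {m : ℕ} {G : Set E3} {E₀ Em : ℝ} {σ τ : KernelDom → ℝ}
  {D D' : MultiIdx m → KernelDom → ℝ}

theorem weakDerivs_ae_unique (hG : IsOpen G) (hD : D ∈ weakDerivs m G E₀ Em σ)
    (hD' : D' ∈ weakDerivs m G E₀ Em σ) (α : MultiIdx m) :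
    D α =ᵐ[kernelMeasure G E₀ Em] D' α :=
  (hD α).2.ae_unique hG (isOpen_univ.prod (isOpen_univ.prod isOpen_Ioo))
    (ae_mem_kernelDomain E₀ Em hG) (hD' α).2

theorem weakDerivs_zero_ae_eq (hG : IsOpen G) (hD : D ∈ weakDerivs m G E₀ Em σ) :
    D (MultiIdx.zero m) =ᵐ[kernelMeasure G E₀ Em] σ := by
  refine (hD _).2.ae_unique hG (isOpen_univ.prod (isOpen_univ.prod isOpen_Ioo))
    (ae_mem_kernelDomain E₀ Em hG) fun φ hφ => ?_
  have hint := ((hD (MultiIdx.zero m)).2 φ hφ).1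
  exact ⟨hint, hint, by simp [MultiIdx.toFun, MultiIdx.zero, xPartial]⟩

theorem kernelNorm_eq (hG : IsOpen G) (hD : D ∈ weakDerivs m G E₀ Em σ) :
    kernelNorm m G E₀ Em σ = ⨆ α, mixedNorm G E₀ Em (D α) :=
  le_antisymm (iInf₂_le D hD) <| le_iInf₂ fun _ hD' =>
    iSup_mono fun α => (mixedNorm_congr (weakDerivs_ae_unique hG hD hD' α)).le

theorem kernelNorm'_eq (hG : IsOpen G) (hD : D ∈ weakDerivs m G E₀ Em σ) :
    kernelNorm' m G E₀ Em σ = ⨆ α, mixedNorm' G E₀ Em (D α) :=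
  le_antisymm (iInf₂_le D hD) <| le_iInf₂ fun _ hD' =>
    iSup_mono fun α => (mixedNorm'_congr (weakDerivs_ae_unique hG hD hD' α)).le

theorem exists_measurable_weakDerivs (h : kernelNorm' m G E₀ Em σ < ⊤) :
    ∃ D ∈ weakDerivs m G E₀ Em σ, ∀ α, Measurable (D α) := by
  simp only [kernelNorm', iInf_lt_iff] at h
  obtain ⟨D, hD, -⟩ := h
  exact ⟨fun α => (hD α).1.mk _, fun α => ⟨(hD α).1.stronglyMeasurable_mk.aestronglyMeasurable,
    (hD α).2.congr (EventuallyEq.refl _ _) (hD α).1.ae_eq_mk⟩,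
    fun α => (hD α).1.stronglyMeasurable_mk.measurable⟩

theorem weakDerivs_add (hD : D ∈ weakDerivs m G E₀ Em σ) (hD' : D' ∈ weakDerivs m G E₀ Em τ) :
    (fun α => D α + D' α) ∈ weakDerivs m G E₀ Em (σ + τ) :=
  fun α => ⟨(hD α).1.add (hD' α).1, (hD α).2.add (hD' α).2⟩

end WeakDerivs

/-! ### Integration by parts -/

section ByParts

variable {G : Set E3} {E₀ Em : ℝ} {φ u : Phase → ℝ}

instance : IsFiniteMeasureOnCompacts (phaseMeasure G E₀ Em) := by
  unfold phaseMeasure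
  infer_instance

theorem integrable_mul_isTest (hu : Continuous u) (hφ : IsTest G (univ ×ˢ Ioo E₀ Em) φ) :
    Integrable (fun p => u p * φ p) (phaseMeasure G E₀ Em) :=
  (hu.mul hφ.1.continuous).integrable_of_hasCompactSupport (hφ.2.1.mul_left (f := u))

theorem integral_xpd_eq_zero (hφ : IsTest G (univ ×ˢ Ioo E₀ Em) φ) (i : Fin 3) :
    ∫ p, xpd i φ p ∂phaseMeasure G E₀ Em = 0 := by
  have hint : Integrable (xpd i φ) (phaseMeasure G E₀ Em) := by
    simpa using integrable_mul_isTest continuous_const (u := fun _ => 1) (hφ.xpd i)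
  refine (integral_prod_symm _ hint).trans (integral_eq_zero_of_ae (ae_of_all _ fun y => ?_))
  have hslice {ψ : Phase → ℝ} (hψ : IsTest G (univ ×ˢ Ioo E₀ Em) ψ) :
      Integrable fun x => ψ (x, y) := by
    have hcont : Continuous fun x => ψ (x, y) := hψ.1.continuous.comp (by fun_prop)
    exact hcont.integrable_of_hasCompactSupport (.intro (hψ.2.1.image continuous_fst)
      fun x hx => image_eq_zero_of_notMem_tsupport fun h => hx ⟨(x, y), h, rfl⟩)
  have hparts := integral_mul_fderiv_eq_neg_fderiv_mul_of_integrable (𝕜 := ℝ) (μ := volume)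
    (f := fun _ : E3 => (1 : ℝ)) (g := fun x => φ (x, y)) (v := EuclideanSpace.single i 1)
    (by simp) (by simpa [xpd] using hslice (hφ.xpd i)) (by simpa using hslice hφ)
    (fun _ _ => by fun_prop) fun x _ => hφ.1.differentiable y x
  calc ∫ x in G, xpd i φ (x, y)
      = ∫ x, xpd i φ (x, y) := setIntegral_eq_integral_of_forall_compl_eq_zero fun x hx =>
        image_eq_zero_of_notMem_tsupport fun h => hx ((hφ.xpd i).2.2 h).1
    _ = 0 := by simpa [xpd] using hparts

theorem hasWeakXDeriv_xPartial (hu : ClassCX ⊤ u) (s : Multiset (Fin 3)) :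
    HasWeakXDeriv G (univ ×ˢ Ioo E₀ Em) (phaseMeasure G E₀ Em) (multiIndex s) u
      (xPartial (multiIndex s) u) := by
  have hone (i : Fin 3) : HasWeakXDeriv G (univ ×ˢ Ioo E₀ Em) (phaseMeasure G E₀ Em)
      (multiIndex {i}) 1 0 := fun φ hφ => by
    rw [xPartial_singleton hφ.1]
    exact ⟨integrable_mul_isTest continuous_const (hφ.xpd i), by simp,
      by simpa using integral_xpd_eq_zero hφ i⟩
  induction s using Multiset.induction_on with
  | empty => exact fun φ hφ => ⟨integrable_mul_isTest hu.continuous hφ,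
      integrable_mul_isTest hu.continuous hφ, by simp [xPartial_zero, sum_multiIndex]⟩
  | cons i s ih =>
    refine ih.cons ?_
    rw [xPartial_cons hu, xPartial_xpd hu]
    simpa only [one_mul, zero_mul, add_zero] using (hone i).mul_classCX
      (fun φ hφ => integrable_mul_isTest continuous_const hφ) (hu.xPartial (multiIndex s))

end ByParts

section AngularIntegral

variable {G : Set E3} {E₀ Em : ℝ}

theorem integral_kernelMeasure_mul {u : KernelDom → ℝ} {χ : Phase → ℝ} {g : S2 → ℝ}
    (h : Integrable (fun q => u q * (χ (q.1, q.2.2) * g q.2.1)) (kernelMeasure G E₀ Em)) :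
    Integrable (fun p => (∫ ω', u (p.1, ω', p.2.1, p.2.2) * g ω' ∂sphereMeasure) * χ p)
        (phaseMeasure G E₀ Em) ∧
      ∫ q, u q * (χ (q.1, q.2.2) * g q.2.1) ∂kernelMeasure G E₀ Em =
        ∫ p, (∫ ω', u (p.1, ω', p.2.1, p.2.2) * g ω' ∂sphereMeasure) * χ p
          ∂phaseMeasure G E₀ Em := by
  have mp := measurePreserving_toKernelDom G E₀ Em
  have hint := (mp.integrable_comp_emb toKernelDom.measurableEmbedding).2 h
  have hinner (p : Phase) : ∫ ω', u (p.1, ω', p.2.1, p.2.2) * (χ p * g ω') ∂sphereMeasure =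
      (∫ ω', u (p.1, ω', p.2.1, p.2.2) * g ω' ∂sphereMeasure) * χ p := by
    rw [← integral_mul_const]
    exact integral_congr_ae (ae_of_all _ fun ω' => by ring)
  refine ⟨hint.integral_prod_left.congr (ae_of_all _ hinner), ?_⟩
  rw [← mp.integral_comp toKernelDom.measurableEmbedding]
  exact (integral_prod _ hint).trans (integral_congr_ae (ae_of_all _ hinner))

theorem IsTest.kernelLift {φ : Phase → ℝ} (hφ : IsTest G (univ ×ˢ Ioo E₀ Em) φ) {g : S2 → ℝ}
    (hg : Continuous g) : IsTest G (univ ×ˢ (univ ×ˢ Ioo E₀ Em))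
      (fun q : KernelDom => φ (q.1, q.2.2) * g q.2.1) := by
  have hsub : tsupport (fun q : KernelDom => φ (q.1, q.2.2) * g q.2.1) ⊆
      {q | (q.1, q.2.2) ∈ tsupport φ} :=
    closure_minimal (fun q hq => subset_tsupport φ (left_ne_zero_of_mul hq))
      ((isClosed_tsupport φ).preimage (by fun_prop))
  have hcompact : IsCompact ((fun r : Phase × S2 => ((r.1.1, r.2, r.1.2) : KernelDom)) ''
      (tsupport φ ×ˢ univ)) :=
    (hφ.2.1.isCompact.prod isCompact_univ).image (by fun_prop)
  refine ⟨(hφ.1.comp_right continuous_snd).mul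
    (classCX_of_continuous (g := fun y : S2 × (S2 × ℝ) => g y.1) (by fun_prop)),
    hcompact.of_isClosed_subset (isClosed_tsupport _) fun q hq =>
      ⟨((q.1, q.2.2), q.2.1), ⟨hsub hq, mem_univ _⟩, rfl⟩, fun q hq => ?_⟩
  have := hφ.2.2 (hsub hq)
  exact ⟨this.1, mem_univ _, this.2⟩

theorem HasWeakXDeriv.integral_angle {u v : KernelDom → ℝ} {s : Multiset (Fin 3)}
    (h : HasWeakXDeriv G (univ ×ˢ (univ ×ˢ Ioo E₀ Em)) (kernelMeasure G E₀ Em)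
      (multiIndex s) u v) {g : S2 → ℝ} (hg : Continuous g) :
    HasWeakXDeriv G (univ ×ˢ Ioo E₀ Em) (phaseMeasure G E₀ Em) (multiIndex s)
      (fun p => ∫ ω', u (p.1, ω', p.2.1, p.2.2) * g ω' ∂sphereMeasure)
      (fun p => ∫ ω', v (p.1, ω', p.2.1, p.2.2) * g ω' ∂sphereMeasure) := by
  intro φ hφ
  obtain ⟨hu, hv, hparts⟩ := h _ (hφ.kernelLift hg)
  have hlift : xPartial (multiIndex s) (fun q : KernelDom => φ (q.1, q.2.2) * g q.2.1) =
      fun q => xPartial (multiIndex s) φ (q.1, q.2.2) * g q.2.1 :=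
    xPartial_mul_snd (hφ.1.comp_right continuous_snd) (g := fun y : S2 × (S2 × ℝ) => g y.1)
      (by fun_prop) s
  rw [hlift] at hu hparts
  obtain ⟨hu', hue⟩ := integral_kernelMeasure_mul hu
  obtain ⟨hv', hve⟩ := integral_kernelMeasure_mul hv
  exact ⟨hu', hv', by rw [← hue, ← hve, hparts]⟩

theorem integrable_of_mixedNorm'_lt_top (hG : Bornology.IsBounded G) {D : KernelDom → ℝ}
    (hD : Measurable D) (h : mixedNorm' G E₀ Em D < ⊤) : Integrable D (kernelMeasure G E₀ Em) := by
  have := isFiniteMeasure_phaseMeasure E₀ Em hG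
  have mp := (measurePreserving_toKernelDom G E₀ Em).comp (measurePreserving_swapAngles G E₀ Em)
  have hmeas : Measurable fun r => ‖D (toKernelDom (swapAngles r))‖ₑ :=
    (hD.comp mp.measurable).enorm
  refine ⟨hD.aestronglyMeasurable, ?_⟩
  calc ∫⁻ q, ‖D q‖ₑ ∂kernelMeasure G E₀ Em
      = ∫⁻ p, ∫⁻ ω, ‖D (p.1, p.2.1, ω, p.2.2)‖ₑ ∂sphereMeasure ∂phaseMeasure G E₀ Em :=
        (mp.lintegral_comp hD.enorm).symm.trans (lintegral_prod _ hmeas.aemeasurable)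
    _ ≤ ∫⁻ _, mixedNorm' G E₀ Em D ∂phaseMeasure G E₀ Em := lintegral_mono_ae ae_le_essSup
    _ < ⊤ := by
      rw [lintegral_const]
      exact ENNReal.mul_lt_top h (measure_lt_top _ _)

end AngularIntegral

/-! ### Smooth kernels -/

section SmoothKernel

variable {Y X : Type*} [TopologicalSpace Y] [NormedAddCommGroup X] [NormedSpace ℝ X]
  {G : Set E3} {E₀ Em : ℝ}

theorem exists_xPartial_clm_comp (s : Multiset (Fin 3)) {F : E3 × Y → X} (hF : ClassCX ⊤ F)
    (hFc : HasCompactSupport F) : ∃ F' : E3 × Y → X, Continuous F' ∧ HasCompactSupport F' ∧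
      ∀ L : X →L[ℝ] ℝ, xPartial (multiIndex s) (fun p => L (F p)) = fun p => L (F' p) := by
  induction s using Multiset.induction_on generalizing F with
  | empty => exact ⟨F, hF.continuous, hFc, fun L => xPartial_zero _⟩
  | cons i s ih =>
    obtain ⟨F', hF', hFc', hL⟩ := ih (hF.xpd i)
      (hFc.mono' ((subset_tsupport _).trans (tsupport_xpd_subset i F)))
    refine ⟨F', hF', hFc', fun L => ?_⟩
    rw [xPartial_cons (hF.clm_comp L), xpd_clm_comp L hF, hL]

/-- The pairing `⟨g, w⟩ = ∫ g w dω` of continuous and of integrable functions on the sphere. -/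
def pairing : C(S2, ℝ) →L[ℝ] Lp ℝ 1 sphereMeasure →L[ℝ] ℝ :=
  (ContinuousLinearMap.mul ℝ ℝ).lpPairing sphereMeasure ∞ 1 ∘L
    ContinuousMap.toLp ∞ sphereMeasure ℝ

theorem pairing_apply (g : C(S2, ℝ)) (w : Lp ℝ 1 sphereMeasure) :
    pairing g w = ∫ ω, w ω * g ω ∂sphereMeasure := by
  refine (ContinuousLinearMap.lpPairing_eq_integral _ _ _).trans (integral_congr_ae ?_)
  filter_upwards [ContinuousMap.coeFn_toLp (p := ∞) sphereMeasure (𝕜 := ℝ) g] with ω hω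
  exact (congrArg (· * w ω) hω).trans (mul_comm _ _)

theorem eq_zero_of_forall_pairing_eq_zero {w : Lp ℝ 1 sphereMeasure}
    (h : ∀ g, pairing g w = 0) : w = 0 := by
  have : Fact (Module.finrank ℝ E3 = 2 + 1) := ⟨finrank_euclideanSpace_fin⟩
  refine Lp.eq_zero_iff_ae_eq_zero.2 (ae_eq_zero_of_integral_contMDiff_smul_eq_zero
    (modelWithCornersSelf ℝ (EuclideanSpace ℝ (Fin 2)))
    (L1.integrable_coeFn w).locallyIntegrable fun g hg _ => ?_)
  simpa only [pairing_apply, smul_eq_mul, ContinuousMap.coe_mk, mul_comm] using h ⟨g, hg.continuous⟩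

theorem ae_ae_eq_of_forall_pairing {P : Type*} [MeasurableSpace P] {μ : Measure P}
    {d : P → S2 → ℝ} {F : P → Lp ℝ 1 sphereMeasure}
    (hd : ∀ᵐ p ∂μ, Integrable (d p) sphereMeasure)
    (h : ∀ g : C(S2, ℝ), ∀ᵐ p ∂μ, ∫ ω, d p ω * g ω ∂sphereMeasure = pairing g (F p)) :
    ∀ᵐ p ∂μ, d p =ᵐ[sphereMeasure] F p := by
  filter_upwards [hd, ae_all_iff.2 fun n => h (TopologicalSpace.denseSeq C(S2, ℝ) n)]
    with p hp hn
  have hzero (g : C(S2, ℝ)) : pairing g (hp.toL1 (d p) - F p) = 0 := by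
    refine congrFun ((TopologicalSpace.denseRange_denseSeq C(S2, ℝ)).equalizer
      (g := fun g => pairing g (hp.toL1 (d p) - F p)) (by fun_prop) continuous_const
      (funext fun n => ?_)) g
    simp only [Function.comp_apply]
    rw [map_sub, sub_eq_zero, ← hn n, pairing_apply]
    exact integral_congr_ae (hp.coeFn_toL1.mul (EventuallyEq.refl _ _))
  rw [← sub_eq_zero.1 (eq_zero_of_forall_pairing_eq_zero hzero)]
  exact hp.coeFn_toL1.symm

theorem IsSmoothKernel.exists_ae_eq_deriv (hG : IsOpen G) {τ D : KernelDom → ℝ}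
    {s : Multiset (Fin 3)} (hτ : IsSmoothKernel G E₀ Em τ)
    (hint : Integrable D (kernelMeasure G E₀ Em))
    (hD : HasWeakXDeriv G (univ ×ˢ (univ ×ˢ Ioo E₀ Em)) (kernelMeasure G E₀ Em)
      (multiIndex s) τ D) :
    ∃ F' : Phase → Lp ℝ 1 sphereMeasure, Continuous F' ∧ HasCompactSupport F' ∧
      ∀ᵐ p ∂phaseMeasure G E₀ Em,
        (fun ω' => D (p.1, ω', p.2.1, p.2.2)) =ᵐ[sphereMeasure] F' p := by
  obtain ⟨F, ⟨⟨F₁, hF₁, hF₁c, hFF⟩, -⟩, hτF⟩ := hτ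
  obtain ⟨F', hF', hF'c, hL⟩ := exists_xPartial_clm_comp s hF₁ hF₁c
  refine ⟨F', hF', hF'c, ae_ae_eq_of_forall_pairing
    (((measurePreserving_toKernelDom G E₀ Em).integrable_comp_emb
      toKernelDom.measurableEmbedding).2 hint).prod_right_ae fun g => ?_⟩
  have hτg : (fun p => ∫ ω', τ (p.1, ω', p.2.1, p.2.2) * g ω' ∂sphereMeasure)
      =ᵐ[phaseMeasure G E₀ Em] fun p => pairing g (F₁ p) := by
    filter_upwards [hτF, ae_mem_phaseDomain E₀ Em hG] with p hp hpG
    rw [← hFF hpG, pairing_apply]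
    exact integral_congr_ae (hp.mono fun ω' hω' => congrArg (· * g ω') hω')
  refine ((hD.integral_angle g.continuous).congr hτg (EventuallyEq.refl _ _)).ae_unique hG
    (isOpen_univ.prod isOpen_Ioo) (ae_mem_phaseDomain E₀ Em hG) ?_
  rw [← hL (pairing g)]
  exact hasWeakXDeriv_xPartial (hF₁.clm_comp (pairing g)) s

theorem IsSmoothKernel.mixedNorm_lt_top (hG : IsOpen G) {τ D : KernelDom → ℝ}
    {s : Multiset (Fin 3)} (hτ : IsSmoothKernel G E₀ Em τ)
    (hint : Integrable D (kernelMeasure G E₀ Em))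
    (hD : HasWeakXDeriv G (univ ×ˢ (univ ×ˢ Ioo E₀ Em)) (kernelMeasure G E₀ Em)
      (multiIndex s) τ D) : mixedNorm G E₀ Em D < ⊤ := by
  obtain ⟨F', hF', hF'c, hDF⟩ := hτ.exists_ae_eq_deriv hG hint hD
  obtain ⟨M, hM⟩ := hF'.bounded_above_of_compact_support hF'c
  refine (essSup_le_of_ae_le (ENNReal.ofReal M) ?_).trans_lt ENNReal.ofReal_lt_top
  filter_upwards [hDF] with p hp
  calc ∫⁻ ω', ‖D (p.1, ω', p.2.1, p.2.2)‖ₑ ∂sphereMeasure = ‖F' p‖ₑ := by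
        rw [Lp.enorm_def, eLpNorm_one_eq_lintegral_enorm]
        exact lintegral_congr_ae (hp.mono fun ω' hω' => congrArg _ hω')
    _ ≤ ENNReal.ofReal M := by
        rw [← ofReal_norm]
        exact ENNReal.ofReal_le_ofReal (hM p)

end SmoothKernel

/-! ### The collision operator on jets -/

section LeibnizOperator

variable {m : ℕ} {H : Type*} [NormedAddCommGroup H] [NormedSpace ℝ H]

/-- The action of a jet `T` of operators on jets of vectors which is prescribed by the Leibniz
rule. -/
def leibnizOp (T : MultiIdx m → H →L[ℝ] H) :
    PiLp 2 (fun _ : MultiIdx m => H) →L[ℝ] PiLp 2 (fun _ : MultiIdx m => H) :=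
  (PiLp.continuousLinearEquiv 2 ℝ fun _ : MultiIdx m => H).symm.toContinuousLinearMap ∘L
    ContinuousLinearMap.pi fun α => ((letters α.toFun).antidiagonal.map fun q =>
      T (.ofMultiset m q.1) ∘L PiLp.proj 2 (𝕜 := ℝ) (fun _ => H) (.ofMultiset m q.2)).sum

theorem leibnizOp_apply (T : MultiIdx m → H →L[ℝ] H) (u : PiLp 2 fun _ : MultiIdx m => H)
    (α : MultiIdx m) : leibnizOp T u α = ((letters α.toFun).antidiagonal.map fun q =>
      T (.ofMultiset m q.1) (u (.ofMultiset m q.2))).sum :=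
  (map_multiset_sum (ContinuousLinearMap.apply ℝ H u) _).trans (by simp [Function.comp_def])

theorem leibnizOp_apply_zero (T : MultiIdx m → H →L[ℝ] H) (u : PiLp 2 fun _ : MultiIdx m => H) :
    leibnizOp T u (.zero m) = T (.zero m) (u (.zero m)) := by
  simp [leibnizOp_apply, MultiIdx.letters_zero, MultiIdx.ofMultiset_zero]

theorem leibnizOp_sub (T T' : MultiIdx m → H →L[ℝ] H) :
    leibnizOp (T - T') = leibnizOp T - leibnizOp T' := by
  ext u α
  simp only [leibnizOp_apply, Pi.sub_apply, sub_apply, PiLp.sub_apply, Multiset.sum_map_sub]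

theorem norm_leibnizOp_le {T : MultiIdx m → H →L[ℝ] H} {N : ℝ} (hT : ∀ β, ‖T β‖ ≤ N) :
    ‖leibnizOp T‖ ≤ Fintype.card (MultiIdx m) * 2 ^ m * N := by
  have hN : 0 ≤ N := (norm_nonneg _).trans (hT (.zero m))
  refine ContinuousLinearMap.opNorm_le_bound _ (by positivity) fun u => ?_
  have hcomp (α : MultiIdx m) : ‖leibnizOp T u α‖ ≤ 2 ^ m * (N * ‖u‖) := by
    rw [leibnizOp_apply]
    calc _ ≤ _ := norm_multiset_sum_le _
      _ ≤ (letters α.toFun).antidiagonal.card • (N * ‖u‖) := by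
          rw [Multiset.map_map, ← Multiset.card_map]
          refine Multiset.sum_le_card_nsmul _ _ fun x hx => ?_
          obtain ⟨q, -, rfl⟩ := Multiset.mem_map.1 hx
          exact (T _).le_of_opNorm_le_of_le (hT _) (PiLp.norm_apply_le u _)
      _ ≤ 2 ^ m * (N * ‖u‖) := by
          rw [Multiset.card_antidiagonal, nsmul_eq_mul, Nat.cast_pow, Nat.cast_ofNat]
          gcongr
          exacts [one_le_two, α.card_letters_le]
  calc ‖leibnizOp T u‖ ≤ ∑ α, ‖leibnizOp T u α‖ := by
        rw [PiLp.norm_eq_of_L2]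
        exact Real.sqrt_le_iff.2 ⟨Finset.sum_nonneg fun _ _ => norm_nonneg _,
          Finset.sum_sq_le_sq_sum_of_nonneg fun _ _ => norm_nonneg _⟩
    _ ≤ Fintype.card (MultiIdx m) * (2 ^ m * (N * ‖u‖)) := by
        exact (Finset.sum_le_card_nsmul _ _ _ fun α _ => hcomp α).trans_eq
          (by rw [Finset.card_univ, nsmul_eq_mul])
    _ = Fintype.card (MultiIdx m) * 2 ^ m * N * ‖u‖ := by ring

end LeibnizOperator

section KernelJets

theorem SchurKernel.toCLM_eq_add {P A : Type*} [MeasurableSpace P] [MeasurableSpace A]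
    {μ : Measure P} {ν : Measure A} [SFinite μ] [SFinite ν] {s : P × A → P × A}
    {κ κ₁ κ₂ : P × A → ℝ} {N₁ N₂ M₁ M₂ L₁ L₂ : ℝ≥0} (h : SchurKernel μ ν s κ N₁ N₂)
    (h₁ : SchurKernel μ ν s κ₁ M₁ M₂) (h₂ : SchurKernel μ ν s κ₂ L₁ L₂)
    (hκ : κ =ᵐ[μ.prod ν] κ₁ + κ₂) : h.toCLM = h₁.toCLM + h₂.toCLM := by
  refine ContinuousLinearMap.ext fun f => Lp.ext ?_
  filter_upwards [h.coeFn_toCLM f, h₁.coeFn_toCLM f, h₂.coeFn_toCLM f,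
    Lp.coeFn_add (h₁.toCLM f) (h₂.toCLM f),
    h₁.ae_integrable (Lp.stronglyMeasurable f).measurable (Lp.memLp f),
    h₂.ae_integrable (Lp.stronglyMeasurable f).measurable (Lp.memLp f),
    Measure.ae_ae_of_ae_prod hκ] with p e e₁ e₂ eadd i₁ i₂ hp
  rw [add_apply, e, eadd, Pi.add_apply, e₁, e₂, schurFun, schurFun, schurFun,
    ← integral_add i₁ i₂]
  refine integral_congr_ae ?_
  filter_upwards [hp] with b hb
  rw [hb, Pi.add_apply, add_mul]

variable {m : ℕ} {G : Set E3} {E₀ Em : ℝ} {σ τ : KernelDom → ℝ}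
  {D D' D'' : MultiIdx m → KernelDom → ℝ} {N₁ N₂ M₁ M₂ ε : ℝ≥0}

/-- `D` is the jet of weak derivatives of the kernel `σ`, with measurable representatives whose
mixed norms are bounded by `N₁` and `N₂`. -/
structure IsKernelJet (m : ℕ) (G : Set E3) (E₀ Em : ℝ) (σ : KernelDom → ℝ)
    (D : MultiIdx m → KernelDom → ℝ) (N₁ N₂ : ℝ≥0) : Prop where
  mem : D ∈ weakDerivs m G E₀ Em σ
  measurable : ∀ α, Measurable (D α)
  mixedNorm_le : ∀ α, mixedNorm G E₀ Em (D α) ≤ N₁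
  mixedNorm'_le : ∀ α, mixedNorm' G E₀ Em (D α) ≤ N₂

theorem IsKernelJet.schurKernel (h : IsKernelJet m G E₀ Em σ D N₁ N₂) (α : MultiIdx m) :
    SchurKernel (phaseMeasure G E₀ Em) sphereMeasure swapAngles
      (fun r => D α (toKernelDom r)) N₁ N₂ :=
  schurKernel_of_mixedNorm_le (h.measurable α) (h.mixedNorm_le α) (h.mixedNorm'_le α)

theorem IsKernelJet.ae_toCLM_eq_collision (h : IsKernelJet m G E₀ Em σ D N₁ N₂) (α : MultiIdx m)
    {v : L2Phase G E₀ Em} {f : Phase → ℝ} (hv : v =ᵐ[phaseMeasure G E₀ Em] f) :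
    ∀ᵐ p ∂phaseMeasure G E₀ Em, Integrable (collisionIntegrand (D α) f p) sphereMeasure ∧
      (h.schurKernel α).toCLM v p = collision (D α) f p := by
  have hs := h.schurKernel α
  filter_upwards [hs.coeFn_toCLM v, schurFun_congr (κ := fun r => D α (toKernelDom r)) hs.mp hv,
    hs.ae_integrable (Lp.stronglyMeasurable v).measurable (Lp.memLp v),
    ae_ae_comp_fst_of_measurePreserving hs.mp hv] with p h1 h2 hint hcongr
  refine ⟨hint.congr ?_, h1.trans h2⟩
  filter_upwards [hcongr] with ω' hω'
  rw [hω']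
  rfl

/-- The operator which maps the jet of `ψ` to the jet of `∫ σ(x, ω', ω, E) ψ(x, ω', E) dω'`. -/
def IsKernelJet.op (h : IsKernelJet m G E₀ Em σ D N₁ N₂) :
    PiLp 2 (fun _ : MultiIdx m => L2Phase G E₀ Em) →L[ℝ]
      PiLp 2 (fun _ : MultiIdx m => L2Phase G E₀ Em) :=
  leibnizOp fun β => (h.schurKernel β).toCLM

theorem IsKernelJet.norm_op_le (h : IsKernelJet m G E₀ Em σ D N₁ N₂) :
    ‖h.op‖ ≤ Fintype.card (MultiIdx m) * 2 ^ m * √(N₁ * N₂) :=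
  norm_leibnizOp_le fun β => (h.schurKernel β).norm_toCLM_le

theorem IsKernelJet.norm_op_sub_le (hG : IsOpen G) (h : IsKernelJet m G E₀ Em σ D N₁ N₂)
    (h' : IsKernelJet m G E₀ Em τ D' M₁ M₂) (h'' : IsKernelJet m G E₀ Em (σ - τ) D'' ε ε) :
    ‖h.op - h'.op‖ ≤ Fintype.card (MultiIdx m) * 2 ^ m * ε := by
  rw [IsKernelJet.op, IsKernelJet.op, ← leibnizOp_sub]
  refine norm_leibnizOp_le fun β => ?_
  have hmem := weakDerivs_add h'.mem h''.mem
  rw [add_sub_cancel] at hmem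
  have hβ := (measurePreserving_toKernelDom G E₀ Em).quasiMeasurePreserving.ae_eq_comp
    (weakDerivs_ae_unique hG h.mem hmem β)
  rw [Pi.sub_apply, (h.schurKernel β).toCLM_eq_add (h'.schurKernel β) (h''.schurKernel β) hβ,
    add_sub_cancel_left]
  simpa using (h''.schurKernel β).norm_toCLM_le

theorem IsKernelJet.ae_op_apply_zero (hG : IsOpen G) (h : IsKernelJet m G E₀ Em σ D N₁ N₂)
    (u : PiLp 2 fun _ : MultiIdx m => L2Phase G E₀ Em) {f : Phase → ℝ}
    (hf : u (.zero m) =ᵐ[phaseMeasure G E₀ Em] f) :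
    ∀ᵐ p ∂phaseMeasure G E₀ Em, Integrable (collisionIntegrand σ f p) sphereMeasure ∧
      h.op u (.zero m) p = collision σ f p := by
  rw [IsKernelJet.op, leibnizOp_apply_zero]
  filter_upwards [h.ae_toCLM_eq_collision (.zero m) hf,
    ae_ae_of_ae_kernelMeasure (weakDerivs_zero_ae_eq hG h.mem)] with p ⟨hint, hp⟩ hσ
  have hcongr : collisionIntegrand (D (.zero m)) f p =ᵐ[sphereMeasure]
      collisionIntegrand σ f p := by
    filter_upwards [hσ] with ω' hω'
    rw [collisionIntegrand, hω', collisionIntegrand]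
  exact ⟨hint.congr hcongr, hp.trans (integral_congr_ae hcongr)⟩

theorem exists_isKernelJet_of_kernelNorm_le (hG : IsOpen G) (h₁ : kernelNorm m G E₀ Em σ ≤ N₁)
    (h₂ : kernelNorm' m G E₀ Em σ ≤ N₂) : ∃ D, IsKernelJet m G E₀ Em σ D N₁ N₂ := by
  obtain ⟨D, hD, hm⟩ := exists_measurable_weakDerivs (h₂.trans_lt ENNReal.coe_lt_top)
  rw [kernelNorm_eq hG hD] at h₁
  rw [kernelNorm'_eq hG hD] at h₂
  exact ⟨D, hD, hm, fun α => (le_iSup _ α).trans h₁, fun α => (le_iSup _ α).trans h₂⟩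

theorem exists_isKernelJet (hG : IsOpen G) (h₁ : kernelNorm m G E₀ Em σ < ⊤)
    (h₂ : kernelNorm' m G E₀ Em σ < ⊤) : ∃ D, IsKernelJet m G E₀ Em σ D
      (kernelNorm m G E₀ Em σ).toNNReal (kernelNorm' m G E₀ Em σ).toNNReal :=
  exists_isKernelJet_of_kernelNorm_le hG (ENNReal.coe_toNNReal h₁.ne).ge
    (ENNReal.coe_toNNReal h₂.ne).ge

theorem IsSmoothKernel.kernelNorm_lt_top (hG : IsOpen G) (hG' : Bornology.IsBounded G)
    (hτ : IsSmoothKernel G E₀ Em τ) (h : kernelNorm' m G E₀ Em τ < ⊤) :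
    kernelNorm m G E₀ Em τ < ⊤ := by
  obtain ⟨D, hD, hm⟩ := exists_measurable_weakDerivs h
  rw [kernelNorm'_eq hG hD] at h
  rw [kernelNorm_eq hG hD]
  rw [← Finset.sup_univ_eq_iSup, Finset.sup_lt_iff ENNReal.zero_lt_top]
  rintro α -
  have hα := (hD α).2
  rw [← multiIndex_letters α.toFun] at hα
  exact hτ.mixedNorm_lt_top hG
    (integrable_of_mixedNorm'_lt_top hG' (hm α) ((le_iSup _ α).trans_lt h)) hα

theorem kernelNorm_add_le (hG : IsOpen G) (hσ : kernelNorm' m G E₀ Em σ < ⊤)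
    (hτ : kernelNorm' m G E₀ Em τ < ⊤) :
    kernelNorm m G E₀ Em (σ + τ) ≤ kernelNorm m G E₀ Em σ + kernelNorm m G E₀ Em τ := by
  obtain ⟨D, hD, hm⟩ := exists_measurable_weakDerivs hσ
  obtain ⟨D', hD', -⟩ := exists_measurable_weakDerivs hτ
  rw [kernelNorm_eq hG hD, kernelNorm_eq hG hD', kernelNorm_eq hG (weakDerivs_add hD hD')]
  exact iSup_le fun α => (mixedNorm_add_le (hm α)).trans
    (add_le_add (le_iSup (fun α => mixedNorm G E₀ Em (D α)) α)
      (le_iSup (fun α => mixedNorm G E₀ Em (D' α)) α))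

theorem kernelNorm'_add_le (hG : IsOpen G) (hσ : kernelNorm' m G E₀ Em σ < ⊤)
    (hτ : kernelNorm' m G E₀ Em τ < ⊤) :
    kernelNorm' m G E₀ Em (σ + τ) ≤ kernelNorm' m G E₀ Em σ + kernelNorm' m G E₀ Em τ := by
  obtain ⟨D, hD, hm⟩ := exists_measurable_weakDerivs hσ
  obtain ⟨D', hD', -⟩ := exists_measurable_weakDerivs hτ
  rw [kernelNorm'_eq hG hD, kernelNorm'_eq hG hD', kernelNorm'_eq hG (weakDerivs_add hD hD')]
  exact iSup_le fun α => (mixedNorm'_add_le (hm α)).trans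
    (add_le_add (le_iSup (fun α => mixedNorm' G E₀ Em (D α)) α)
      (le_iSup (fun α => mixedNorm' G E₀ Em (D' α)) α))

theorem MemW0.kernelNorm_lt_top (hG : IsOpen G) (hG' : Bornology.IsBounded G)
    (hσ : MemW0 m G E₀ Em σ) :
    kernelNorm m G E₀ Em σ < ⊤ ∧ kernelNorm' m G E₀ Em σ < ⊤ := by
  obtain ⟨τ, -, hτ, hτ', hlt⟩ := hσ 1 one_pos
  obtain ⟨hlt₁, hlt₂⟩ := ENNReal.add_lt_top.1 (hlt.trans ENNReal.one_lt_top)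
  have hadd₁ := kernelNorm_add_le hG hτ' hlt₂
  have hadd₂ := kernelNorm'_add_le hG hτ' hlt₂
  rw [add_sub_cancel] at hadd₁ hadd₂
  exact ⟨hadd₁.trans_lt (ENNReal.add_lt_top.2 ⟨hτ.kernelNorm_lt_top hG hG' hτ', hlt₁⟩),
    hadd₂.trans_lt (ENNReal.add_lt_top.2 ⟨hτ', hlt₂⟩)⟩

end KernelJets

section Closedness

variable {m : ℕ} {G : Set E3} {E₀ Em : ℝ}

theorem IsTest.xPartial {Y : Type*} [TopologicalSpace Y] {V : Set Y} {φ : E3 × Y → ℝ}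
    (hφ : IsTest G V φ) (α : Fin 3 → ℕ) : IsTest G V (xPartial α φ) := by
  rw [← multiIndex_letters α]
  induction letters α using Multiset.induction_on generalizing φ with
  | empty => rwa [xPartial_zero]
  | cons i s ih => rw [xPartial_cons hφ.1]; exact ih (hφ.xpd i)

theorem IsTest.memLp {φ : Phase → ℝ} (hφ : IsTest G (univ ×ˢ Ioo E₀ Em) φ) :
    MemLp φ 2 (phaseMeasure G E₀ Em) :=
  hφ.1.continuous.memLp_of_hasCompactSupport hφ.2.1

theorem integrable_and_integral_mul_eq_inner {χ : Phase → ℝ}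
    (hχ : MemLp χ 2 (phaseMeasure G E₀ Em)) (u : L2Phase G E₀ Em) :
    Integrable (fun p => u p * χ p) (phaseMeasure G E₀ Em) ∧
      ∫ p, u p * χ p ∂phaseMeasure G E₀ Em = inner ℝ (hχ.toLp χ) u := by
  have hinner : (fun p => inner ℝ (hχ.toLp χ p) (u p)) =ᵐ[phaseMeasure G E₀ Em]
      fun p => u p * χ p := by
    filter_upwards [hχ.coeFn_toLp] with p hp
    simp [hp]
  exact ⟨(L2.integrable_inner _ _).congr hinner, (integral_congr_ae hinner).symm⟩

theorem hasWeakXDeriv_iff_inner {α : Fin 3 → ℕ} {u v : L2Phase G E₀ Em} :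
    HasWeakXDeriv G (univ ×ˢ Ioo E₀ Em) (phaseMeasure G E₀ Em) α u v ↔
      ∀ φ (hφ : IsTest G (univ ×ˢ Ioo E₀ Em) φ), inner ℝ ((hφ.xPartial α).memLp.toLp _) u =
        (-1) ^ (∑ i, α i) * inner ℝ (hφ.memLp.toLp φ) v := by
  refine forall₂_congr fun φ hφ => ?_
  obtain ⟨hu, hu'⟩ := integrable_and_integral_mul_eq_inner (hφ.xPartial α).memLp u
  obtain ⟨hv, hv'⟩ := integrable_and_integral_mul_eq_inner hφ.memLp v
  rw [hu', hv']
  exact ⟨fun h => h.2.2, fun h => ⟨hu, hv, h⟩⟩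

theorem isClosed_sobolevH (m : ℕ) (G : Set E3) (E₀ Em : ℝ) :
    IsClosed (sobolevH m G E₀ Em : Set (PiLp 2 fun _ : MultiIdx m => L2Phase G E₀ Em)) := by
  have hset : (sobolevH m G E₀ Em : Set (PiLp 2 fun _ : MultiIdx m => L2Phase G E₀ Em)) =
      {u | ∀ α : MultiIdx m, HasWeakXDeriv G (univ ×ˢ Ioo E₀ Em) (phaseMeasure G E₀ Em) α.toFun
        (u (.zero m)) (u α)} := rfl
  simp only [hset, hasWeakXDeriv_iff_inner, ofPred_forall]
  exact isClosed_iInter fun α => isClosed_iInter fun φ => isClosed_iInter fun hφ =>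
    isClosed_eq (by fun_prop) (by fun_prop)

/-- The space `H₀^{(m,0,0)}(G × S × I, Γ₋)`, seen as a space of jets. -/
def sobolevH0Jets (m : ℕ) (G : Set E3) (E₀ Em : ℝ) :
    Submodule ℝ (PiLp 2 fun _ : MultiIdx m => L2Phase G E₀ Em) :=
  (sobolevH0 m G E₀ Em).map (sobolevH m G E₀ Em).subtype

theorem isClosed_sobolevH0Jets (m : ℕ) (G : Set E3) (E₀ Em : ℝ) :
    IsClosed (sobolevH0Jets m G E₀ Em : Set (PiLp 2 fun _ : MultiIdx m => L2Phase G E₀ Em)) :=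
  (isClosed_sobolevH m G E₀ Em).isClosedEmbedding_subtypeVal.isClosedMap _
    (Submodule.isClosed_topologicalClosure _)

end Closedness

section SmoothKernelJets

variable {m : ℕ} {G : Set E3} {E₀ Em : ℝ} {σ τ : KernelDom → ℝ}
  {D : MultiIdx m → KernelDom → ℝ} {N₁ N₂ : ℝ≥0} {Ψ : E3 × ℝ → C(S2, ℝ)}

theorem ae_multiset_sum_eq_integral {P A Q ι : Type*} [MeasurableSpace P] [MeasurableSpace A]
    {μ : Measure P} {ν : Measure A} (r : P → A → Q) {t : Multiset ι} {w : ι → Lp ℝ 2 μ}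
    {k : ι → Q → ℝ} (h : ∀ j ∈ t, ∀ᵐ p ∂μ,
      Integrable (fun a => k j (r p a)) ν ∧ w j p = ∫ a, k j (r p a) ∂ν) :
    ∀ᵐ p ∂μ, Integrable (fun a => (t.map k).sum (r p a)) ν ∧
      (t.map w).sum p = ∫ a, (t.map k).sum (r p a) ∂ν := by
  induction t using Multiset.induction_on with
  | empty =>
    filter_upwards [Lp.coeFn_zero ℝ 2 μ] with p hp
    simpa using hp
  | cons j t ih =>
    simp only [Multiset.map_cons, Multiset.sum_cons]
    filter_upwards [h j (Multiset.mem_cons_self j t),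
      ih fun i hi => h i (Multiset.mem_cons_of_mem hi),
      Lp.coeFn_add (w j) (t.map w).sum] with p ⟨hj, hj'⟩ ⟨ht, ht'⟩ hadd
    refine ⟨hj.add ht, ?_⟩
    rw [hadd, Pi.add_apply, hj', ht', ← integral_add hj ht]
    rfl

/-- The function `f(x, ω', E)` of the variables `(x, ω', ω, E)`. -/
def incomingLift (f : Phase → ℝ) (q : KernelDom) : ℝ := f (q.1, q.2.1, q.2.2.2)

theorem ClassCX.incomingLift_evalAngle (hΨ : ClassCX ⊤ Ψ) :
    ClassCX ⊤ (incomingLift (evalAngle Ψ)) :=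
  hΨ.apply_continuousMap.comp_right (q := fun y : S2 × (S2 × ℝ) => (y.1, y.2.2)) (by fun_prop)

theorem isWeakJet_of_mem_weakDerivs (hG : IsOpen G) (hD : D ∈ weakDerivs m G E₀ Em σ) :
    IsWeakJet m G (univ ×ˢ (univ ×ˢ Ioo E₀ Em)) (kernelMeasure G E₀ Em)
      fun s => D (.ofMultiset m s) := by
  intro s hs
  have hDs := (hD (.ofMultiset m s)).2
  rw [MultiIdx.toFun_ofMultiset hs] at hDs
  refine hDs.congr ?_ .rfl
  simp only [MultiIdx.ofMultiset_zero]
  exact (weakDerivs_zero_ae_eq hG hD).symm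

/-- The Leibniz expression for the derivative `∂_x^s` of `σ(x, ω', ω, E) f(x, ω', E)`, where `D` is
the jet of `σ`. -/
def integrandJet (D : MultiIdx m → KernelDom → ℝ) (f : Phase → ℝ) :
    Multiset (Fin 3) → KernelDom → ℝ :=
  leibniz (fun s => D (.ofMultiset m s)) fun s => incomingLift (xPartial (multiIndex s) f)

theorem HasWeakXDeriv.integral_integrandJet (hG : IsOpen G) (hD : D ∈ weakDerivs m G E₀ Em σ)
    {f : Phase → ℝ} (hf : ClassCX ⊤ (incomingLift f)) {s : Multiset (Fin 3)} (hs : s.card ≤ m) :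
    HasWeakXDeriv G (univ ×ˢ Ioo E₀ Em) (phaseMeasure G E₀ Em) (multiIndex s)
      (fun p => ∫ ω', integrandJet D f 0 (p.1, ω', p.2.1, p.2.2) ∂sphereMeasure)
      (fun p => ∫ ω', integrandJet D f s (p.1, ω', p.2.1, p.2.2) ∂sphereMeasure) := by
  have hweak := HasWeakXDeriv.integral_angle
    ((isWeakJet_of_mem_weakDerivs hG hD).leibniz hf s hs) (g := fun _ => 1) continuous_const
  simp only [mul_one] at hweak
  exact hweak

theorem IsKernelJet.op_apply_ae_eq (h : IsKernelJet m G E₀ Em σ D N₁ N₂)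
    {u : PiLp 2 fun _ : MultiIdx m => L2Phase G E₀ Em} {f : Phase → ℝ}
    (hu : ∀ α, u α =ᵐ[phaseMeasure G E₀ Em] xPartial α.toFun f) (α : MultiIdx m) :
    h.op u α =ᵐ[phaseMeasure G E₀ Em] fun p =>
      ∫ ω', integrandJet D f (letters α.toFun) (p.1, ω', p.2.1, p.2.2) ∂sphereMeasure := by
  rw [IsKernelJet.op, leibnizOp_apply]
  refine (ae_multiset_sum_eq_integral (fun p ω' => (p.1, ω', p.2.1, p.2.2))
    (k := fun q : Multiset (Fin 3) × Multiset (Fin 3) =>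
      D (.ofMultiset m q.1) * incomingLift (xPartial (multiIndex q.2) f))
    fun q hq => ?_).mono fun p hp => hp.2
  have hcard : q.2.card ≤ m :=
    (Multiset.card_le_card (Multiset.le_add_left _ _)).trans
      ((congrArg _ (Multiset.mem_antidiagonal.1 hq)).trans_le α.card_letters_le)
  have hq' := hu (.ofMultiset m q.2)
  rw [MultiIdx.toFun_ofMultiset hcard] at hq'
  exact h.ae_toCLM_eq_collision _ hq'

theorem IsKernelJet.mapsTo_op_smoothJets (hG : IsOpen G) (h : IsKernelJet m G E₀ Em σ D N₁ N₂) :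
    MapsTo h.op (smoothJets m G E₀ Em) (sobolevH m G E₀ Em) := by
  rintro u ⟨Ψ, hΨ, hu⟩ α
  have hzero := h.op_apply_ae_eq hu (.zero m)
  rw [MultiIdx.letters_zero] at hzero
  have hweak := HasWeakXDeriv.integral_integrandJet hG h.mem hΨ.incomingLift_evalAngle
    α.card_letters_le
  rw [multiIndex_letters] at hweak
  exact hweak.congr hzero.symm (h.op_apply_ae_eq hu α).symm

theorem ClassC0.of_le {X : Type*} [NormedAddCommGroup X] [NormedSpace ℝ X] {k l : ℕ∞}
    {f : Phase → X} (hf : ClassC0 k G E₀ Em f) (h : l ≤ k) : ClassC0 l G E₀ Em f :=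
  ⟨hf.1.imp fun _ hF => ⟨hF.1.of_le h, hF.2⟩, hf.2⟩

theorem IsSmoothKernel.exists_classC0_collision (hτ : IsSmoothKernel G E₀ Em τ)
    (hΨ : ClassCX ⊤ Ψ) : ∃ k : Phase → ℝ, ClassC0 ⊤ G E₀ Em k ∧
      collision τ (evalAngle Ψ) =ᵐ[phaseMeasure G E₀ Em] k := by
  obtain ⟨F, ⟨⟨F₁, hF₁, hF₁c, hFF₁⟩, hdisj⟩, hτF⟩ := hτ
  have hΨ' : ClassCX ⊤ fun p : Phase => Ψ (p.1, p.2.2) := hΨ.comp_right continuous_snd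
  have hsupp (F : Phase → Lp ℝ 1 sphereMeasure) :
      (Function.support fun p => pairing (Ψ (p.1, p.2.2)) (F p)) ⊆ Function.support F :=
    fun p hp h0 => hp (by simp [h0])
  refine ⟨fun p => pairing (Ψ (p.1, p.2.2)) (F p), ⟨⟨fun p => pairing (Ψ (p.1, p.2.2)) (F₁ p),
    hΨ'.bilin pairing hF₁, hF₁c.mono (hsupp F₁), fun p hp => ?_⟩,
    hdisj.mono_left (closure_mono (inter_subset_inter_left _ (hsupp F)))⟩, ?_⟩
  · simp only [hFF₁ hp]
  · filter_upwards [hτF] with p hp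
    rw [pairing_apply]
    refine integral_congr_ae ?_
    filter_upwards [hp] with ω' hω'
    rw [collisionIntegrand, hω', evalAngle]

theorem IsKernelJet.mapsTo_op_smoothJets_of_isSmoothKernel (hG : IsOpen G)
    (h : IsKernelJet m G E₀ Em τ D N₁ N₂) (hτ : IsSmoothKernel G E₀ Em τ) :
    MapsTo h.op (smoothJets m G E₀ Em) (sobolevH0Jets m G E₀ Em) := by
  intro u hu
  have hmem := h.mapsTo_op_smoothJets hG hu
  obtain ⟨Ψ, hΨ, hu⟩ := hu
  obtain ⟨k, hk, hτk⟩ := hτ.exists_classC0_collision hΨ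
  have hzero : h.op u (.zero m) =ᵐ[phaseMeasure G E₀ Em] collision τ (evalAngle Ψ) :=
    (h.ae_op_apply_zero hG u (hu (.zero m))).mono fun p hp => hp.2
  exact ⟨⟨h.op u, hmem⟩, subset_closure ⟨k, fun n _ => hk.of_le le_top, hzero.trans hτk⟩, rfl⟩

theorem IsKernelJet.op_mem_of_isSmoothKernel (hG : IsOpen G) (hG' : Bornology.IsBounded G)
    (hconv : Convex ℝ G) (h : IsKernelJet m G E₀ Em τ D N₁ N₂) (hτ : IsSmoothKernel G E₀ Em τ)
    (ψ : sobolevH m G E₀ Em) : h.op ψ ∈ sobolevH0Jets m G E₀ Em :=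
  closure_minimal (h.mapsTo_op_smoothJets_of_isSmoothKernel hG hτ)
    ((isClosed_sobolevH0Jets m G E₀ Em).preimage h.op.continuous)
    (sobolevH_subset_closure_smoothJets m hG hG' hconv ψ.2)

theorem IsKernelJet.op_mem_sobolevH0Jets (hG : IsOpen G) (hG' : Bornology.IsBounded G)
    (hconv : Convex ℝ G) (h : IsKernelJet m G E₀ Em σ D N₁ N₂) (hσ : MemW0 m G E₀ Em σ)
    (ψ : sobolevH m G E₀ Em) : h.op ψ ∈ sobolevH0Jets m G E₀ Em := by
  have hclosed : IsClosed {T : _ →L[ℝ] _ | T (ψ : PiLp 2 fun _ : MultiIdx m => L2Phase G E₀ Em) ∈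
      sobolevH0Jets m G E₀ Em} :=
    (isClosed_sobolevH0Jets m G E₀ Em).preimage (ContinuousLinearMap.apply ℝ _ ψ.1).continuous
  refine hclosed.closure_subset (Metric.mem_closure_iff.2 fun ε hε => ?_)
  obtain ⟨δ, hδ, hlt⟩ := exists_pos_mul_lt hε (Fintype.card (MultiIdx m) * 2 ^ m)
  lift δ to ℝ≥0 using hδ.le
  obtain ⟨τ, -, hτ, hτ', hdist⟩ := hσ δ (by exact_mod_cast hδ)
  obtain ⟨D', h'⟩ := exists_isKernelJet hG (hτ.kernelNorm_lt_top hG hG' hτ') hτ'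
  obtain ⟨D'', h''⟩ := exists_isKernelJet_of_kernelNorm_le hG (le_self_add.trans hdist.le)
    (le_add_self.trans hdist.le)
  exact ⟨h'.op, h'.op_mem_of_isSmoothKernel hG hG' hconv hτ ψ,
    (dist_eq_norm h.op h'.op).trans_lt ((h.norm_op_sub_le hG h' h'').trans_lt hlt)⟩

end SmoothKernelJets

theorem exists_clm_of_mem_map_subtype {V : Type*} [NormedAddCommGroup V] [NormedSpace ℝ V]
    {H : Submodule ℝ V} {H₀ : Submodule ℝ H} {T : V →L[ℝ] V}
    (hT : ∀ ψ : H, T ψ ∈ H₀.map H.subtype) :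
    ∃ K : H →L[ℝ] H₀, (∀ ψ, ((K ψ : H) : V) = T ψ) ∧ ‖K‖ ≤ ‖T‖ := by
  have hH (ψ : H) : T ψ ∈ H := Submodule.map_subtype_le H H₀ (hT ψ)
  have hH₀ (ψ : H) : (T ∘L H.subtypeL).codRestrict H hH ψ ∈ H₀ := by
    obtain ⟨φ, hφ, hφT⟩ := hT ψ
    rwa [show (T ∘L H.subtypeL).codRestrict H hH ψ = φ from Subtype.ext hφT.symm]
  exact ⟨((T ∘L H.subtypeL).codRestrict H hH).codRestrict H₀ hH₀, fun _ => rfl,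
    ContinuousLinearMap.opNorm_le_bound _ (norm_nonneg T) fun ψ => T.le_opNorm ψ⟩

theorem eventually_nonpos_of_mem_interior_closure {X : Type*} [TopologicalSpace X] {G : Set X}
    {y : X} {ρ : X → ℝ} (hy : y ∈ interior (closure G)) (hρ : Continuous ρ)
    (hG : ∀ᶠ x in 𝓝 y, x ∈ G → ρ x < 0) : ∀ᶠ x in 𝓝 y, ρ x ≤ 0 := by
  filter_upwards [(isOpen_interior.eventually_mem hy).and hG |>.eventually_nhds] with x hx
  by_contra! hpos
  obtain ⟨z, ⟨hzpos, -, hz⟩, hzG⟩ := mem_closure_iff_nhds.1 (interior_subset hx.self_of_nhds.1) _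
    ((hρ.continuousAt.eventually (lt_mem_nhds hpos)).and hx)
  exact (hz hzG).not_gt hzpos

theorem interior_closure_of_hasSmoothBoundary {G : Set E3} (hG : IsOpen G)
    (hs : HasSmoothBoundary G) : interior (closure G) = G := by
  refine Subset.antisymm (fun y hy => ?_) (interior_maximal subset_closure hG)
  by_contra hyG
  obtain ⟨ρ, hρ, hρy, hgrad, hev⟩ := hs y ⟨interior_subset hy, by rwa [hG.interior_eq]⟩
  have hmax : IsLocalMax ρ y := by
    simpa only [IsLocalMax, IsMaxFilter, hρy] using eventually_nonpos_of_mem_interior_closure hy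
      hρ.continuous (hev.mono fun _ h => h.1)
  exact hgrad (by simp [gradient, hmax.fderiv_eq_zero])

end Transport

end

theorem theorem3p9_general (m : ℕ) :
    ∃ C : ℝ, 0 < C ∧
      ∀ (G : Set Transport.E3) (E₀ Em : ℝ) (σ : Transport.KernelDom → ℝ),
        IsOpen G → Bornology.IsBounded G → Convex ℝ G → Transport.MemW0 m G E₀ Em σ →
        ∃ K : Transport.sobolevH m G E₀ Em →L[ℝ] Transport.sobolevH0 m G E₀ Em,
          (∀ (ψ : Transport.sobolevH m G E₀ Em) (f : Transport.Phase → ℝ),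
            Transport.toL2 ψ =ᵐ[Transport.phaseMeasure G E₀ Em] f →
            ∀ᵐ p ∂Transport.phaseMeasure G E₀ Em,
              MeasureTheory.Integrable (Transport.collisionIntegrand σ f p)
                Transport.sphereMeasure ∧
              Transport.toL2 (K ψ : Transport.sobolevH m G E₀ Em) p = Transport.collision σ f p) ∧
          Transport.kernelNorm m G E₀ Em σ < ⊤ ∧ Transport.kernelNorm' m G E₀ Em σ < ⊤ ∧
          ‖K‖ ^ 2 ≤ C * (Transport.kernelNorm m G E₀ Em σ).toReal *
            (Transport.kernelNorm' m G E₀ Em σ).toReal := by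
  have : Nonempty (Transport.MultiIdx m) := ⟨.zero m⟩
  refine ⟨(Fintype.card (Transport.MultiIdx m) * 2 ^ m) ^ 2, by positivity, ?_⟩
  intro G E₀ Em σ hG hG' hconv hσ
  obtain ⟨h₁, h₂⟩ := hσ.kernelNorm_lt_top hG hG'
  obtain ⟨D, hD⟩ := Transport.exists_isKernelJet hG h₁ h₂
  obtain ⟨K, hK, hnorm⟩ :=
    Transport.exists_clm_of_mem_map_subtype (hD.op_mem_sobolevH0Jets hG hG' hconv hσ)
  refine ⟨K, fun ψ f hf => ?_, h₁, h₂, ?_⟩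
  · simpa only [Transport.toL2, hK] using hD.ae_op_apply_zero hG ψ.1 hf
  · calc ‖K‖ ^ 2 ≤ _ := pow_le_pow_left₀ (norm_nonneg K) (hnorm.trans hD.norm_op_le) 2
      _ = _ := by
        rw [mul_pow, Real.sq_sqrt (by positivity), ENNReal.coe_toNNReal_eq_toReal,
          ENNReal.coe_toNNReal_eq_toReal, mul_assoc]

theorem theorem3p9 (m : ℕ) :
    ∃ C : ℝ, 0 < C ∧
      ∀ (G : Set Transport.E3) (E₀ Em : ℝ) (σ : Transport.KernelDom → ℝ),
        IsOpen G → Bornology.IsBounded G → Transport.HasSmoothBoundary G →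
        StrictConvex ℝ (closure G) → 0 ≤ E₀ → E₀ < Em →
        Measurable σ →
        (∀ x ∈ G, ∀ ω' ω : Transport.S2, ∀ E ∈ Set.Icc E₀ Em, 0 ≤ σ (x, ω', ω, E)) →
        Transport.MemW0 m G E₀ Em σ →
        ∃ K : Transport.sobolevH m G E₀ Em →L[ℝ] Transport.sobolevH0 m G E₀ Em,
          (∀ (ψ : Transport.sobolevH m G E₀ Em) (f : Transport.Phase → ℝ),
            Transport.toL2 ψ =ᵐ[Transport.phaseMeasure G E₀ Em] f →
            ∀ᵐ p ∂Transport.phaseMeasure G E₀ Em,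
              MeasureTheory.Integrable (Transport.collisionIntegrand σ f p)
                Transport.sphereMeasure ∧
              Transport.toL2 (K ψ : Transport.sobolevH m G E₀ Em) p = Transport.collision σ f p) ∧
          Transport.kernelNorm m G E₀ Em σ < ⊤ ∧ Transport.kernelNorm' m G E₀ Em σ < ⊤ ∧
          ‖K‖ ^ 2 ≤ C * (Transport.kernelNorm m G E₀ Em σ).toReal *
            (Transport.kernelNorm' m G E₀ Em σ).toReal := by
  obtain ⟨C, hC, h⟩ := theorem3p9_general m
  exact ⟨C, hC, fun G E₀ Em σ hG hG' hs hconv _ _ _ _ => h G E₀ Em σ hG hG'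
    (Transport.interior_closure_of_hasSmoothBoundary hG hs ▸ hconv.convex.interior)⟩
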